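/- Let $0\le\alpha<1$ and $\theta>-\alpha$. **Definitions.** Let $\Delta$ be the set of sequences $x_1\ge x_2\ge\dots>0$ with $\sum_i x_i=1$, and write $y^\downarrow$ for the decreasing rearrangement of $y$. - If $b_1,b_2,\dots$ are independent with $b_n\sim\mathrm{Beta}(1-\alpha,\theta+n\alpha)$, then $\mathrm{GEM}(\alpha,\theta)$ is the law of $\tilde X$, where $\tilde X_n=(1-b_1)\cdots(1-b_{n-1})b_n$, and $\mathrm{PD}(\alpha,\theta)$ is the law of $\tilde X^\downarrow$. - For $x\in\Delta$, $\mathrm{Frag}_\alpha(x)$ is the random sequence obtained as follows: pick an index $I$ with $\mathbb P(I=i)=x_i$ and, independently, $\eta\sim\mathrm{PD}(\alpha,1-\alpha)$; replace the entry $x_I$ by the entries $x_I\eta_1,x_I\eta_2,\dots$; and rank. - For $x\in\Delta$, $\mathrm{Coag}_{\alpha,\theta}(x)$ is the random sequence obtained as follows: let $B\sim\mathrm{Beta}((1-\alpha)/\alpha,(\theta+\alpha)/\alpha)$ if $\alpha>0$ and $B=1/(\theta+1)$ if $\alpha=0$; given $B$, let $I_1,I_2,\dots$ be i.i.d. Bernoulli$(B)$;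 replace all entries $x_j$ with $I_j=1$ by the single entry $\sum_{j:I_j=1}x_j$; and rank. - An exchangeable $(\alpha,\theta)$ partition of an infinite set $A\subseteq\mathbb N=\{1,2,\dots\}$ is a random partition with the following law: generate $Y\sim\mathrm{PD}(\alpha,\theta)$; given $Y$, assign each element of $A$ independently to block $j$ with probability $Y_j$. Blocks are listed in increasing order of their smallest elements. The asymptotic frequency of $B\subseteq A$ is $\lim_n |B\cap\{1,\dots,n\}|/|A\cap\{1,\dots,n\}|$, if this limit exists. - The $(\alpha,\theta)$-recursive tree on $\{0,1,2,\dots\}$ is the random tree that starts with the root $0$ and its child $1$; then vertices $2,3,\dots$ are added in turn, each as a child of an existing vertex chosen with probability proportional to its weight. The weight is $\theta+\alpha k_0$ for the root $0$ and $1-\alpha+\alpha k_j$ for a vertex $j\ge1$, where $k_j$ is the current number of children of $j$. **Theorem.** In an $(\alpha,\theta)$-recursive tree, for $i\ge0$ let $B^{(i)}_1,B^{(i)}_2,\dots$ be the vertex sets of the subtrees that remain when the vertices $0,1,\dots,i$ are removed, in increasing order of smallest element. Then: 1. For every $i\ge0$, the blocks $B^{(i)}_1,B^{(i)}_2,\dots$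 form an exchangeable $(\alpha,\theta+i)$ partition of $\mathbb N\setminus\{1,\dots,i\}$. 2. Almost surely, for all $i\ge 0$ and $k\ge1$, the asymptotic frequency $F^{(i)}_k$ of $B^{(i)}_k$ relative to $\mathbb N\setminus\{1,\dots,i\}$ exists, and $G^{(i)}:=(F^{(i)})^\downarrow\in\Delta$. Moreover $F^{(i)}\sim\mathrm{GEM}(\alpha,\theta+i)$ for every $i\ge0$. 3. $(G^{(i)},i\ge0)$ is a Markov chain: for every $i\ge0$, conditional on $G^{(0)},\dots,G^{(i)}$, the law of $G^{(i+1)}$ is that of $\mathrm{Frag}_\alpha(G^{(i)})$; in particular this is its law conditional on $G^{(i)}$. 4. For every $i\ge0$, conditional on $G^{(i+1)}$, the law of $G^{(i)}$ is that of $\mathrm{Coag}_{\alpha,\theta+i}(G^{(i+1)})$. Consequently, for random variables $X$ and $Y$ with values in $\Delta$ on a common probability space, the following are equivalent: (a) $X\sim\mathrm{PD}(\alpha,\theta)$ and, conditional on $X$, $Y\sim\mathrm{Frag}_\alpha(X)$; (b) $Y\sim\mathrm{PD}(\alpha,\theta+1)$ and, conditional on $Y$, $X\sim\mathrm{Coag}_{\alpha,\theta}(Y)$.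 -/

import Mathlib

open MeasureTheory ProbabilityTheory

namespace FragCoag

/-! ### Ranked sequences -/

/-- The decreasing rearrangement of a countable family of nonnegative numbers:
`rank x n` is the `(n+1)`-st largest value of `x`, counted with multiplicity, written as the
supremum over all sets `s` of `n + 1` indices of the smallest value of `x` on `s`. It is used for
summable families only. When fewer than `n + 1` indices exist the value is `0`. -/
noncomputable def rank {ι : Type*} (x : ι → ℝ) (n : ℕ) : ℝ :=
  ⨆ s : {s : Finset ι // s.card = n + 1}, ⨅ j : s.1, x j

/-- The space of decreasing sequences of positive numbers with sum one. -/
def massPartitions : Set (ℕ → ℝ) :=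
  {x | (∀ i, 0 < x i) ∧ Antitone x ∧ HasSum x 1}

theorem measurable_rank {ι : Type*} [Countable ι] :
    Measurable (rank : (ι → ℝ) → ℕ → ℝ) := by
  refine measurable_pi_lambda _ fun n => ?_
  exact Measurable.iSup fun s => Measurable.iInf fun j => measurable_pi_apply _

theorem measurableSet_massPartitions : MeasurableSet massPartitions := by
  have h : massPartitions = {x : ℕ → ℝ | (∀ i, 0 < x i)} ∩ {x | ∀ i j, i ≤ j → x j ≤ x i} ∩
      {x | ∑' i, ENNReal.ofReal (x i) = 1} := by
    ext x
    simp only [massPartitions, Set.mem_ofPred_eq, Set.mem_inter_iff, Antitone]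
    constructor
    · rintro ⟨h0, h1, h2⟩
      refine ⟨⟨h0, h1⟩, ?_⟩
      rw [← ENNReal.ofReal_tsum_of_nonneg (fun i => (h0 i).le) h2.summable, h2.tsum_eq]
      simp
    · rintro ⟨⟨h0, h1⟩, h2⟩
      refine ⟨h0, fun i j hij => h1 i j hij, ?_⟩
      have hs : Summable x := by
        have := ENNReal.summable_toReal (f := fun i => ENNReal.ofReal (x i)) (by simp [h2])
        simpa [ENNReal.toReal_ofReal (h0 _).le] using this
      have h3 : ENNReal.ofReal (∑' i, x i) = 1 := by
        rw [ENNReal.ofReal_tsum_of_nonneg (fun i => (h0 i).le) hs, h2]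
      rw [ENNReal.ofReal_eq_one] at h3
      rw [← h3]
      exact hs.hasSum
  rw [h]
  refine ((?_ : MeasurableSet _).inter ?_).inter ?_
  · simp only [Set.ofPred_forall]
    exact MeasurableSet.iInter fun i =>
      measurableSet_lt measurable_const (measurable_pi_apply i)
  · simp only [Set.ofPred_forall]
    exact MeasurableSet.iInter fun i => MeasurableSet.iInter fun j => MeasurableSet.iInter fun _ =>
      measurableSet_le (measurable_pi_apply j) (measurable_pi_apply i)
  · exact measurableSet_eq_fun
      (Measurable.tsum fun i => (measurable_pi_apply i).ennreal_ofReal) measurable_const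

/-! ### The GEM and Poisson–Dirichlet distributions -/

/-- Stick breaking: `b₀, (1 - b₀) b₁, (1 - b₀)(1 - b₁) b₂, …`. -/
noncomputable def stickBreaking (b : ℕ → ℝ) (n : ℕ) : ℝ :=
  (∏ m ∈ Finset.range n, (1 - b m)) * b n

/-- The Griffiths–Engen–McCloskey distribution: the law of the stick-breaking sequence built from
independent variables, the `n`-th of which (`n = 1, 2, …`) has law `Beta(1 - α, θ + n α)`. -/
noncomputable def GEM (α θ : ℝ) : Measure (ℕ → ℝ) :=
  (Measure.infinitePi fun n : ℕ => betaMeasure (1 - α) (θ + (n + 1) * α)).map stickBreaking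

/-- The two-parameter Poisson–Dirichlet distribution: the law of the ranked GEM sequence. -/
noncomputable def PD (α θ : ℝ) : Measure (ℕ → ℝ) :=
  (GEM α θ).map rank

theorem measurable_stickBreaking : Measurable stickBreaking := by
  unfold stickBreaking
  fun_prop

theorem isProbabilityMeasure_GEM {α θ : ℝ} (hα0 : 0 ≤ α) (hα1 : α < 1) (hθ : -α < θ) :
    IsProbabilityMeasure (GEM α θ) := by
  have h (n : ℕ) : IsProbabilityMeasure (betaMeasure (1 - α) (θ + (n + 1) * α)) := by
    refine isProbabilityMeasureBeta (by linarith) ?_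
    have : 0 ≤ (n : ℝ) * α := by positivity
    linarith
  exact Measure.isProbabilityMeasure_map measurable_stickBreaking.aemeasurable

theorem isProbabilityMeasure_PD {α θ : ℝ} (hα0 : 0 ≤ α) (hα1 : α < 1) (hθ : -α < θ) :
    IsProbabilityMeasure (PD α θ) := by
  have := isProbabilityMeasure_GEM hα0 hα1 hθ
  exact Measure.isProbabilityMeasure_map measurable_rank.aemeasurable

instance isFiniteMeasure_PD (α θ : ℝ) : IsFiniteMeasure (PD α θ) := by
  have : IsFiniteMeasure
      (Measure.infinitePi fun n : ℕ => betaMeasure (1 - α) (θ + (n + 1) * α)) := by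
    by_cases h : ∀ n : ℕ, IsProbabilityMeasure (betaMeasure (1 - α) (θ + (n + 1) * α))
    · infer_instance
    · rw [Measure.infinitePi, dif_neg h]
      infer_instance
  unfold PD GEM
  infer_instance

/-! ### Choosing an index -/

open Classical in
/-- The law of a random index `I` with `ℙ(I = i) = xᵢ`, for a mass partition `x`
(for other sequences the value is a placeholder). -/
noncomputable def pickLaw (x : ℕ → ℝ) : Measure ℕ :=
  if x ∈ massPartitions then
    Measure.sum fun i => ENNReal.ofReal (x i) • Measure.dirac i
  else Measure.dirac 0

instance isProbabilityMeasure_pickLaw (x : ℕ → ℝ) : IsProbabilityMeasure (pickLaw x) := by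
  unfold pickLaw
  split_ifs with h
  · constructor
    simp only [MeasurableSet.univ, Measure.sum_apply, Measure.smul_apply, measure_univ,
      smul_eq_mul, mul_one]
    rw [← ENNReal.ofReal_tsum_of_nonneg (fun i => (h.1 i).le) h.2.2.summable, h.2.2.tsum_eq]
    simp
  · infer_instance

theorem measurable_pickLaw : Measurable pickLaw := by
  classical
  refine Measurable.ite measurableSet_massPartitions ?_ measurable_const
  refine Measure.measurable_of_measurable_coe _ fun s hs => ?_
  simp only [hs, Measure.sum_apply, Measure.smul_apply, smul_eq_mul]
  exact Measurable.tsum fun i => ((measurable_pi_apply i).ennreal_ofReal).mul_const _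

/-- Infinite powers of a measurable family of probability measures are measurable. -/
theorem measurable_infinitePi_const {Y Z : Type*} [MeasurableSpace Y] [MeasurableSpace Z]
    {κ : Y → Measure Z} [∀ y, IsProbabilityMeasure (κ y)] (hκ : Measurable κ) :
    Measurable fun y => Measure.infinitePi fun _ : ℕ => κ y := by
  refine Measurable.measure_of_isPiSystem_of_isProbabilityMeasure
    (generateFrom_squareCylinders (α := fun _ : ℕ => Z)).symm
    (isPiSystem_squareCylinders (fun _ => MeasurableSpace.isPiSystem_measurableSet) (by simp)) ?_
  rintro - ⟨s, t, ht, rfl⟩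
  simp only [Set.mem_univ_pi, Set.mem_ofPred_eq] at ht
  simp_rw [Measure.infinitePi_pi _ (fun i _ => ht i)]
  exact Finset.measurable_prod _ fun i _ => (Measure.measurable_coe (ht i)).comp hκ

/-! ### The fragmentation operator -/

/-- The ranked sequence obtained from `x` by replacing the entry `x i` by the entries
`x i * η 0, x i * η 1, …`. -/
noncomputable def fragment (x : ℕ → ℝ) (i : ℕ) (η : ℕ → ℝ) : ℕ → ℝ :=
  rank (Sum.elim (fun j : {j : ℕ // j ≠ i} => x j) (fun j : ℕ => x i * η j))

/-- The law of `Frag_α(x)`: a size-biased index `I` and an independent `PD(α, 1 - α)` vector `η`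
are chosen and the entry `x_I` is split according to `η`. -/
noncomputable def fragLaw (α : ℝ) (x : ℕ → ℝ) : Measure (ℕ → ℝ) :=
  ((pickLaw x).prod (PD α (1 - α))).map fun p => fragment x p.1 p.2

theorem measurable_fragment :
    Measurable fun p : (ℕ → ℝ) × ℕ × (ℕ → ℝ) => fragment p.1 p.2.1 p.2.2 := by
  have h : Measurable fun q : ℕ × ((ℕ → ℝ) × (ℕ → ℝ)) => fragment q.2.1 q.1 q.2.2 := by
    refine measurable_from_prod_countable_right fun i => ?_
    have h1 : Measurable fun y : (ℕ → ℝ) × (ℕ → ℝ) =>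
        (Sum.elim (fun j : {j : ℕ // j ≠ i} => y.1 j) (fun j : ℕ => y.1 i * y.2 j) :
          {j : ℕ // j ≠ i} ⊕ ℕ → ℝ) := by
      refine measurable_pi_lambda _ ?_
      rintro (j | j) <;> simp only [Sum.elim_inl, Sum.elim_inr] <;> fun_prop
    exact measurable_rank.comp h1
  have h2 : Measurable fun p : (ℕ → ℝ) × ℕ × (ℕ → ℝ) => (p.2.1, (p.1, p.2.2)) := by fun_prop
  exact h.comp h2

theorem measurable_fragLaw (α : ℝ) : Measurable (fragLaw α) := by
  let pick : Kernel (ℕ → ℝ) ℕ := ⟨pickLaw, measurable_pickLaw⟩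
  have : IsMarkovKernel pick := ⟨fun x => isProbabilityMeasure_pickLaw x⟩
  have key : fragLaw α = ((Kernel.id ×ₖ (pick ×ₖ Kernel.const _ (PD α (1 - α)))).map
      fun p : (ℕ → ℝ) × ℕ × (ℕ → ℝ) => fragment p.1 p.2.1 p.2.2) := by
    funext x
    rw [Kernel.map_apply _ measurable_fragment, Kernel.prod_apply, Kernel.id_apply,
      Measure.dirac_prod, Measure.map_map measurable_fragment (by fun_prop), Kernel.prod_apply,
      Kernel.const_apply]
    rfl
  rw [key]
  exact Kernel.measurable _

/-- The transition kernel `x ↦ law of Frag_α(x)`. -/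
noncomputable def fragKernel (α : ℝ) : Kernel (ℕ → ℝ) (ℕ → ℝ) :=
  ⟨fragLaw α, measurable_fragLaw α⟩

theorem isMarkovKernel_fragKernel {α : ℝ} (hα0 : 0 ≤ α) (hα1 : α < 1) :
    IsMarkovKernel (fragKernel α) := by
  have := isProbabilityMeasure_PD hα0 hα1 (θ := 1 - α) (by linarith)
  refine ⟨fun x => ?_⟩
  exact Measure.isProbabilityMeasure_map
    (measurable_fragment.comp (measurable_prodMk_left (x := x))).aemeasurable

/-! ### The coagulation operator -/

/-- The law of the proportion `B` of coagulating blocks: `Beta((1 - α)/α, (θ + α)/α)` if `α ≠ 0`,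
and the constant `1/(θ + 1)` if `α = 0`. -/
noncomputable def proportionLaw (α θ : ℝ) : Measure ℝ :=
  if α = 0 then Measure.dirac (1 / (θ + 1)) else betaMeasure ((1 - α) / α) ((θ + α) / α)

/-- The law of the random set `{j | I_j = 1}` of coagulating blocks: given `B`, each index belongs
to the set with probability `B`, independently of the others. -/
noncomputable def coagSetLaw (α θ : ℝ) : Measure (Set ℕ) :=
  (proportionLaw α θ).bind fun b => setBernoulli Set.univ (Set.projIcc 0 1 zero_le_one b)

open Classical in
/-- The ranked sequence obtained from `x` by replacing the entries with index in `S` by their sum.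
Before ranking, the removed entries are replaced by zeros, which come after all positive entries in
the ranking. -/
noncomputable def coalesce (x : ℕ → ℝ) (S : Set ℕ) : ℕ → ℝ :=
  rank fun j : Option ℕ =>
    j.elim (∑' k, if k ∈ S then x k else 0) fun k => if k ∈ S then 0 else x k

/-- The law of `Coag_{α,θ}(x)`. -/
noncomputable def coagLaw (α θ : ℝ) (x : ℕ → ℝ) : Measure (ℕ → ℝ) :=
  (coagSetLaw α θ).map (coalesce x)

theorem measurable_setBernoulli :
    Measurable fun p : unitInterval => (setBernoulli Set.univ p : Measure (Set ℕ)) := by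
  simp_rw [setBernoulli_eq_map]
  refine (Measure.measurable_map _ (MeasurableEquiv.setOfPred (α := ℕ)).measurable).comp ?_
  refine measurable_infinitePi_const (κ := fun p : unitInterval =>
      unitInterval.toNNReal p • Measure.dirac True +
        unitInterval.toNNReal (unitInterval.symm p) • Measure.dirac False) ?_
  refine Measure.measurable_of_measurable_coe _ fun s hs => ?_
  change Measurable fun p : unitInterval =>
    (unitInterval.toNNReal p : ENNReal) * Measure.dirac True s +
      (unitInterval.toNNReal (unitInterval.symm p) : ENNReal) * Measure.dirac False s
  have h1 : Measurable (unitInterval.toNNReal : unitInterval → NNReal) := by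
    unfold unitInterval.toNNReal
    fun_prop
  have h2 : Measurable (unitInterval.symm : unitInterval → unitInterval) :=
    unitInterval.continuous_symm.measurable
  exact (h1.coe_nnreal_ennreal.mul_const _).add ((h1.comp h2).coe_nnreal_ennreal.mul_const _)

theorem isProbabilityMeasure_coagSetLaw {α θ : ℝ} (hα0 : 0 ≤ α) (hα1 : α < 1) (hθ : -α < θ) :
    IsProbabilityMeasure (coagSetLaw α θ) := by
  have : IsProbabilityMeasure (proportionLaw α θ) := by
    unfold proportionLaw
    split_ifs with h
    · infer_instance
    · have : 0 < α := lt_of_le_of_ne hα0 (Ne.symm h)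
      exact isProbabilityMeasureBeta (div_pos (by linarith) this) (div_pos (by linarith) this)
  have hm : Measurable fun b : ℝ =>
      (setBernoulli Set.univ (Set.projIcc 0 1 zero_le_one b) : Measure (Set ℕ)) :=
    measurable_setBernoulli.comp continuous_projIcc.measurable
  refine ⟨?_⟩
  rw [coagSetLaw, Measure.bind_apply MeasurableSet.univ hm.aemeasurable]
  simp

theorem measurable_coalesce : Measurable fun p : (ℕ → ℝ) × Set ℕ => coalesce p.1 p.2 := by
  classical
  have hS (k : ℕ) : MeasurableSet {p : (ℕ → ℝ) × Set ℕ | k ∈ p.2} :=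
    measurable_snd (measurableSet_setOfPred.2 (measurable_set_mem k))
  refine measurable_rank.comp (measurable_pi_lambda _ ?_)
  rintro (_ | k)
  · simp only [Option.elim_none]
    exact Measurable.tsum fun k => Measurable.ite (hS k) (by fun_prop) measurable_const
  · simp only [Option.elim_some]
    exact Measurable.ite (hS k) measurable_const (by fun_prop)

theorem measurable_coagLaw (α θ : ℝ) : Measurable (coagLaw α θ) := by
  let ber : Kernel ℝ (Set ℕ) := ⟨fun b => setBernoulli Set.univ (Set.projIcc 0 1 zero_le_one b),
    measurable_setBernoulli.comp continuous_projIcc.measurable⟩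
  have : IsMarkovKernel ber :=
    ⟨fun b => inferInstanceAs (IsProbabilityMeasure
      (setBernoulli Set.univ (Set.projIcc 0 1 zero_le_one b)))⟩
  have : SFinite (proportionLaw α θ) := by
    unfold proportionLaw betaMeasure
    split_ifs <;> infer_instance
  have : SFinite (coagSetLaw α θ) := inferInstanceAs (SFinite (ber ∘ₘ proportionLaw α θ))
  have key : coagLaw α θ = ((Kernel.id ×ₖ Kernel.const _ (coagSetLaw α θ)).map
      fun p : (ℕ → ℝ) × Set ℕ => coalesce p.1 p.2) := by
    funext x
    rw [Kernel.map_apply _ measurable_coalesce, Kernel.prod_apply, Kernel.id_apply,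
      Measure.dirac_prod, Measure.map_map measurable_coalesce (by fun_prop), Kernel.const_apply]
    rfl
  rw [key]
  exact Kernel.measurable _

/-- The transition kernel `x ↦ law of Coag_{α,θ}(x)`. -/
noncomputable def coagKernel (α θ : ℝ) : Kernel (ℕ → ℝ) (ℕ → ℝ) :=
  ⟨coagLaw α θ, measurable_coagLaw α θ⟩

theorem isMarkovKernel_coagKernel {α θ : ℝ} (hα0 : 0 ≤ α) (hα1 : α < 1) (hθ : -α < θ) :
    IsMarkovKernel (coagKernel α θ) := by
  have := isProbabilityMeasure_coagSetLaw hα0 hα1 hθ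
  refine ⟨fun x => ?_⟩
  exact Measure.isProbabilityMeasure_map
    (measurable_coalesce.comp (measurable_prodMk_left (x := x))).aemeasurable

/-! ### Partitions and exchangeable partitions -/

/-- `m` is the smallest element of its class. Here `r` is a partial equivalence relation, that is,
an equivalence relation on the set `{m | r m m}`. -/
def IsLeader (r : ℕ → ℕ → Prop) (m : ℕ) : Prop :=
  r m m ∧ ∀ l, r m l → m ≤ l

/-- The classes of the partial equivalence relation `r`, listed in increasing order of their
smallest elements: `block r k` is the class whose smallest element is preceded by exactly `k`
smallest elements of other classes. It is empty if there are at most `k` classes. -/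
def block (r : ℕ → ℕ → Prop) (k : ℕ) : Set ℕ :=
  {v | ∃ m, IsLeader r m ∧ r m v ∧ {l | l < m ∧ IsLeader r l}.ncard = k}

/-- The partition of `A` according to the value of the labels `L`. -/
def sameLabel (A : Set ℕ) (L : ℕ → ℕ) (u v : ℕ) : Prop :=
  u ∈ A ∧ v ∈ A ∧ L u = L v

/-- The law of an exchangeable `(α, θ)` partition of `A`, as a random sequence of blocks in
increasing order of smallest elements: given a `PD(α, θ)` vector `y`, each element of `A` is
independently given the label `j` with probability `y j`, and elements with equal labels are put in
the same block. -/
noncomputable def exchangeablePartitionLaw (α θ : ℝ) (A : Set ℕ) : Measure (ℕ → Set ℕ) :=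
  (PD α θ).bind fun y =>
    (Measure.infinitePi fun _ : ℕ => pickLaw y).map fun L => block (sameLabel A L)

theorem measurable_block {Y : Type*} [MeasurableSpace Y] {r : Y → ℕ → ℕ → Prop}
    (hr : ∀ u v, MeasurableSet {y | r y u v}) : Measurable fun y => block (r y) := by
  have hL (m : ℕ) : MeasurableSet {y | IsLeader (r y) m} := by
    have h : MeasurableSet {y | ∀ l, r y m l → m ≤ l} := by
      rw [Set.ofPred_forall]
      exact MeasurableSet.iInter fun l => (hr m l).imp (.const _)
    exact (hr m m).inter h
  refine measurable_pi_lambda _ fun k => measurable_set_iff.2 fun v => ?_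
  have hS (m : ℕ) : MeasurableSet {y | {l | l < m ∧ IsLeader (r y) l}.ncard = k} := by
    have h : Measurable fun y => {l | l < m ∧ IsLeader (r y) l} :=
      measurable_set_iff.2 fun l => measurableSet_setOfPred.1 ((MeasurableSet.const _).inter (hL l))
    exact (measurable_ncard.comp h) (measurableSet_singleton k)
  have h : MeasurableSet {y | ∃ m, IsLeader (r y) m ∧ r y m v ∧
      {l | l < m ∧ IsLeader (r y) l}.ncard = k} := by
    rw [Set.ofPred_exists]
    exact MeasurableSet.iUnion fun m => (hL m).inter ((hr m v).inter (hS m))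
  exact measurableSet_setOfPred.1 h

theorem isProbabilityMeasure_exchangeablePartitionLaw {α θ : ℝ} (hα0 : 0 ≤ α) (hα1 : α < 1)
    (hθ : -α < θ) (A : Set ℕ) : IsProbabilityMeasure (exchangeablePartitionLaw α θ A) := by
  have := isProbabilityMeasure_PD hα0 hα1 hθ
  have h1 : Measurable fun L : ℕ → ℕ => block (sameLabel A L) :=
    measurable_block fun u v => (MeasurableSet.const _).inter ((MeasurableSet.const _).inter
      (measurableSet_eq_fun (measurable_pi_apply u) (measurable_pi_apply v)))
  have h2 : Measurable fun y => (Measure.infinitePi fun _ : ℕ => pickLaw y).map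
      fun L => block (sameLabel A L) :=
    (Measure.measurable_map _ h1).comp (measurable_infinitePi_const measurable_pickLaw)
  refine ⟨?_⟩
  rw [exchangeablePartitionLaw, Measure.bind_apply MeasurableSet.univ h2.aemeasurable]
  simp [Measure.map_apply h1 MeasurableSet.univ]

/-- The set `B` has asymptotic frequency `f` relative to `A`. -/
def HasFrequency (A B : Set ℕ) (f : ℝ) : Prop :=
  Filter.Tendsto
    (fun n : ℕ => ((B ∩ Set.Icc 1 n).ncard : ℝ) / ((A ∩ Set.Icc 1 n).ncard : ℝ))
    Filter.atTop (nhds f)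

open Classical in
/-- The asymptotic frequency of `B` relative to `A`, with value `0` if it does not exist. -/
noncomputable def frequency (A B : Set ℕ) : ℝ :=
  if h : ∃ f, HasFrequency A B f then h.choose else 0

/-! ### Recursive trees -/

/-- The current number of children of vertex `j` when the vertices `0, …, n` are present, where
`a m` is the parent of `m ≥ 1`. -/
def childCount (a : ℕ → ℕ) (n j : ℕ) : ℕ :=
  ((Finset.Icc 1 n).filter fun m => a m = j).card

/-- The weight of vertex `j` when the vertices `0, …, n` are present: `θ + α k₀` for the root and
`1 - α + α k_j` for `j ≥ 1`, where `k_j` is the current number of children of `j`. -/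
noncomputable def vertexWeight (α θ : ℝ) (a : ℕ → ℕ) (n j : ℕ) : ℝ :=
  if j = 0 then θ + α * childCount a n 0 else 1 - α + α * childCount a n j

/-- The random function `m ↦ par m` that maps each `m ≥ 1` to its parent is an
`(α, θ)`-recursive tree on `{0, 1, 2, …}`: vertex `1` is a child of the root `0`, and given the tree
on `{0, …, n}`, `n ≥ 1`, vertex `n + 1` is added as a child of `j ≤ n` with probability
proportional to the current weight of `j`. The value `par 0` plays no role. -/
structure IsRecursiveTree {Ω : Type*} [MeasurableSpace Ω] (α θ : ℝ) (par : ℕ → Ω → ℕ)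
    (P : Measure Ω) : Prop where
  measurable : ∀ n, Measurable (par n)
  parent_one : ∀ᵐ ω ∂P, par 1 ω = 0
  attach : ∀ n, 1 ≤ n → ∀ a : ℕ → ℕ, ∀ j, j ≤ n →
    P {ω | (∀ m ∈ Finset.Icc 1 n, par m ω = a m) ∧ par (n + 1) ω = j} =
      P {ω | ∀ m ∈ Finset.Icc 1 n, par m ω = a m} *
        ENNReal.ofReal (vertexWeight α θ a n j / ∑ l ∈ Finset.range (n + 1), vertexWeight α θ a n l)

/-- The tree with parent function `p`, as a graph on `{0, 1, 2, …}`. -/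
def treeGraph (p : ℕ → ℕ) : SimpleGraph ℕ :=
  SimpleGraph.fromRel fun m n => 1 ≤ n ∧ p n = m

/-- Two vertices are in the same component of the forest obtained by removing the vertices
`0, …, i` from the tree with parent function `p`. -/
def sameSubtree (p : ℕ → ℕ) (i u v : ℕ) : Prop :=
  ∃ (hu : u ∈ Set.Ioi i) (hv : v ∈ Set.Ioi i),
    ((treeGraph p).induce (Set.Ioi i)).Reachable ⟨u, hu⟩ ⟨v, hv⟩

/-- The blocks of the partition of `{i + 1, i + 2, …}` into the subtrees that remain after the
vertices `0, …, i` have been removed. -/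
def subtreeBlock (p : ℕ → ℕ) (i k : ℕ) : Set ℕ :=
  block (sameSubtree p i) k

/-- The asymptotic frequencies of the blocks. -/
noncomputable def subtreeFreq (p : ℕ → ℕ) (i k : ℕ) : ℝ :=
  frequency (Set.Ioi i) (subtreeBlock p i k)

/-- The ranked asymptotic frequencies of the blocks. -/
noncomputable def rankedFreq (p : ℕ → ℕ) (i : ℕ) : ℕ → ℝ :=
  rank (subtreeFreq p i)

end FragCoag

/-!
The tree is handled as the sequence of the parents of the vertices `1, 2, …`, and its law, like all
laws of sequences with values in a countable set below, is described by a prediction rule: the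
conditional law of the next term given the past (`HasPrediction`). A prediction rule determines the
law, and prediction rules are transported by maps that do not anticipate (`HasPrediction.map`), so
identities between laws reduce to identities between finitely many weights.

*Blocks and frequencies.* In a recursive tree the weight `θ + α k` of the root and the weight
`1 - α + α l` of its first child add up to `θ + 1 + α (k - 1 + l)`, which is the weight of the
vertex obtained by contracting the two. So contracting the vertices `0, …, i` turns an
`(α, θ)`-recursive tree into an `(α, θ + i)`-recursive tree (`HasPrediction.map_contract`), and it
suffices to study the subtrees of the root. A subtree with `k` vertices has weight `k - α`, so these
form a Chinese restaurant process (`HasPrediction.map_subtreeSeq`). This process can be built from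
independent labels with a `GEM` law, with a label that skips values replaced by the next unused one
(`hasPrediction_crpLaw`); its frequencies then have the `GEM` law by the strong law of large numbers
(`map_freq_crpLaw`). It is also the partition generated by independent labels sampled from a `PD`
vector (`paintboxLaw_eq_crpLaw`): the probability that given groups of labels form the classes
satisfies a recursion obtained by breaking the first stick, which has the partition probability
function as its only bounded solution (`lintegral_classWeight`).

*Reversed transitions.* The contraction of the root and its first child is undone by splitting the
root, with each child of the root attached to one of the two vertices. These choices form a Pólya
urn, which is the indicator sequence of the coagulating set, independent of the contracted tree
(`hasPrediction_memSeq`, `HasPrediction.map_splitRoot`). Therefore, given the contracted tree, the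
frequencies of the original tree arise by coagulation (`HasPrediction.map_contract_treeFreq`).

*Duality.* In independent labels sampled from a `PD(α, θ)` vector, the block of the first label is
size-biased, like the block chosen by the fragmentation. If this block is fragmented by an
independent `(α, 1 - α)` Chinese restaurant process, the resulting partition with its fragments
marked is an `(α, θ + 1)` Chinese restaurant process whose blocks are marked by an independent
coagulating set, because both follow the same prediction rule (`IsSplitSeq.tsum_splitRule`,
`map_splitMark_eq`). Merging the marked blocks recovers the original partition. Passing to
frequencies, the joint law of a `PD(α, θ)` vector and its fragmentation is that of the coagulation
of a `PD(α, θ + 1)` vector and the vector itself (`swap_compProd_fragKernel`). This turns the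
reversed transitions into the forward ones. The reversed transition is valid conditionally on the
whole contracted tree, hence on the entire future of the chain, and the Markov property follows
(`HasPrediction.map_freqHistory`).
-/

namespace FragCoag

/-! ### Laws of sequences with values in a countable set -/

/-- The set of sequences that agree with `a` before time `n`. -/
def prefixSet {E : Type*} (a : ℕ → E) (n : ℕ) : Set (ℕ → E) := {x | ∀ m < n, x m = a m}

section Prediction

variable {E F : Type*}

theorem measurable_of_prefix [MeasurableSpace E] [Countable E] [MeasurableSingletonClass E]
    [Nonempty E] {β : Type*} [MeasurableSpace β] {f : (ℕ → E) → β} (n : ℕ)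
    (h : ∀ x y : ℕ → E, (∀ m < n, x m = y m) → f x = f y) : Measurable f := by
  classical
  obtain ⟨e⟩ := ‹Nonempty E›
  let g : (Fin n → E) → β := fun y => f fun m => if h : m < n then y ⟨m, h⟩ else e
  have hg : Measurable g := measurable_of_countable g
  have hf : f = g ∘ fun x i => x i.1 := by
    funext x
    refine h _ _ fun m hm => ?_
    simp [hm]
  rw [hf]
  exact hg.comp (by fun_prop)

theorem measurableSet_of_prefix [MeasurableSpace E] [Countable E] [MeasurableSingletonClass E]
    [Nonempty E] {s : Set (ℕ → E)} (n : ℕ)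
    (h : ∀ x y : ℕ → E, (∀ m < n, x m = y m) → (x ∈ s ↔ y ∈ s)) : MeasurableSet s :=
  measurableSet_setOfPred.2 (measurable_of_prefix n fun x y hxy => propext (h x y hxy))

theorem measurableSet_prefixSet [MeasurableSpace E] [MeasurableSingletonClass E]
    (a : ℕ → E) (n : ℕ) : MeasurableSet (prefixSet a n) := by
  have : prefixSet a n = ⋂ m, ⋂ _ : m < n, {x | x m = a m} := by
    ext x; simp [prefixSet]
  rw [this]
  exact MeasurableSet.iInter fun m => MeasurableSet.iInter fun _ =>
    (measurable_pi_apply m : Measurable fun x : ℕ → E => x m) (measurableSet_singleton (a m))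

theorem prefixSet_congr {a b : ℕ → E} {n : ℕ} (h : ∀ m < n, a m = b m) :
    prefixSet a n = prefixSet b n := by
  ext x
  exact forall₂_congr fun m hm => by rw [h m hm]

theorem prefixSet_succ (a : ℕ → E) (n : ℕ) :
    prefixSet a (n + 1) = {x | (∀ m < n, x m = a m) ∧ x n = a n} := by
  ext x
  simp only [prefixSet, Set.mem_ofPred_eq, Nat.lt_succ_iff_lt_or_eq]
  constructor
  · exact fun h => ⟨fun m hm => h m (.inl hm), h n (.inr rfl)⟩
  · rintro ⟨h1, h2⟩ m (hm | rfl)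
    exacts [h1 m hm, h2]

theorem prefixSet_update (a : ℕ → E) (n : ℕ) (e : E) :
    {x : ℕ → E | (∀ m < n, x m = a m) ∧ x n = e} = prefixSet (Function.update a n e) (n + 1) := by
  rw [prefixSet_succ]
  ext x
  simp only [Set.mem_ofPred_eq, Function.update_self]
  refine and_congr_left fun _ => forall₂_congr fun m hm => ?_
  rw [Function.update_of_ne hm.ne]

/-- A finite measure on the space of sequences is determined by its values on the sets of sequences
with a given initial segment. -/
theorem ext_of_prefixSet [MeasurableSpace E] [Countable E] [MeasurableSingletonClass E] [Nonempty E]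
    {μ ν : Measure (ℕ → E)} [IsFiniteMeasure μ] [IsFiniteMeasure ν]
    (h : ∀ a n, μ (prefixSet a n) = ν (prefixSet a n)) : μ = ν := by
  classical
  obtain ⟨e⟩ := ‹Nonempty E›
  have key (n : ℕ) : μ.map (Finset.range n).restrict = ν.map (Finset.range n).restrict := by
    refine Measure.ext_of_singleton fun y => ?_
    rw [Measure.map_apply (Finset.measurable_restrict _) (measurableSet_singleton _),
      Measure.map_apply (Finset.measurable_restrict _) (measurableSet_singleton _)]
    have : (Finset.range n).restrict (π := fun _ => E) ⁻¹' ({y} : Set (Finset.range n → E)) =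
      prefixSet
        (fun m => if h : m ∈ Finset.range n then y ⟨m, h⟩ else e) n := by
      ext x
      simp only [Set.mem_preimage, Set.mem_singleton_iff, prefixSet, Set.mem_ofPred_eq, funext_iff,
        Subtype.forall, Finset.mem_range]
      refine forall₂_congr fun m hm => ?_
      simp [hm]
    rw [this, h]
  have hproj (μ : Measure (ℕ → E)) :
      IsProjectiveLimit μ (fun I : Finset ℕ => μ.map I.restrict) := fun I => rfl
  refine (hproj μ).unique fun I => ?_
  obtain ⟨n, hn⟩ := I.exists_nat_subset_range
  have hr : (I.restrict : (ℕ → E) → _) = Finset.restrict₂ hn ∘ (Finset.range n).restrict := rfl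
  change ν.map I.restrict = μ.map I.restrict
  rw [hr, ← Measure.map_map (Finset.measurable_restrict₂ _) (Finset.measurable_restrict _),
    ← Measure.map_map (Finset.measurable_restrict₂ _) (Finset.measurable_restrict _), key n]

/-- The random sequence with law `μ` follows the prediction rule `q`: given the initial segment of
length `n` of a sequence `a`, the next term is `e` with probability `q n a e`. -/
def HasPrediction [MeasurableSpace E] (μ : Measure (ℕ → E))
    (q : ℕ → (ℕ → E) → E → ENNReal) : Prop :=
  ∀ n a e, μ {x | (∀ m < n, x m = a m) ∧ x n = e} = μ (prefixSet a n) * q n a e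

/-- The law of a sequence is determined by its prediction rule. -/
theorem HasPrediction.eq [MeasurableSpace E] [Countable E] [MeasurableSingletonClass E] [Nonempty E]
    {μ ν : Measure (ℕ → E)} [IsProbabilityMeasure μ] [IsProbabilityMeasure ν]
    {q : ℕ → (ℕ → E) → E → ENNReal} (hμ : HasPrediction μ q) (hν : HasPrediction ν q) : μ = ν := by
  refine ext_of_prefixSet fun a n => ?_
  induction n with
  | zero => simp [prefixSet]
  | succ n ih => rw [prefixSet_succ, hμ, hν, ih]

theorem HasPrediction.prefixSet_succ_ne_zero [MeasurableSpace E] {μ : Measure (ℕ → E)}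
    {q : ℕ → (ℕ → E) → E → ENNReal} (hμ : HasPrediction μ q) {a : ℕ → E} {n : ℕ}
    (h : μ (prefixSet a n) ≠ 0) : ∀ m < n, q m a (a m) ≠ 0 := by
  intro m hm h0
  refine h (measure_mono_null (t := prefixSet a (m + 1))
    (fun x hx l hl => hx l (by omega)) ?_)
  rw [prefixSet_succ, hμ, h0, mul_zero]

theorem measure_eq_tsum_inter_fiber {Ω ι : Type*} [MeasurableSpace Ω] [Countable ι]
    [MeasurableSpace ι] [MeasurableSingletonClass ι] (μ : Measure Ω) {g : Ω → ι}
    (hg : Measurable g) {s : Set Ω} (hs : MeasurableSet s) :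
    μ s = ∑' i, μ (s ∩ {x | g x = i}) := by
  have hm (i : ι) : MeasurableSet {x | g x = i} := hg (measurableSet_singleton i)
  rw [← measure_iUnion _ fun i => hs.inter (hm i)]
  · congr 1
    ext x
    simp
  · intro i j hij
    refine Set.disjoint_left.2 fun x hx hx' => hij ?_
    exact hx.2.symm.trans hx'.2

/-- A sequence that is a non-anticipating function of a sequence following a prediction rule
follows a prediction rule itself, provided that the conditional probability of its next value
depends on its own past only. -/
theorem HasPrediction.map [MeasurableSpace E] [Countable E] [MeasurableSingletonClass E]
    [Nonempty E]
    [MeasurableSpace F] [Countable F] [MeasurableSingletonClass F]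
    {μ : Measure (ℕ → E)} {q : ℕ → (ℕ → E) → E → ENNReal} (hμ : HasPrediction μ q)
    {v : (ℕ → E) → ℕ → F} (hv : ∀ x y n, (∀ m < n + 1, x m = y m) → v x n = v y n)
    {r : ℕ → (ℕ → F) → F → ENNReal}
    (hr : ∀ n b b', (∀ m < n, b m = b' m) → ∀ z, r n b z = r n b' z)
    (h : ∀ n a, μ (prefixSet a n) ≠ 0 → ∀ z,
      ∑' e, (open Classical in if v (Function.update a n e) n = z then q n a e else 0) =
        r n (v a) z) :
    HasPrediction (μ.map v) r := by
  classical
  have hvm : Measurable v := measurable_pi_lambda _ fun n => measurable_of_prefix (n + 1)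
    fun x y hxy => hv x y n hxy
  intro n b z
  have hvn (x y : ℕ → E) (hxy : ∀ m < n, x m = y m) : ∀ m < n, v x m = v y m := fun m hm =>
    hv x y m fun l hl => hxy l (by omega)
  rw [Measure.map_apply hvm, Measure.map_apply hvm (measurableSet_prefixSet _ _)]
  swap
  · rw [prefixSet_update]
    exact measurableSet_prefixSet _ _
  set S : Set (ℕ → E) := v ⁻¹' prefixSet b n with hS
  have hSm : MeasurableSet S := hvm (measurableSet_prefixSet _ _)
  have hz : MeasurableSet {x | v x n = z} :=
    ((measurable_pi_apply n).comp hvm) (measurableSet_singleton z)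
  have h1 : v ⁻¹' {x | (∀ m < n, x m = b m) ∧ x n = z} = S ∩ {x | v x n = z} := rfl
  rw [h1]
  obtain ⟨e0⟩ := ‹Nonempty E›
  let g : (ℕ → E) → (Fin n → E) := fun x i => x i.1
  have hg : Measurable g := by fun_prop
  rw [measure_eq_tsum_inter_fiber μ hg (hSm.inter hz), measure_eq_tsum_inter_fiber μ hg hSm,
    ← ENNReal.tsum_mul_right]
  refine tsum_congr fun c => ?_
  let a : ℕ → E := fun m => if h : m < n then c ⟨m, h⟩ else e0
  have hga : {x | g x = c} = prefixSet a n := by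
    ext x
    simp only [g, a, prefixSet, Set.mem_ofPred_eq, funext_iff, Fin.forall_iff]
    refine forall₂_congr fun m hm => ?_
    simp [hm]
  rw [hga]
  by_cases hab : ∀ m < n, v a m = b m
  · have h2 : S ∩ prefixSet a n = prefixSet a n := by
      refine Set.inter_eq_right.2 fun x hx m hm => ?_
      rw [← hab m hm, hvn x a hx m hm]
    have h3 : S ∩ {x | v x n = z} ∩ prefixSet a n = prefixSet a n ∩ {x | v x n = z} := by
      rw [Set.inter_right_comm, h2]
    rw [h2, h3]
    by_cases h0 : μ (prefixSet a n) = 0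
    · rw [h0, zero_mul]
      exact measure_mono_null Set.inter_subset_left h0
    rw [hr n b (v a) (fun m hm => (hab m hm).symm), ← h n a h0,
      measure_eq_tsum_inter_fiber μ (measurable_pi_apply n)
        ((measurableSet_prefixSet _ _).inter hz), ← ENNReal.tsum_mul_left]
    refine tsum_congr fun e => ?_
    have h4 : ∀ x, x ∈ prefixSet a n → x n = e → v x n = v (Function.update a n e) n := by
      intro x hx hxe
      refine hv _ _ _ fun m hm => ?_
      rcases Nat.lt_succ_iff_lt_or_eq.1 hm with hm | rfl
      · rw [Function.update_of_ne hm.ne, hx m hm]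
      · rw [Function.update_self, hxe]
    split_ifs with hve
    · rw [← hμ]
      congr 1
      ext x
      constructor
      · exact fun hx => ⟨hx.1.1, hx.2⟩
      · exact fun hx => ⟨⟨hx.1, (h4 x hx.1 hx.2).trans hve⟩, hx.2⟩
    · rw [mul_zero]
      convert! measure_empty (μ := μ)
      ext x
      simp only [Set.mem_inter_iff, Set.mem_ofPred_eq, Set.mem_empty_iff_false, iff_false]
      rintro ⟨⟨hx, hxz⟩, hxe⟩
      exact hve ((h4 x hx hxe).symm.trans hxz)
  · have h2 : S ∩ prefixSet a n = ∅ := by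
      ext x
      simp only [Set.mem_inter_iff, Set.mem_empty_iff_false, iff_false]
      rintro ⟨hx, hxa⟩
      exact hab fun m hm => (hvn a x (fun l hl => (hxa l hl).symm) m hm).trans (hx m hm)
    have h3 : S ∩ {x | v x n = z} ∩ prefixSet a n = ∅ := by
      rw [Set.inter_right_comm, h2, Set.empty_inter]
    rw [h2, h3]
    simp

end Prediction

/-! ### Numbering the classes of a labelling in order of appearance -/

section RG

variable {ι κ : Type*}

/-- The number of distinct labels among the first `n` terms. -/
noncomputable def numBlocks (L : ℕ → ι) (n : ℕ) : ℕ := (L '' Set.Iio n).ncard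

/-- The relabelling of a sequence in order of appearance: `rg L n` is the number of labels that
appear strictly before the first occurrence of the label `L n`. The result is a restricted growth
sequence with the same classes as `L`. -/
noncomputable def rg (L : ℕ → ι) (n : ℕ) : ℕ := numBlocks L (sInf {m | L m = L n})

/-- The first `n` terms of `d` have restricted growth: each is at most the number of distinct
earlier terms. -/
def RestrictedGrowth (d : ℕ → ℕ) (n : ℕ) : Prop := ∀ m < n, d m ≤ numBlocks d m

theorem image_Iio_succ (L : ℕ → ι) (n : ℕ) :
    L '' Set.Iio (n + 1) = insert (L n) (L '' Set.Iio n) := by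
  rw [← Order.succ_eq_add_one, Order.Iio_succ_eq_insert, Set.image_insert_eq]

theorem finite_image_Iio (L : ℕ → ι) (n : ℕ) : (L '' Set.Iio n).Finite :=
  (Set.finite_Iio n).image L

@[simp] theorem numBlocks_zero (L : ℕ → ι) : numBlocks L 0 = 0 := by simp [numBlocks]

theorem numBlocks_succ_of_mem {L : ℕ → ι} {n m : ℕ} (hm : m < n) (h : L m = L n) :
    numBlocks L (n + 1) = numBlocks L n := by
  have : L n ∈ L '' Set.Iio n := ⟨m, hm, h⟩
  rw [numBlocks, image_Iio_succ, Set.insert_eq_of_mem this, numBlocks]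

theorem numBlocks_succ_of_new {L : ℕ → ι} {n : ℕ} (h : ∀ m < n, L m ≠ L n) :
    numBlocks L (n + 1) = numBlocks L n + 1 := by
  rw [numBlocks, image_Iio_succ, Set.ncard_insert_of_notMem _ (finite_image_Iio L n), numBlocks]
  rintro ⟨m, hm, hmn⟩
  exact h m hm hmn

theorem numBlocks_mono (L : ℕ → ι) : Monotone (numBlocks L) := fun _ n h =>
  Set.ncard_le_ncard (Set.image_mono (Set.Iio_subset_Iio h)) (finite_image_Iio L n)

theorem numBlocks_pos (L : ℕ → ι) {n : ℕ} (hn : 0 < n) : 0 < numBlocks L n := by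
  refine (Set.ncard_pos (finite_image_Iio L n)).2 ⟨L 0, 0, hn, rfl⟩

theorem numBlocks_congr {L : ℕ → ι} {L' : ℕ → κ} {n : ℕ}
    (h : ∀ l < n, ∀ m < n, L l = L m ↔ L' l = L' m) : numBlocks L n = numBlocks L' n := by
  induction n with
  | zero => simp
  | succ n ih =>
    have ih' := ih fun l hl m hm => h l (by omega) m (by omega)
    by_cases hn : ∃ m < n, L m = L n
    · obtain ⟨m, hm, hmn⟩ := hn
      rw [numBlocks_succ_of_mem hm hmn,
        numBlocks_succ_of_mem hm ((h m (by omega) n (by omega)).1 hmn), ih']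
    · push Not at hn
      rw [numBlocks_succ_of_new hn, numBlocks_succ_of_new, ih']
      exact fun m hm hmn => hn m hm ((h m (by omega) n (by omega)).2 hmn)

theorem firstOcc_spec (L : ℕ → ι) (n : ℕ) : L (sInf {m | L m = L n}) = L n :=
  Nat.sInf_mem (s := {m | L m = L n}) ⟨n, rfl⟩

theorem firstOcc_le (L : ℕ → ι) {m n : ℕ} (h : L m = L n) : sInf {m | L m = L n} ≤ m :=
  Nat.sInf_le h

theorem firstOcc_new (L : ℕ → ι) (n : ℕ) {m : ℕ} (h : m < sInf {m | L m = L n}) : L m ≠ L n :=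
  Nat.notMem_of_lt_sInf h

theorem rg_of_new {L : ℕ → ι} {n : ℕ} (h : ∀ m < n, L m ≠ L n) : rg L n = numBlocks L n := by
  have : sInf {m | L m = L n} = n := by
    refine le_antisymm (firstOcc_le L rfl) ?_
    by_contra! hlt
    exact h _ hlt (firstOcc_spec L n)
  rw [rg, this]

theorem rg_eq_of_eq {L : ℕ → ι} {m n : ℕ} (h : L m = L n) : rg L m = rg L n := by
  rw [rg, rg, h]

theorem rg_lt_of_lt {L : ℕ → ι} {m n : ℕ}
    (h : sInf {l | L l = L m} < sInf {l | L l = L n}) : rg L m < rg L n := by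
  refine lt_of_lt_of_le ?_ (numBlocks_mono L (Nat.succ_le_of_lt h))
  have : numBlocks L (sInf {l | L l = L m} + 1) = numBlocks L (sInf {l | L l = L m}) + 1 := by
    refine numBlocks_succ_of_new fun l hl => ?_
    rw [firstOcc_spec L m]
    exact firstOcc_new L m hl
  rw [rg, Nat.succ_eq_add_one, this]
  exact Nat.lt_succ_self _

theorem rg_eq_iff {L : ℕ → ι} {m n : ℕ} : rg L m = rg L n ↔ L m = L n := by
  refine ⟨fun h => ?_, rg_eq_of_eq⟩
  rcases lt_trichotomy (sInf {l | L l = L m}) (sInf {l | L l = L n}) with hl | hl | hl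
  · exact absurd h (rg_lt_of_lt hl).ne
  · rw [← firstOcc_spec L m, ← firstOcc_spec L n, hl]
  · exact absurd h (rg_lt_of_lt hl).ne'

theorem rg_congr_of_le {L : ℕ → ι} {L' : ℕ → κ} {n : ℕ}
    (h : ∀ l < n + 1, ∀ m < n + 1, L l = L m ↔ L' l = L' m) : rg L n = rg L' n := by
  have hf : sInf {m | L m = L n} = sInf {m | L' m = L' n} := by
    have h1 : sInf {m | L m = L n} ≤ n := firstOcc_le L rfl
    have h2 : sInf {m | L' m = L' n} ≤ n := firstOcc_le L' rfl
    refine le_antisymm (firstOcc_le L ?_) (firstOcc_le L' ?_)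
    · exact (h _ (by omega) n (by omega)).2 (firstOcc_spec L' n)
    · exact (h _ (by omega) n (by omega)).1 (firstOcc_spec L n)
  have h1 : sInf {m | L m = L n} ≤ n := firstOcc_le L rfl
  rw [rg, rg, ← hf]
  exact numBlocks_congr fun l hl m hm => h l (by omega) m (by omega)

theorem rg_congr {L : ℕ → ι} {L' : ℕ → κ} (h : ∀ l m, L l = L m ↔ L' l = L' m) : rg L = rg L' :=
  funext fun _ => rg_congr_of_le fun l _ m _ => h l m

theorem rg_prefix (x y : ℕ → ι) (n : ℕ) (h : ∀ m < n + 1, x m = y m) : rg x n = rg y n :=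
  rg_congr_of_le fun l hl m hm => by rw [h l hl, h m hm]

theorem numBlocks_prefix {x y : ℕ → ι} {n : ℕ} (h : ∀ m < n, x m = y m) :
    numBlocks x n = numBlocks y n :=
  numBlocks_congr fun l hl m hm => by rw [h l hl, h m hm]

theorem measurable_rg [MeasurableSpace ι] [Countable ι] [MeasurableSingletonClass ι] [Nonempty ι] :
    Measurable (rg : (ℕ → ι) → ℕ → ℕ) :=
  measurable_pi_lambda _ fun n => measurable_of_prefix (n + 1) fun x y h => rg_prefix x y n h

theorem numBlocks_rg (L : ℕ → ι) (n : ℕ) : numBlocks (rg L) n = numBlocks L n :=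
  numBlocks_congr fun _ _ _ _ => rg_eq_iff

theorem rg_le_numBlocks (L : ℕ → ι) (n : ℕ) : rg L n ≤ numBlocks L n :=
  numBlocks_mono L (firstOcc_le L rfl)

theorem restrictedGrowth_rg (L : ℕ → ι) (n : ℕ) : RestrictedGrowth (rg L) n := fun m _ => by
  rw [numBlocks_rg]
  exact rg_le_numBlocks L m

theorem RestrictedGrowth.mono {d : ℕ → ℕ} {m n : ℕ} (h : RestrictedGrowth d n) (hmn : m ≤ n) :
    RestrictedGrowth d m := fun l hl => h l (by omega)

theorem RestrictedGrowth.image_eq {d : ℕ → ℕ} {n : ℕ} (h : RestrictedGrowth d n) :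
    d '' Set.Iio n = Set.Iio (numBlocks d n) := by
  induction n with
  | zero => simp
  | succ n ih =>
    have ih' := ih (h.mono n.le_succ)
    have hn := h n n.lt_succ_self
    by_cases hnew : ∃ m < n, d m = d n
    · obtain ⟨m, hm, hmn⟩ := hnew
      have hmem : d n ∈ d '' Set.Iio n := ⟨m, hm, hmn⟩
      rw [image_Iio_succ, numBlocks_succ_of_mem hm hmn, Set.insert_eq_of_mem hmem, ih']
    · push Not at hnew
      have : d n ∉ d '' Set.Iio n := by
        rintro ⟨m, hm, hmn⟩
        exact hnew m hm hmn
      rw [ih', Set.mem_Iio, not_lt] at this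
      rw [image_Iio_succ, numBlocks_succ_of_new hnew, ih', le_antisymm hn this,
        ← Order.succ_eq_add_one, Order.Iio_succ_eq_insert]

theorem RestrictedGrowth.lt_numBlocks_iff {d : ℕ → ℕ} {n : ℕ} (h : RestrictedGrowth d n) {k : ℕ} :
    k < numBlocks d n ↔ ∃ m < n, d m = k := by
  have : k ∈ d '' Set.Iio n ↔ k ∈ Set.Iio (numBlocks d n) := by rw [h.image_eq]
  exact this.symm

theorem RestrictedGrowth.rg_eq {d : ℕ → ℕ} {n : ℕ} (h : RestrictedGrowth d n) {m : ℕ} (hm : m < n) :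
    rg d m = d m := by
  have hf : sInf {l | d l = d m} ≤ m := firstOcc_le d rfl
  have hs := firstOcc_spec d m
  rw [rg]
  refine le_antisymm ?_ ?_
  · by_contra! hlt
    obtain ⟨l, hl, hlm⟩ := (h.mono (by omega : sInf {l | d l = d m} ≤ n)).lt_numBlocks_iff.1 hlt
    exact firstOcc_new d m hl hlm
  · conv_lhs => rw [← hs]
    exact h _ (by omega)

/-- The classes of the labelling `D`, whose `n`-th term labels the integer `n + i + 1`, viewed as
sets of integers larger than `i`. -/
def classesFrom (i : ℕ) (D : ℕ → ℕ) (k : ℕ) : Set ℕ := {v | i < v ∧ D (v - i - 1) = k}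

theorem isLeader_sameLabel_iff {i : ℕ} {L : ℕ → ℕ} {n : ℕ} :
    IsLeader (sameLabel (Set.Ioi i) L) (n + i + 1) ↔
      ∀ l < n, L (l + i + 1) ≠ L (n + i + 1) := by
  constructor
  · rintro ⟨-, h⟩ l hl hln
    have := h (l + i + 1) ⟨by simp only [Set.mem_Ioi]; omega,
      by simp only [Set.mem_Ioi]; omega, hln.symm⟩
    omega
  · intro h
    refine ⟨⟨by simp only [Set.mem_Ioi]; omega, by simp only [Set.mem_Ioi]; omega, rfl⟩, ?_⟩
    rintro l ⟨-, hl, hln⟩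
    simp only [Set.mem_Ioi] at hl
    by_contra! hlt
    refine h (l - i - 1) (by omega) ?_
    rw [hln]
    congr 1
    omega

theorem ncard_leaders {i : ℕ} {L : ℕ → ℕ} (n : ℕ) :
    {l | l < n + i + 1 ∧ IsLeader (sameLabel (Set.Ioi i) L) l}.ncard =
      numBlocks (fun m => L (m + i + 1)) n := by
  have himg : (fun m => L (m + i + 1)) '' Set.Iio n =
      L '' {l | l < n + i + 1 ∧ IsLeader (sameLabel (Set.Ioi i) L) l} := by
    ext z
    constructor
    · rintro ⟨m, hm, rfl⟩
      set f := sInf {l | (fun m => L (m + i + 1)) l = (fun m => L (m + i + 1)) m} with hf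
      have h1 : f ≤ m := firstOcc_le (fun m => L (m + i + 1)) rfl
      have h2 : L (f + i + 1) = L (m + i + 1) := firstOcc_spec (fun m => L (m + i + 1)) m
      simp only [Set.mem_Iio] at hm
      refine ⟨f + i + 1, ⟨by omega, isLeader_sameLabel_iff.2 fun l hl => ?_⟩, h2⟩
      rw [h2]
      exact firstOcc_new (fun m => L (m + i + 1)) m hl
    · rintro ⟨l, ⟨hl, ⟨⟨hli, -⟩, -⟩⟩, rfl⟩
      simp only [Set.mem_Ioi] at hli
      refine ⟨l - i - 1, by simp only [Set.mem_Iio]; omega, ?_⟩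
      simp only
      congr 1
      omega
  rw [numBlocks, himg, Set.InjOn.ncard_image]
  rintro a ⟨-, ⟨⟨ha, -⟩, ha'⟩⟩ b ⟨-, ⟨⟨hb, -⟩, hb'⟩⟩ hab
  exact le_antisymm (ha' b ⟨ha, hb, hab⟩) (hb' a ⟨hb, ha, hab.symm⟩)

theorem block_sameLabel (i : ℕ) (L : ℕ → ℕ) :
    block (sameLabel (Set.Ioi i) L) = classesFrom i (rg fun n => L (n + i + 1)) := by
  funext k
  ext v
  set L' : ℕ → ℕ := fun n => L (n + i + 1) with hL'
  constructor
  · rintro ⟨m, hm, ⟨hmi, hvi, hmv⟩, hk⟩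
    simp only [Set.mem_Ioi] at hmi hvi
    obtain ⟨m, rfl⟩ : ∃ m', m = m' + i + 1 := ⟨m - i - 1, by omega⟩
    obtain ⟨v, rfl⟩ : ∃ v', v = v' + i + 1 := ⟨v - i - 1, by omega⟩
    rw [ncard_leaders] at hk
    refine ⟨hvi, ?_⟩
    rw [show v + i + 1 - i - 1 = v by omega, ← hk, ← rg_of_new (isLeader_sameLabel_iff.1 hm)]
    exact rg_eq_of_eq hmv.symm
  · rintro ⟨hvi, hk⟩
    obtain ⟨v, rfl⟩ : ∃ v', v = v' + i + 1 := ⟨v - i - 1, by omega⟩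
    rw [show v + i + 1 - i - 1 = v by omega] at hk
    refine ⟨sInf {l | L' l = L' v} + i + 1, isLeader_sameLabel_iff.2 fun l hl => ?_,
      ⟨by simp only [Set.mem_Ioi]; omega, hvi, firstOcc_spec L' v⟩, ?_⟩
    · change L' l ≠ L' _
      rw [firstOcc_spec L' v]
      exact firstOcc_new L' v hl
    · rw [ncard_leaders]
      exact hk

end RG

/-! ### Beta moments and stick breaking -/

/-- The rising factorial `a (a + 1) ⋯ (a + n - 1)`. -/
noncomputable def rising (a : ℝ) (n : ℕ) : ℝ := ∏ i ∈ Finset.range n, (a + i)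

@[simp] theorem rising_zero (a : ℝ) : rising a 0 = 1 := by simp [rising]

theorem rising_succ (a : ℝ) (n : ℕ) : rising a (n + 1) = rising a n * (a + n) := by
  rw [rising, Finset.prod_range_succ, rising]

theorem rising_succ' (a : ℝ) (n : ℕ) : rising a (n + 1) = a * rising (a + 1) n := by
  rw [rising, Finset.prod_range_succ', rising, mul_comm]
  push_cast
  simp only [add_zero, add_assoc, add_comm (1 : ℝ)]

theorem rising_pos {a : ℝ} (ha : 0 < a) (n : ℕ) : 0 < rising a n :=
  Finset.prod_pos fun i _ => by positivity

theorem Gamma_add_nat {a : ℝ} (ha : 0 < a) (n : ℕ) :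
    Real.Gamma (a + n) = rising a n * Real.Gamma a := by
  induction n with
  | zero => simp
  | succ n ih =>
    have : a + (n + 1 : ℕ) = (a + n) + 1 := by push_cast; ring
    rw [this, Real.Gamma_add_one (by positivity), ih, rising_succ]
    ring

theorem beta_add_nat {a c : ℝ} (ha : 0 < a) (hc : 0 < c) (u w : ℕ) :
    beta (a + u) (c + w) / beta a c = rising a u * rising c w / rising (a + c) (u + w) := by
  have h : a + u + (c + w) = a + c + (u + w : ℕ) := by push_cast; ring
  have h1 := (Real.Gamma_pos_of_pos ha).ne'
  have h2 := (Real.Gamma_pos_of_pos hc).ne'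
  have h3 := (Real.Gamma_pos_of_pos (add_pos ha hc)).ne'
  have h4 := (rising_pos (add_pos ha hc) (u + w)).ne'
  rw [beta, beta, h, Gamma_add_nat ha, Gamma_add_nat hc, Gamma_add_nat (add_pos ha hc)]
  field_simp

theorem ae_betaMeasure_mem_Ioo (a c : ℝ) : ∀ᵐ x ∂betaMeasure a c, x ∈ Set.Ioo (0 : ℝ) 1 := by
  have hm : Measurable (betaPDF a c) := (measurable_betaPDFReal a c).ennreal_ofReal
  rw [betaMeasure, ae_withDensity_iff hm]
  refine ae_of_all _ fun x hx => ?_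
  by_contra h
  refine hx ?_
  rw [betaPDF, betaPDFReal, if_neg (show ¬(0 < x ∧ x < 1) from h), ENNReal.ofReal_zero]

/-- The mixed moments of a beta variable. -/
theorem lintegral_betaMeasure {a c : ℝ} (ha : 0 < a) (hc : 0 < c) (u w : ℕ) :
    ∫⁻ x, ENNReal.ofReal x ^ u * ENNReal.ofReal (1 - x) ^ w ∂betaMeasure a c =
      ENNReal.ofReal (rising a u * rising c w / rising (a + c) (u + w)) := by
  have hm (a c : ℝ) : Measurable (betaPDF a c) := (measurable_betaPDFReal a c).ennreal_ofReal
  rw [betaMeasure, lintegral_withDensity_eq_lintegral_mul _ (hm a c) (by fun_prop),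
    ← beta_add_nat ha hc]
  have hpos : 0 < beta (a + u) (c + w) := beta_pos (by positivity) (by positivity)
  have hpos' : 0 < beta a c := beta_pos ha hc
  rw [← mul_one (ENNReal.ofReal _), ← lintegral_betaPDF_eq_one (α := a + u) (β := c + w)
    (by positivity) (by positivity), ← lintegral_const_mul _ (hm _ _)]
  refine lintegral_congr fun x => ?_
  simp only [Pi.mul_apply, betaPDF, betaPDFReal]
  split_ifs with hx
  · have h1 : 0 < 1 - x := by linarith [hx.2]
    have e1 : x ^ (a + u - 1) = x ^ (a - 1) * x ^ u := by
      rw [← Real.rpow_natCast, ← Real.rpow_add hx.1]; congr 1; ring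
    have e2 : (1 - x) ^ (c + w - 1) = (1 - x) ^ (c - 1) * (1 - x) ^ w := by
      rw [← Real.rpow_natCast, ← Real.rpow_add h1]; congr 1; ring
    rw [← ENNReal.ofReal_pow hx.1.le, ← ENNReal.ofReal_pow h1.le,
      ← ENNReal.ofReal_mul (pow_nonneg hx.1.le _),
      ← ENNReal.ofReal_mul (mul_nonneg (mul_nonneg (one_div_nonneg.2 hpos'.le)
        (Real.rpow_nonneg hx.1.le _)) (Real.rpow_nonneg h1.le _)),
      ← ENNReal.ofReal_mul (div_nonneg hpos.le hpos'.le), e1, e2]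
    congr 1
    field_simp
  · simp

/-- Such products tend to zero because the harmonic series diverges. -/
theorem tendsto_prod_div_zero {u v α : ℝ} (hu : 0 < u) (huv : u < v) (hα : 0 ≤ α) :
    Filter.Tendsto (fun n : ℕ => ∏ j ∈ Finset.range n, ((u + j * α) / (v + j * α)))
      Filter.atTop (nhds 0) := by
  have hv : 0 < v := hu.trans huv
  have hd (j : ℕ) : 0 < v + j * α := by positivity
  set c : ℝ := (v - u) / (v + α + 1) with hc
  have hcpos : 0 < c := div_pos (by linarith) (by positivity)
  have hub (n : ℕ) : ∏ j ∈ Finset.range n, ((u + j * α) / (v + j * α)) ≤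
      Real.exp (-(c * ∑ j ∈ Finset.range n, (1 / ((j : ℝ) + 1)))) := by
    rw [Finset.mul_sum, ← Finset.sum_neg_distrib, Real.exp_sum]
    refine Finset.prod_le_prod (fun j _ => by positivity) fun j _ => ?_
    have h1 : (u + j * α) / (v + j * α) = 1 - (v - u) / (v + j * α) := by
      field_simp [(hd j).ne']
      ring
    rw [h1]
    refine le_trans (sub_le_sub_left ?_ 1) (Real.one_sub_le_exp_neg _)
    rw [hc, div_mul_div_comm, mul_one]
    refine div_le_div_of_nonneg_left (by linarith) (hd j) ?_
    have hj : (0 : ℝ) ≤ j := j.cast_nonneg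
    nlinarith
  refine squeeze_zero (fun n => Finset.prod_nonneg fun j _ => by positivity) hub ?_
  refine Real.tendsto_exp_neg_atTop_nhds_zero.comp ?_
  exact Real.tendsto_sum_range_one_div_nat_succ_atTop.const_mul_atTop hcpos

theorem lintegral_prod_infinitePi {X : ℕ → Type*} [∀ i, MeasurableSpace (X i)]
    (μ : ∀ i, Measure (X i)) [∀ i, IsProbabilityMeasure (μ i)] {f : ∀ i, X i → ENNReal}
    (hf : ∀ i, Measurable (f i)) (N : ℕ) :
    ∫⁻ b, ∏ k ∈ Finset.range N, f k (b k) ∂Measure.infinitePi μ =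
      ∏ k ∈ Finset.range N, ∫⁻ x, f k x ∂μ k := by
  have hind : iIndepFun (fun k (b : ∀ i, X i) => f k (b k)) (Measure.infinitePi μ) :=
    iIndepFun_infinitePi hf
  rw [lintegral_prod_eq_prod_lintegral_of_indepFun (Finset.range N) _ hind fun i => by fun_prop]
  refine Finset.prod_congr rfl fun k _ => ?_
  exact (measurePreserving_eval_infinitePi μ k).lintegral_comp (hf k)

/-- The law of the independent proportions whose stick-breaking sequence has law `GEM`. -/
noncomputable def stickLaw (α θ : ℝ) : Measure (ℕ → ℝ) :=
  Measure.infinitePi fun n : ℕ => betaMeasure (1 - α) (θ + (n + 1) * α)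

theorem GEM_eq (α θ : ℝ) : GEM α θ = (stickLaw α θ).map stickBreaking := rfl

section Params

variable {α θ : ℝ}

theorem stick_param_pos (hα0 : 0 ≤ α) (hθ : -α < θ) (n : ℕ) : 0 < θ + (n + 1) * α := by
  have : 0 ≤ (n : ℝ) * α := by positivity
  linarith

theorem isProbabilityMeasure_stick (hα0 : 0 ≤ α) (hα1 : α < 1) (hθ : -α < θ) (n : ℕ) :
    IsProbabilityMeasure (betaMeasure (1 - α) (θ + (n + 1) * α)) :=
  isProbabilityMeasureBeta (by linarith) (stick_param_pos hα0 hθ n)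

theorem isProbabilityMeasure_stickLaw (hα0 : 0 ≤ α) (hα1 : α < 1) (hθ : -α < θ) :
    IsProbabilityMeasure (stickLaw α θ) := by
  have := isProbabilityMeasure_stick hα0 hα1 hθ
  unfold stickLaw
  infer_instance

theorem ae_stickLaw_mem_Ioo (hα0 : 0 ≤ α) (hα1 : α < 1) (hθ : -α < θ) :
    ∀ᵐ b ∂stickLaw α θ, ∀ n, b n ∈ Set.Ioo (0 : ℝ) 1 := by
  have := isProbabilityMeasure_stick hα0 hα1 hθ
  refine ae_all_iff.2 fun n => ?_
  exact (measurePreserving_eval_infinitePi _ n).quasiMeasurePreserving.ae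
    (ae_betaMeasure_mem_Ioo (1 - α) (θ + (n + 1) * α))

theorem lintegral_stick (hα0 : 0 ≤ α) (hα1 : α < 1) (hθ : -α < θ) (n u w : ℕ) :
    ∫⁻ x, ENNReal.ofReal x ^ u * ENNReal.ofReal (1 - x) ^ w
        ∂betaMeasure (1 - α) (θ + (n + 1) * α) =
      ENNReal.ofReal (rising (1 - α) u * rising (θ + (n + 1) * α) w /
        rising (θ + n * α + 1) (u + w)) := by
  rw [lintegral_betaMeasure (by linarith) (stick_param_pos hα0 hθ n)]
  congr 3
  ring

theorem stickBreaking_eq_sub (b : ℕ → ℝ) (n : ℕ) :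
    ∑ m ∈ Finset.range n, stickBreaking b m = 1 - ∏ m ∈ Finset.range n, (1 - b m) := by
  induction n with
  | zero => simp
  | succ n ih =>
    rw [Finset.sum_range_succ, ih, Finset.prod_range_succ, stickBreaking]
    ring

theorem stickBreaking_pos {b : ℕ → ℝ} (hb : ∀ n, b n ∈ Set.Ioo (0 : ℝ) 1) (n : ℕ) :
    0 < stickBreaking b n :=
  mul_pos (Finset.prod_pos fun m _ => by linarith [(hb m).2]) (hb n).1

/-- The length of the remaining stick tends to zero: it is decreasing and its expectation, a
product of beta moments, tends to zero. -/
theorem ae_tendsto_prod_stickLaw (hα0 : 0 ≤ α) (hα1 : α < 1) (hθ : -α < θ) :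
    ∀ᵐ b ∂stickLaw α θ, Filter.Tendsto (fun n => ∏ m ∈ Finset.range n, (1 - b m))
      Filter.atTop (nhds 0) := by
  have := isProbabilityMeasure_stick hα0 hα1 hθ
  let R : ℕ → (ℕ → ℝ) → ENNReal := fun n b => ∏ m ∈ Finset.range n, ENNReal.ofReal (1 - b m)
  have hRm (n : ℕ) : Measurable (R n) := by fun_prop
  have hR (n : ℕ) : ∫⁻ b, R n b ∂stickLaw α θ =
      ENNReal.ofReal (∏ j ∈ Finset.range n, ((θ + α + j * α) / (θ + 1 + j * α))) := by
    rw [stickLaw, lintegral_prod_infinitePi _ (f := fun _ x => ENNReal.ofReal (1 - x))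
      (fun i => by fun_prop), ENNReal.ofReal_prod_of_nonneg]
    · refine Finset.prod_congr rfl fun j _ => ?_
      have := lintegral_stick hα0 hα1 hθ j 0 1
      simp only [pow_zero, pow_one, one_mul] at this
      rw [this, rising_zero, one_mul, zero_add, rising_succ, rising_succ, rising_zero, rising_zero]
      congr 1
      simp only [Nat.cast_zero, add_zero, one_mul]
      congr 1 <;> ring
    · intro j _
      have : (0 : ℝ) ≤ j * α := by positivity
      exact div_nonneg (by linarith) (by linarith)
  have hinf : ∫⁻ b, ⨅ n, R n b ∂stickLaw α θ = 0 := by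
    have hlim : Filter.Tendsto (fun n => ∫⁻ b, R n b ∂stickLaw α θ) Filter.atTop (nhds 0) := by
      simp_rw [hR]
      rw [← ENNReal.ofReal_zero]
      exact (ENNReal.continuous_ofReal.tendsto 0).comp
        (tendsto_prod_div_zero (by linarith) (by linarith) hα0)
    refine le_antisymm (ge_of_tendsto' hlim fun n => ?_) bot_le
    exact lintegral_mono fun b => iInf_le _ n
  rw [lintegral_eq_zero_iff (Measurable.iInf hRm)] at hinf
  filter_upwards [hinf, ae_stickLaw_mem_Ioo hα0 hα1 hθ] with b hb hb01
  have hle (m : ℕ) : ENNReal.ofReal (1 - b m) ≤ 1 := by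
    rw [ENNReal.ofReal_le_one]; linarith [(hb01 m).1]
  have hanti : Antitone fun n => R n b := antitone_nat_of_succ_le fun n => by
    simp only [R, Finset.prod_range_succ]
    exact mul_le_of_le_one_right' (hle n)
  have ht := tendsto_atTop_iInf hanti
  rw [hb] at ht
  have ht' := (ENNReal.tendsto_toReal (by simp : (0 : ENNReal) ≠ ⊤)).comp ht
  refine ht'.congr fun n => ?_
  simp only [R, Function.comp_apply, ENNReal.toReal_prod]
  refine Finset.prod_congr rfl fun m _ => ?_
  rw [ENNReal.toReal_ofReal (by linarith [(hb01 m).2])]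

theorem ae_hasSum_stickLaw (hα0 : 0 ≤ α) (hα1 : α < 1) (hθ : -α < θ) :
    ∀ᵐ b ∂stickLaw α θ, HasSum (stickBreaking b) 1 := by
  filter_upwards [ae_tendsto_prod_stickLaw hα0 hα1 hθ, ae_stickLaw_mem_Ioo hα0 hα1 hθ] with b hb hb'
  rw [hasSum_iff_tendsto_nat_of_nonneg fun n => (stickBreaking_pos hb' n).le]
  simp_rw [stickBreaking_eq_sub]
  simpa using hb.const_sub 1

theorem measurableSet_pos_hasSum : MeasurableSet {x : ℕ → ℝ | (∀ i, 0 < x i) ∧ HasSum x 1} := by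
  have h : {x : ℕ → ℝ | (∀ i, 0 < x i) ∧ HasSum x 1} = {x : ℕ → ℝ | ∀ i, 0 < x i} ∩
      {x | Filter.Tendsto (fun n => ∑ i ∈ Finset.range n, x i) Filter.atTop (nhds 1)} := by
    ext x
    simp only [Set.mem_ofPred_eq, Set.mem_inter_iff]
    exact and_congr_right fun h => hasSum_iff_tendsto_nat_of_nonneg (fun i => (h i).le) 1
  rw [h, Set.ofPred_forall]
  exact (MeasurableSet.iInter fun i => measurableSet_lt measurable_const
    (measurable_pi_apply i)).inter (measurableSet_tendsto _ fun n => by fun_prop)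

theorem ae_GEM (hα0 : 0 ≤ α) (hα1 : α < 1) (hθ : -α < θ) :
    ∀ᵐ x ∂GEM α θ, (∀ i, 0 < x i) ∧ HasSum x 1 := by
  rw [GEM_eq, ae_map_iff measurable_stickBreaking.aemeasurable measurableSet_pos_hasSum]
  filter_upwards [ae_hasSum_stickLaw hα0 hα1 hθ, ae_stickLaw_mem_Ioo hα0 hα1 hθ] with b hb hb'
  exact ⟨stickBreaking_pos hb', hb⟩

/-- The stick-breaking sequence with first proportion `p` whose remainder is broken
according to `x`. -/
noncomputable def consStick (p : ℝ) (x : ℕ → ℝ) : ℕ → ℝ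
  | 0 => p
  | n + 1 => (1 - p) * x n

theorem measurable_consStick : Measurable fun q : ℝ × (ℕ → ℝ) => consStick q.1 q.2 := by
  refine measurable_pi_lambda _ fun n => ?_
  cases n <;> simp only [consStick] <;> fun_prop

theorem infinitePi_succ {Z : Type*} [MeasurableSpace Z] (μ : ℕ → Measure Z)
    [∀ i, IsProbabilityMeasure (μ i)] :
    Measure.infinitePi μ = ((μ 0).prod (Measure.infinitePi fun n => μ (n + 1))).map
      (fun q : Z × (ℕ → Z) => (fun n => Nat.casesOn n q.1 q.2 : ℕ → Z)) := by
  have hmeas : Measurable fun q : Z × (ℕ → Z) => (fun n => Nat.casesOn n q.1 q.2 : ℕ → Z) := by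
    refine measurable_pi_lambda _ fun n => ?_
    cases n
    · exact measurable_fst
    · exact (measurable_pi_apply _).comp measurable_snd
  symm
  refine Measure.eq_infinitePi _ fun s t ht => ?_
  classical
  rw [Measure.map_apply hmeas (MeasurableSet.pi s.countable_toSet fun i _ => ht i)]
  set t' : ℕ → Set Z := fun i => if i ∈ s then t i else Set.univ with ht'
  have ht'm (i : ℕ) : MeasurableSet (t' i) := by
    simp only [ht']; split_ifs
    exacts [ht i, MeasurableSet.univ]
  obtain ⟨N, hN⟩ := s.exists_nat_subset_range
  have hset : (fun q : Z × (ℕ → Z) => (fun n => Nat.casesOn n q.1 q.2 : ℕ → Z)) ⁻¹' (Set.pi s t) =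
      t' 0 ×ˢ (Set.pi (Finset.range N) fun n => t' (n + 1)) := by
    ext q
    simp only [Set.mem_preimage, Set.mem_pi, Set.mem_prod, ht', Finset.mem_coe]
    constructor
    · intro h
      refine ⟨?_, fun i _ => ?_⟩
      · split_ifs with h0
        exacts [h 0 h0, trivial]
      · split_ifs with h0
        exacts [h (i + 1) h0, trivial]
    · rintro ⟨h0, h1⟩ i hi
      cases i with
      | zero => simpa [hi] using h0
      | succ i =>
        have := h1 i (by have := Finset.mem_range.1 (hN hi); simp; omega)
        simpa [hi] using this
  rw [hset, Measure.prod_prod, Measure.infinitePi_pi _ fun i _ => ht'm (i + 1), mul_comm,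
    ← Finset.prod_range_succ' (fun i => μ i (t' i))]
  rw [← Finset.prod_subset (hN.trans (Finset.range_mono N.le_succ)) fun i _ hi => by
    simp [ht', hi]]
  exact Finset.prod_congr rfl fun i hi => by simp [ht', hi]

theorem stickBreaking_cons (p : ℝ) (b : ℕ → ℝ) :
    stickBreaking (fun n => Nat.casesOn n p b : ℕ → ℝ) = consStick p (stickBreaking b) := by
  funext n
  cases n with
  | zero => simp [stickBreaking, consStick]
  | succ n =>
    simp only [stickBreaking, consStick, Finset.prod_range_succ']
    change (∏ m ∈ Finset.range n, (1 - b m)) * (1 - p) * b n = _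
    ring

/-- The `GEM(α, θ)` law is obtained from the `GEM(α, θ + α)` law by one stick-breaking step. -/
theorem GEM_eq_map_consStick (hα0 : 0 ≤ α) (hα1 : α < 1) (hθ : -α < θ) :
    GEM α θ = ((betaMeasure (1 - α) (θ + α)).prod (GEM α (θ + α))).map
      fun q => consStick q.1 q.2 := by
  have h0 := isProbabilityMeasure_stick hα0 hα1 hθ
  have h1 := isProbabilityMeasure_stickLaw hα0 hα1 (θ := θ + α) (by linarith)
  have h2 : IsProbabilityMeasure (betaMeasure (1 - α) (θ + α)) :=
    isProbabilityMeasureBeta (by linarith) (by linarith)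
  have hs : stickLaw α θ = ((betaMeasure (1 - α) (θ + α)).prod (stickLaw α (θ + α))).map
      (fun q : ℝ × (ℕ → ℝ) => (fun n => Nat.casesOn n q.1 q.2 : ℕ → ℝ)) := by
    have e1 : (fun n : ℕ => betaMeasure (1 - α) (θ + α + (n + 1) * α)) =
        fun n : ℕ => betaMeasure (1 - α) (θ + ((n + 1 : ℕ) + 1) * α) := by
      funext n
      congr 1
      push_cast
      ring
    rw [stickLaw, infinitePi_succ, stickLaw, e1]
    simp
  have hmeas : Measurable fun q : ℝ × (ℕ → ℝ) => (fun n => Nat.casesOn n q.1 q.2 : ℕ → ℝ) := by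
    refine measurable_pi_lambda _ fun n => ?_
    cases n
    · exact measurable_fst
    · exact (measurable_pi_apply _).comp measurable_snd
  rw [GEM_eq, hs, Measure.map_map measurable_stickBreaking hmeas, GEM_eq]
  have h3 : (betaMeasure (1 - α) (θ + α)).prod ((stickLaw α (θ + α)).map stickBreaking) =
      ((betaMeasure (1 - α) (θ + α)).prod (stickLaw α (θ + α))).map
        (Prod.map id stickBreaking) := by
    rw [← Measure.map_prod_map _ _ measurable_id measurable_stickBreaking, Measure.map_id]
  rw [h3, Measure.map_map measurable_consStick
    (measurable_id.prodMap measurable_stickBreaking)]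
  congr 1
  funext q
  exact stickBreaking_cons q.1 q.2

end Params

/-! ### The Chinese restaurant prediction rule -/

/-- The number of occurrences of the label `z` among the first `n` terms. -/
def occ {ι : Type*} [DecidableEq ι] (L : ℕ → ι) (z : ι) (n : ℕ) : ℕ :=
  ((Finset.range n).filter fun m => L m = z).card

section Occ

variable {ι : Type*} [DecidableEq ι]

@[simp] theorem occ_zero (L : ℕ → ι) (z : ι) : occ L z 0 = 0 := by simp [occ]

theorem occ_succ (L : ℕ → ι) (z : ι) (n : ℕ) :
    occ L z (n + 1) = occ L z n + if L n = z then 1 else 0 := by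
  rw [occ, Finset.range_add_one, Finset.filter_insert]
  split_ifs with h
  · rw [Finset.card_insert_of_notMem (by simp), occ]
  · rw [occ, add_zero]

theorem occ_congr {L : ℕ → ι} {κ : Type*} [DecidableEq κ] {L' : ℕ → κ} {z : ι} {z' : κ} {n : ℕ}
    (h : ∀ m < n, L m = z ↔ L' m = z') : occ L z n = occ L' z' n := by
  rw [occ, occ]
  congr 1
  ext m
  simp only [Finset.mem_filter, Finset.mem_range]
  exact and_congr_right fun hm => h m hm

theorem occ_pos_iff {L : ℕ → ι} {z : ι} {n : ℕ} : 0 < occ L z n ↔ ∃ m < n, L m = z := by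
  rw [occ, Finset.card_pos]
  constructor
  · rintro ⟨m, hm⟩
    simp only [Finset.mem_filter, Finset.mem_range] at hm
    exact ⟨m, hm⟩
  · rintro ⟨m, hm⟩
    exact ⟨m, by simpa using hm⟩

theorem occ_eq_zero {L : ℕ → ι} {z : ι} {n : ℕ} (h : ∀ m < n, L m ≠ z) : occ L z n = 0 := by
  by_contra h0
  obtain ⟨m, hm, hz⟩ := occ_pos_iff.1 (Nat.pos_of_ne_zero h0)
  exact h m hm hz

theorem sum_occ {d : ℕ → ℕ} {K n : ℕ} (h : ∀ m < n, d m < K) :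
    ∑ k ∈ Finset.range K, occ d k n = n := by
  induction n with
  | zero => simp
  | succ n ih =>
    simp_rw [occ_succ]
    rw [Finset.sum_add_distrib, ih fun m hm => h m (by omega), Finset.sum_ite_eq,
      if_pos (Finset.mem_range.2 (h n n.lt_succ_self))]

theorem RestrictedGrowth.lt_numBlocks {d : ℕ → ℕ} {n : ℕ} (h : RestrictedGrowth d n) {m : ℕ}
    (hm : m < n) : d m < numBlocks d n := h.lt_numBlocks_iff.2 ⟨m, hm, rfl⟩

theorem RestrictedGrowth.occ_pos {d : ℕ → ℕ} {n : ℕ} (h : RestrictedGrowth d n) {k : ℕ}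
    (hk : k < numBlocks d n) : 0 < occ d k n := occ_pos_iff.2 (h.lt_numBlocks_iff.1 hk)

theorem RestrictedGrowth.sum_occ {d : ℕ → ℕ} {n : ℕ} (h : RestrictedGrowth d n) :
    ∑ k ∈ Finset.range (numBlocks d n), occ d k n = n :=
  FragCoag.sum_occ fun _ hm => h.lt_numBlocks hm

theorem RestrictedGrowth.numBlocks_succ {d : ℕ → ℕ} {n : ℕ} (h : RestrictedGrowth d (n + 1)) :
    numBlocks d (n + 1) = if d n < numBlocks d n then numBlocks d n else numBlocks d n + 1 := by
  have h' := h.mono n.le_succ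
  split_ifs with hn
  · obtain ⟨m, hm, hmn⟩ := h'.lt_numBlocks_iff.1 hn
    exact numBlocks_succ_of_mem hm hmn
  · refine numBlocks_succ_of_new fun m hm hmn => hn ?_
    rw [← hmn]
    exact h'.lt_numBlocks hm

theorem RestrictedGrowth.succ {d : ℕ → ℕ} {n : ℕ} (h : RestrictedGrowth d n)
    (hn : d n ≤ numBlocks d n) : RestrictedGrowth d (n + 1) := by
  intro m hm
  rcases Nat.lt_succ_iff_lt_or_eq.1 hm with hm | rfl
  exacts [h m hm, hn]

end Occ

/-- The probability that an `(α, θ)` partition of a finite set consists of `K` given blocks of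
sizes `c 0, …, c (K - 1)`. -/
noncomputable def eppf (α θ : ℝ) (K : ℕ) (c : ℕ → ℕ) : ℝ :=
  (∏ k ∈ Finset.range K, rising (1 - α) (c k - 1)) *
    (∏ i ∈ Finset.range (K - 1), (θ + (i + 1) * α)) /
      rising (θ + 1) ((∑ k ∈ Finset.range K, c k) - 1)

/-- The prediction rule of the Chinese restaurant process: element `n` joins the block with index
`e` with probability proportional to its size minus `α`, and forms a new block with probability
proportional to `θ + α K`, where `K` is the current number of blocks. -/
noncomputable def crpRule (α θ : ℝ) (n : ℕ) (a : ℕ → ℕ) (e : ℕ) : ENNReal :=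
  if n = 0 then if e = 0 then 1 else 0
  else if e < numBlocks a n then ENNReal.ofReal ((occ a e n - α) / (θ + n))
  else if e = numBlocks a n then ENNReal.ofReal ((θ + α * numBlocks a n) / (θ + n))
  else 0

section CRP

variable {α θ : ℝ}

theorem eppf_nonneg (hα0 : 0 ≤ α) (hα1 : α < 1) (hθ : -α < θ) (K : ℕ) (c : ℕ → ℕ) :
    0 ≤ eppf α θ K c := by
  refine div_nonneg (mul_nonneg (Finset.prod_nonneg fun k _ => ?_)
    (Finset.prod_nonneg fun i _ => (stick_param_pos hα0 hθ i).le)) (rising_pos (by linarith) _).le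
  exact (rising_pos (by linarith) _).le

theorem eppf_join (hα1 : α < 1) (hθ : -α < θ) {K : ℕ} {c c' : ℕ → ℕ} {z : ℕ}
    (hz : z < K) (hcz : 0 < c z) (hc' : ∀ k, c' k = c k + if z = k then 1 else 0) :
    eppf α θ K c' =
      eppf α θ K c * ((c z - α) / (θ + (∑ k ∈ Finset.range K, c k : ℕ))) := by
  set n := ∑ k ∈ Finset.range K, c k with hn
  have hn0 : 0 < n := hcz.trans_le (Finset.single_le_sum (f := c) (fun _ _ => Nat.zero_le _)
    (Finset.mem_range.2 hz))
  have hn' : ∑ k ∈ Finset.range K, c' k = n + 1 := by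
    simp_rw [hc']
    rw [Finset.sum_add_distrib]
    simp [hz, hn]
  have hprod : ∏ k ∈ Finset.range K, rising (1 - α) (c' k - 1) =
      (∏ k ∈ Finset.range K, rising (1 - α) (c k - 1)) * (c z - α) := by
    have : ∀ k ∈ Finset.range K, rising (1 - α) (c' k - 1) =
        rising (1 - α) (c k - 1) * if z = k then (c z - α) else 1 := by
      intro k _
      rw [hc' k]
      split_ifs with h
      · subst h
        rw [Nat.sub_add_comm hcz, rising_succ]
        push_cast [Nat.cast_sub hcz]
        ring
      · simp
    rw [Finset.prod_congr rfl this, Finset.prod_mul_distrib]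
    simp [hz]
  have hr : rising (θ + 1) (n + 1 - 1) = rising (θ + 1) (n - 1) * (θ + n) := by
    rw [Nat.sub_add_comm hn0, rising_succ]
    push_cast [Nat.cast_sub hn0]
    ring
  rw [eppf, eppf, hn', hprod, hr, ← hn]
  have h1 := (rising_pos (by linarith : 0 < θ + 1) (n - 1)).ne'
  have h2 : θ + n ≠ 0 := by
    have : (1 : ℝ) ≤ n := by exact_mod_cast hn0
    have : 0 < θ + n := by linarith
    exact this.ne'
  field_simp

theorem eppf_new (hα1 : α < 1) (hθ : -α < θ) {K : ℕ} (hK : 0 < K) {c c' : ℕ → ℕ}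
    (hn0 : 0 < ∑ k ∈ Finset.range K, c k) (hc' : ∀ k < K, c' k = c k) (hc'K : c' K = 1) :
    eppf α θ (K + 1) c' =
      eppf α θ K c * ((θ + α * K) / (θ + (∑ k ∈ Finset.range K, c k : ℕ))) := by
  set n := ∑ k ∈ Finset.range K, c k with hn
  have hn' : ∑ k ∈ Finset.range (K + 1), c' k = n + 1 := by
    rw [Finset.sum_range_succ, hc'K, Finset.sum_congr rfl fun k hk => hc' k (Finset.mem_range.1 hk)]
  have hprod : ∏ k ∈ Finset.range (K + 1), rising (1 - α) (c' k - 1) =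
      ∏ k ∈ Finset.range K, rising (1 - α) (c k - 1) := by
    rw [Finset.prod_range_succ, hc'K,
      Finset.prod_congr rfl fun k hk => by rw [hc' k (Finset.mem_range.1 hk)]]
    simp
  have hprod' : ∏ i ∈ Finset.range (K + 1 - 1), (θ + (i + 1) * α) =
      (∏ i ∈ Finset.range (K - 1), (θ + (i + 1) * α)) * (θ + α * K) := by
    rw [Nat.sub_add_comm hK, Finset.prod_range_succ]
    push_cast [Nat.cast_sub hK]
    ring
  have hr : rising (θ + 1) (n + 1 - 1) = rising (θ + 1) (n - 1) * (θ + n) := by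
    rw [Nat.sub_add_comm hn0, rising_succ]
    push_cast [Nat.cast_sub hn0]
    ring
  rw [eppf, eppf, hn', hprod, hr, ← hn, hprod']
  have h1 := (rising_pos (by linarith : 0 < θ + 1) (n - 1)).ne'
  have h2 : θ + n ≠ 0 := by
    have : (1 : ℝ) ≤ n := by exact_mod_cast hn0
    have : 0 < θ + n := by linarith
    exact this.ne'
  field_simp

theorem occ_update (a : ℕ → ℕ) (n e k : ℕ) :
    occ (Function.update a n e) k (n + 1) = occ a k n + if e = k then 1 else 0 := by
  rw [occ_succ, Function.update_self]
  congr 1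
  exact occ_congr fun m hm => by rw [Function.update_of_ne hm.ne]

theorem numBlocks_update (a : ℕ → ℕ) (n e : ℕ) :
    numBlocks (Function.update a n e) n = numBlocks a n :=
  numBlocks_prefix fun m hm => by rw [Function.update_of_ne hm.ne]

theorem restrictedGrowth_congr {a b : ℕ → ℕ} {n : ℕ} (h : ∀ m < n, a m = b m) :
    RestrictedGrowth a n ↔ RestrictedGrowth b n := by
  refine forall₂_congr fun m hm => ?_
  rw [h m hm, numBlocks_prefix (x := a) (y := b) fun l hl => h l (by omega)]

/-- A random restricted growth sequence whose finite-dimensional distributions are given by `eppf`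
follows the Chinese restaurant prediction rule. -/
theorem hasPrediction_of_eppf (hα0 : 0 ≤ α) (hα1 : α < 1) (hθ : -α < θ) {μ : Measure (ℕ → ℕ)}
    (h0 : ∀ a n, ¬ RestrictedGrowth a n → μ (prefixSet a n) = 0)
    (h1 : ∀ a n, RestrictedGrowth a n →
      μ (prefixSet a n) = ENNReal.ofReal (eppf α θ (numBlocks a n) fun k => occ a k n)) :
    HasPrediction μ (crpRule α θ) := by
  intro n a e
  rw [prefixSet_update]
  set a' := Function.update a n e with ha'
  have hcongr : RestrictedGrowth a' n ↔ RestrictedGrowth a n :=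
    restrictedGrowth_congr fun m hm => Function.update_of_ne hm.ne _ _
  have hK : numBlocks a' n = numBlocks a n := numBlocks_update a n e
  have hae : a' n = e := Function.update_self ..
  by_cases hrg : RestrictedGrowth a n
  swap
  · rw [h0 a n hrg, zero_mul, h0]
    exact fun h => hrg (hcongr.1 (h.mono n.le_succ))
  have hocc := occ_update a n e
  rw [h1 a n hrg, crpRule]
  rcases Nat.eq_zero_or_pos n with rfl | hn
  · rw [if_pos rfl]
    split_ifs with he
    · subst he
      have hrg' : RestrictedGrowth a' 1 := by
        intro m hm
        rw [Nat.lt_one_iff] at hm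
        rw [hm, hae]; exact Nat.zero_le _
      have hK1 : numBlocks a' 1 = 1 :=
        (numBlocks_succ_of_new (n := 0) fun m hm => by omega).trans (by simp)
      rw [h1 a' _ hrg', hK1, numBlocks_zero]
      have h01 : occ a' 0 1 = 1 := (hocc 0).trans (by simp)
      simp [eppf, h01]
    · rw [h0, mul_zero]
      intro h
      have := h 0 Nat.one_pos
      rw [numBlocks_zero, hae] at this
      omega
  have hKpos : 0 < numBlocks a n := numBlocks_pos a hn
  have hsum := hrg.sum_occ
  have hp := eppf_nonneg hα0 hα1 hθ (numBlocks a n) fun k => occ a k n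
  rw [if_neg hn.ne']
  split_ifs with he he'
  · have hrg' : RestrictedGrowth a' (n + 1) := (hcongr.2 hrg).succ (by omega)
    have hK' : numBlocks a' (n + 1) = numBlocks a n := by
      rw [hrg'.numBlocks_succ, hK, hae, if_pos he]
    have := eppf_join hα1 hθ he (hrg.occ_pos he) hocc
    rw [hsum] at this
    rw [h1 a' _ hrg', hK', this, ENNReal.ofReal_mul hp]
  · have hrg' : RestrictedGrowth a' (n + 1) := (hcongr.2 hrg).succ (by omega)
    have hK' : numBlocks a' (n + 1) = numBlocks a n + 1 := by
      rw [hrg'.numBlocks_succ, hK, hae, if_neg he]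
    have := eppf_new hα1 hθ (c := fun k => occ a k n) (c' := fun k => occ a' k (n + 1)) hKpos
      (by rw [hsum]; exact hn) (fun k hk => by rw [hocc, if_neg (by omega), add_zero])
      (by
        rw [hocc, if_pos he', occ_eq_zero fun m hm => ?_]
        exact (hrg.lt_numBlocks hm).ne)
    rw [hsum] at this
    rw [h1 a' _ hrg', hK', this, ENNReal.ofReal_mul hp]
  · rw [mul_zero, h0]
    intro h
    have := h n n.lt_succ_self
    rw [hK, hae] at this
    omega

theorem restrictedGrowth_of_crpRule {n : ℕ} {a : ℕ → ℕ}
    (h : ∀ m < n, crpRule α θ m a (a m) ≠ 0) : RestrictedGrowth a n := by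
  intro m hm
  have := h m hm
  rw [crpRule] at this
  split_ifs at this with h1 h2 h3 h4
  · omega
  · exact absurd rfl this
  · omega
  · omega
  · exact absurd rfl this

theorem HasPrediction.restrictedGrowth {μ : Measure (ℕ → ℕ)} (hμ : HasPrediction μ (crpRule α θ))
    {a : ℕ → ℕ} {n : ℕ} (h : μ (prefixSet a n) ≠ 0) : RestrictedGrowth a n :=
  restrictedGrowth_of_crpRule (hμ.prefixSet_succ_ne_zero h)

theorem crpRule_congr {n : ℕ} {a b : ℕ → ℕ} (h : ∀ m < n, a m = b m) (e : ℕ) :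
    crpRule α θ n a e = crpRule α θ n b e := by
  rw [crpRule, crpRule, numBlocks_prefix h, occ_congr (L' := b) fun m hm => by rw [h m hm]]

end CRP

/-! ### Independent labels -/

open Classical in
/-- The law of a random label that takes the value `i` with probability `x i`, for a nonnegative
sequence `x` with sum one (for other sequences the value is a placeholder). -/
noncomputable def labelLaw (x : ℕ → ℝ) : Measure ℕ :=
  if (∀ i, 0 ≤ x i) ∧ ∑' i, ENNReal.ofReal (x i) = 1 then
    Measure.sum fun i => ENNReal.ofReal (x i) • Measure.dirac i
  else Measure.dirac 0

theorem tsum_ofReal_eq_one {x : ℕ → ℝ} (h0 : ∀ i, 0 ≤ x i) (h1 : HasSum x 1) :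
    ∑' i, ENNReal.ofReal (x i) = 1 := by
  rw [← ENNReal.ofReal_tsum_of_nonneg h0 h1.summable, h1.tsum_eq, ENNReal.ofReal_one]

instance isProbabilityMeasure_labelLaw (x : ℕ → ℝ) : IsProbabilityMeasure (labelLaw x) := by
  unfold labelLaw
  split_ifs with h
  · constructor
    simp only [MeasurableSet.univ, Measure.sum_apply, Measure.smul_apply, measure_univ,
      smul_eq_mul, mul_one]
    exact h.2
  · infer_instance

theorem measurable_labelLaw : Measurable labelLaw := by
  classical
  refine Measurable.ite ?_ ?_ measurable_const
  · refine MeasurableSet.inter (s₁ := {x : ℕ → ℝ | ∀ i, 0 ≤ x i}) ?_ ?_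
    · rw [Set.ofPred_forall]
      exact MeasurableSet.iInter fun i => measurableSet_le measurable_const (measurable_pi_apply i)
    · exact measurableSet_eq_fun
        (Measurable.tsum fun i => (measurable_pi_apply i).ennreal_ofReal) measurable_const
  · refine Measure.measurable_of_measurable_coe _ fun s hs => ?_
    simp only [hs, Measure.sum_apply, Measure.smul_apply, smul_eq_mul]
    exact Measurable.tsum fun i => ((measurable_pi_apply i).ennreal_ofReal).mul_const _

theorem pickLaw_eq_labelLaw {x : ℕ → ℝ} (hx : x ∈ massPartitions) : pickLaw x = labelLaw x := by
  rw [pickLaw, labelLaw, if_pos hx,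
    if_pos ⟨fun i => (hx.1 i).le, tsum_ofReal_eq_one (fun i => (hx.1 i).le) hx.2.2⟩]

theorem labelLaw_apply {x : ℕ → ℝ} (h0 : ∀ i, 0 ≤ x i) (h1 : HasSum x 1) (s : Set ℕ) :
    labelLaw x s = ∑' i, ENNReal.ofReal (x i) * s.indicator 1 i := by
  rw [labelLaw, if_pos ⟨h0, tsum_ofReal_eq_one h0 h1⟩, Measure.sum_apply _ (.of_discrete)]
  refine tsum_congr fun i => ?_
  rw [Measure.smul_apply, Measure.dirac_apply, smul_eq_mul]

theorem labelLaw_singleton {x : ℕ → ℝ} (h0 : ∀ i, 0 ≤ x i) (h1 : HasSum x 1) (i : ℕ) :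
    labelLaw x {i} = ENNReal.ofReal (x i) := by
  rw [labelLaw_apply h0 h1, tsum_eq_single i]
  · simp
  · intro j hj
    simp [hj]

theorem labelLaw_Ici {x : ℕ → ℝ} (h0 : ∀ i, 0 ≤ x i) (h1 : HasSum x 1) (K : ℕ) :
    labelLaw x (Set.Ici K) = ENNReal.ofReal (1 - ∑ j ∈ Finset.range K, x j) := by
  have hc : (Set.Ici K)ᶜ = ⋃ j ∈ Finset.range K, {j} := by ext; simp
  have h2 : labelLaw x (Set.Ici K)ᶜ = ENNReal.ofReal (∑ j ∈ Finset.range K, x j) := by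
    rw [hc, measure_biUnion_finset (fun i _ j _ hij => by simpa using hij)
      (fun _ _ => .of_discrete), ENNReal.ofReal_sum_of_nonneg fun i _ => h0 i]
    exact Finset.sum_congr rfl fun j _ => labelLaw_singleton h0 h1 j
  rw [← compl_compl (Set.Ici K), prob_compl_eq_one_sub .of_discrete, h2,
    ENNReal.ofReal_sub _ (Finset.sum_nonneg fun i _ => h0 i), ENNReal.ofReal_one]

/-- Given `x`, the law of a sequence of independent labels with law `labelLaw x`. -/
noncomputable def labelKernel : Kernel (ℕ → ℝ) (ℕ → ℕ) :=
  ⟨fun x => Measure.infinitePi fun _ : ℕ => labelLaw x,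
    measurable_infinitePi_const measurable_labelLaw⟩

theorem labelKernel_apply (x : ℕ → ℝ) :
    labelKernel x = Measure.infinitePi fun _ : ℕ => labelLaw x := rfl

instance isMarkovKernel_labelKernel : IsMarkovKernel labelKernel :=
  ⟨fun x => by rw [labelKernel_apply]; infer_instance⟩

/-! ### The sequential construction -/

/-- The number of blocks after `n` steps when labels that skip values are clipped. -/
def clipState (L : ℕ → ℕ) : ℕ → ℕ
  | 0 => 0
  | n + 1 => if L n < clipState L n then clipState L n else clipState L n + 1

/-- The restricted growth sequence obtained from a sequence of labels: a label that is not the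
index of an existing block opens the next block. -/
def clip (L : ℕ → ℕ) (n : ℕ) : ℕ := min (L n) (clipState L n)

theorem clip_spec (L : ℕ → ℕ) (n : ℕ) :
    RestrictedGrowth (clip L) n ∧ numBlocks (clip L) n = clipState L n := by
  induction n with
  | zero => exact ⟨fun m hm => by omega, by simp [clipState]⟩
  | succ n ih =>
    have h : RestrictedGrowth (clip L) (n + 1) := ih.1.succ (by rw [ih.2]; exact min_le_right _ _)
    refine ⟨h, ?_⟩
    rw [h.numBlocks_succ, ih.2, clipState, clip]
    simp

theorem measurable_clip : Measurable clip := by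
  have hs (n : ℕ) (x y : ℕ → ℕ) (h : ∀ m < n, x m = y m) : clipState x n = clipState y n := by
    induction n with
    | zero => rfl
    | succ n ih => rw [clipState, clipState, ih fun m hm => h m (by omega), h n n.lt_succ_self]
  refine measurable_pi_lambda _ fun n => measurable_of_prefix (n + 1) fun x y h => ?_
  rw [clip, clip, h n n.lt_succ_self, hs n x y fun m hm => h m (by omega)]

theorem clip_mem_prefixSet_iff {d : ℕ → ℕ} {n : ℕ} (hd : RestrictedGrowth d n) (L : ℕ → ℕ) :
    clip L ∈ prefixSet d n ↔
      ∀ m < n, L m ∈ if d m < numBlocks d m then {d m} else Set.Ici (numBlocks d m) := by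
  induction n with
  | zero => simp [prefixSet]
  | succ n ih =>
    rw [prefixSet_succ]
    have ih' := ih (hd.mono n.le_succ)
    have hiff (h : clip L ∈ prefixSet d n) : (clip L n = d n ↔
        L n ∈ if d n < numBlocks d n then {d n} else Set.Ici (numBlocks d n)) := by
      have hK : clipState L n = numBlocks d n := by
        rw [← (clip_spec L n).2]
        exact numBlocks_prefix h
      have := hd n n.lt_succ_self
      rw [clip, hK]
      split_ifs with hlt
      · simp only [Set.mem_singleton_iff]; omega
      · simp only [Set.mem_Ici]; omega
    constructor
    · rintro ⟨h1, h2⟩ m hm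
      rcases Nat.lt_succ_iff_lt_or_eq.1 hm with hm | rfl
      · exact ih'.1 h1 m hm
      · exact (hiff h1).1 h2
    · intro h
      have h1 := ih'.2 fun m hm => h m (by omega)
      exact ⟨h1, (hiff h1).2 (h n n.lt_succ_self)⟩

/-- The law of the Chinese restaurant process, constructed from a `GEM` sequence. -/
noncomputable def crpLaw (α θ : ℝ) : Measure (ℕ → ℕ) :=
  ((GEM α θ).bind labelKernel).map clip

/-- Collecting the stick-breaking weights of the labels `d 0, …, d (n - 1)`: each label `d m`
contributes the factors `γ j` for `j < d m`, and the factor `β (d m)` if `p m` holds. -/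
theorem prod_clip_weights {M : Type*} [CommMonoid M] (β γ : ℕ → M) (d : ℕ → ℕ) (p : ℕ → Prop)
    [DecidablePred p]
    (n N : ℕ) (hd : ∀ m < n, d m < N) :
    ∏ m ∈ Finset.range n, ((∏ j ∈ Finset.range (d m), γ j) * if p m then β (d m) else 1) =
      ∏ k ∈ Finset.range N, (β k ^ ((Finset.range n).filter fun m => d m = k ∧ p m).card *
        γ k ^ ((Finset.range n).filter fun m => k < d m).card) := by
  induction n with
  | zero => simp
  | succ n ih =>
    rw [Finset.prod_range_succ, ih fun m hm => hd m (by omega)]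
    have h1 : (∏ j ∈ Finset.range (d n), γ j) * (if p n then β (d n) else 1) =
        ∏ k ∈ Finset.range N,
          ((if d n = k ∧ p n then β k else 1) * if k < d n then γ k else 1) := by
      have hN := hd n n.lt_succ_self
      rw [Finset.prod_mul_distrib, mul_comm]
      congr 1
      · rw [Finset.prod_eq_single (d n)]
        · simp
        · intro k _ hk
          rw [if_neg fun h => hk h.1.symm]
        · intro h; exact absurd (Finset.mem_range.2 hN) h
      · rw [← Finset.prod_filter]
        refine Finset.prod_congr ?_ fun _ _ => rfl
        ext k
        simp only [Finset.mem_range, Finset.mem_filter]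
        omega
    rw [h1, ← Finset.prod_mul_distrib]
    refine Finset.prod_congr rfl fun k _ => ?_
    rw [Finset.range_add_one, Finset.filter_insert, Finset.filter_insert]
    have e1 : (if d n = k ∧ p n then insert n ((Finset.range n).filter fun m => d m = k ∧ p m) else
        (Finset.range n).filter fun m => d m = k ∧ p m).card =
        ((Finset.range n).filter fun m => d m = k ∧ p m).card + if d n = k ∧ p n then 1 else 0 := by
      split_ifs
      · rw [Finset.card_insert_of_notMem (by simp)]
      · rfl
    have e2 : (if k < d n then insert n ((Finset.range n).filter fun m => k < d m) else
        (Finset.range n).filter fun m => k < d m).card =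
        ((Finset.range n).filter fun m => k < d m).card + if k < d n then 1 else 0 := by
      split_ifs
      · rw [Finset.card_insert_of_notMem (by simp)]
      · rfl
    rw [e1, e2, pow_add, pow_add]
    split_ifs <;> simp only [pow_one, pow_zero, mul_one] <;> ac_rfl

/-- Here `w k` counts the terms larger than `k`, and `u (k + 1)` the terms equal to `k + 1`
except for the one that opens block `k + 1`. This is why the product of the beta moments
telescopes. -/
theorem prod_rising_telescope {α θ : ℝ} (hα0 : 0 ≤ α) (hα1 : α < 1) (hθ : -α < θ) {u w : ℕ → ℕ}
    (K : ℕ) (h : ∀ k < K, w k = u (k + 1) + w (k + 1) + 1) :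
    ∏ k ∈ Finset.range K, (rising (θ + (k + 1) * α) (w k) / rising (θ + k * α + 1) (u k + w k)) =
      (∏ i ∈ Finset.range K, (θ + (i + 1) * α)) * rising (θ + K * α + 1) (u K + w K) /
        rising (θ + 1) (u 0 + w 0) := by
  have hpos (k : ℕ) : 0 < θ + k * α + 1 := by
    have : 0 ≤ (k : ℝ) * α := by positivity
    linarith
  induction K with
  | zero =>
    have := (rising_pos (by linarith : 0 < θ + 1) (u 0 + w 0)).ne'
    simp [this]
  | succ K ih =>
    rw [Finset.prod_range_succ, ih fun k hk => h k (by omega), Finset.prod_range_succ,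
      h K K.lt_succ_self, rising_succ']
    have h1 := (rising_pos (hpos K) (u K + (u (K + 1) + w (K + 1) + 1))).ne'
    have h2 := (rising_pos (by linarith : 0 < θ + 1) (u 0 + w 0)).ne'
    push_cast
    rw [div_mul_div_comm, div_eq_div_iff (mul_ne_zero h2 h1) h2]
    ring

section ClipLaw

variable {α θ : ℝ}

theorem isProbabilityMeasure_crpLaw (hα0 : 0 ≤ α) (hα1 : α < 1) (hθ : -α < θ) :
    IsProbabilityMeasure (crpLaw α θ) := by
  have := isProbabilityMeasure_GEM hα0 hα1 hθ
  exact Measure.isProbabilityMeasure_map measurable_clip.aemeasurable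

/-- Given the proportions `b`, the next clipped label is `k` with the stick-breaking probability
if block `k` exists already, and opens a new block with the remaining probability. Hence the
conditional probability of an initial segment is a product of powers of `b k` and `1 - b k`. -/
theorem crpLaw_prefixSet (hα0 : 0 ≤ α) (hα1 : α < 1) (hθ : -α < θ) {d : ℕ → ℕ} {n : ℕ}
    (hd : RestrictedGrowth d n) :
    crpLaw α θ (prefixSet d n) =
      ENNReal.ofReal (eppf α θ (numBlocks d n) fun k => occ d k n) := by
  have := isProbabilityMeasure_stick hα0 hα1 hθ
  set K := numBlocks d n with hK
  let u : ℕ → ℕ := fun k => ((Finset.range n).filter fun m => d m = k ∧ d m < numBlocks d m).card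
  let w : ℕ → ℕ := fun k => ((Finset.range n).filter fun m => k < d m).card
  have hint : crpLaw α θ (prefixSet d n) = ∫⁻ b, ∏ k ∈ Finset.range K,
      (ENNReal.ofReal (b k) ^ u k * ENNReal.ofReal (1 - b k) ^ w k) ∂stickLaw α θ := by
    rw [crpLaw, Measure.map_apply measurable_clip (measurableSet_prefixSet _ _),
      Measure.bind_apply (measurable_clip (measurableSet_prefixSet _ _))
        labelKernel.measurable.aemeasurable, GEM_eq, lintegral_map
        (labelKernel.measurable_coe (measurable_clip (measurableSet_prefixSet _ _)))
        measurable_stickBreaking]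
    refine lintegral_congr_ae ?_
    filter_upwards [ae_hasSum_stickLaw hα0 hα1 hθ, ae_stickLaw_mem_Ioo hα0 hα1 hθ] with b hb hb'
    have hx0 (i : ℕ) : 0 ≤ stickBreaking b i := (stickBreaking_pos hb' i).le
    have hset : clip ⁻¹' prefixSet d n = Set.pi (Finset.range n)
        fun m => if d m < numBlocks d m then {d m} else Set.Ici (numBlocks d m) := by
      ext L
      simp only [Set.mem_preimage, clip_mem_prefixSet_iff hd, Set.mem_pi, Finset.coe_range,
        Set.mem_Iio]
    rw [hset, labelKernel_apply, Measure.infinitePi_pi _ fun _ _ => .of_discrete]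
    refine Eq.trans ?_ (prod_clip_weights (fun k => ENNReal.ofReal (b k))
      (fun k => ENNReal.ofReal (1 - b k)) d
        (fun m => d m < numBlocks d m) n K fun m hm => hd.lt_numBlocks hm)
    refine Finset.prod_congr rfl fun m hm => ?_
    have h1 (j : ℕ) : 0 ≤ 1 - b j := by linarith [(hb' j).2]
    split_ifs with hlt
    · rw [labelLaw_singleton hx0 hb, stickBreaking,
        ENNReal.ofReal_mul (Finset.prod_nonneg fun j _ => h1 j),
        ENNReal.ofReal_prod_of_nonneg fun j _ => h1 j]
    · have : d m = numBlocks d m := le_antisymm (hd m (Finset.mem_range.1 hm)) (not_lt.1 hlt)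
      rw [labelLaw_Ici hx0 hb, stickBreaking_eq_sub, ← this, mul_one,
        ← ENNReal.ofReal_prod_of_nonneg fun j _ => h1 j]
      congr 1
      ring
  rw [hint, stickLaw, lintegral_prod_infinitePi _
    (f := fun k x => ENNReal.ofReal x ^ u k * ENNReal.ofReal (1 - x) ^ w k) (fun i => by fun_prop)]
  simp_rw [lintegral_stick hα0 hα1 hθ]
  rw [← ENNReal.ofReal_prod_of_nonneg]
  swap
  · intro k _
    have h1 : 0 < θ + k * α + 1 := by
      have : 0 ≤ (k : ℝ) * α := by positivity
      linarith
    exact div_nonneg (mul_nonneg (rising_pos (by linarith) _).le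
      (rising_pos (stick_param_pos hα0 hθ k) _).le) (rising_pos h1 _).le
  congr 1
  have hu (k : ℕ) : u k = occ d k n - 1 := by
    have : ∀ N ≤ n, ((Finset.range N).filter fun m => d m = k ∧ d m < numBlocks d m).card =
        occ d k N - 1 := by
      intro N hN
      induction N with
      | zero => simp
      | succ N ih =>
        rw [Finset.range_add_one, Finset.filter_insert, occ_succ]
        have hN' := hd.mono (by omega : N ≤ n)
        have key : N < n := by omega
        split_ifs with h1 h2 h2
        · rw [Finset.card_insert_of_notMem (by simp), ih (by omega)]
          have := hN'.occ_pos (h1.1 ▸ h1.2 : k < numBlocks d N)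
          omega
        · exact absurd h1.1 h2
        · rw [ih (by omega)]
          have hge : ¬ k < numBlocks d N := fun hlt => h1 ⟨h2, h2 ▸ hlt⟩
          have : occ d k N = 0 := occ_eq_zero fun m hm hmk => hge (hmk ▸ hN'.lt_numBlocks hm)
          omega
        · rw [ih (by omega), add_zero]
    exact this n le_rfl
  have hw (k : ℕ) : w k = occ d (k + 1) n + w (k + 1) := by
    simp only [w, occ]
    rw [← Finset.card_union_of_disjoint]
    · congr 1
      ext m
      simp only [Finset.mem_filter, Finset.mem_union, Finset.mem_range]
      omega
    · rw [Finset.disjoint_filter]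
      intro m _ h1; omega
  simp_rw [mul_div_assoc]
  rw [Finset.prod_mul_distrib, eppf, mul_div_assoc]
  congr 1
  · exact Finset.prod_congr rfl fun k _ => by rw [hu]
  rcases Nat.eq_zero_or_pos K with hK0 | hKpos
  · have : n = 0 := by
      by_contra h
      exact (numBlocks_pos d (Nat.pos_of_ne_zero h)).ne' hK0
    subst this
    simp [hK0]
  obtain ⟨J, hJ⟩ : ∃ J, K = J + 1 := ⟨K - 1, by omega⟩
  have hwJ : w J = 0 := by
    simp only [w, Finset.card_eq_zero, Finset.filter_eq_empty_iff, Finset.mem_range]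
    intro m hm
    have := hd.lt_numBlocks hm
    omega
  have hstep : ∀ k < J, w k = u (k + 1) + w (k + 1) + 1 := by
    intro k hk
    have := hd.occ_pos (by omega : k + 1 < numBlocks d n)
    rw [hw k, hu (k + 1)]
    omega
  have h0n : u 0 + w 0 = n - 1 := by
    have hpos := hd.occ_pos (k := 0) (by omega)
    have : occ d 0 n + w 0 = n := by
      simp only [w, occ]
      rw [← Finset.card_union_of_disjoint]
      · conv_rhs => rw [← Finset.card_range n]
        congr 1
        ext m
        simp only [Finset.mem_filter, Finset.mem_union, Finset.mem_range]
        omega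
      · rw [Finset.disjoint_filter]
        intro m _ h1; omega
    rw [hu]; omega
  rw [hd.sum_occ, ← h0n, hJ, Finset.prod_range_succ, prod_rising_telescope hα0 hα1 hθ J hstep, hwJ,
    Nat.add_sub_cancel, rising_zero]
  have h1 : 0 < θ + J * α + 1 := by
    have : 0 ≤ (J : ℝ) * α := by positivity
    linarith
  have h2 := (rising_pos h1 (u J + 0)).ne'
  rw [div_mul_div_comm, mul_one, mul_div_mul_right _ _ h2]

theorem hasPrediction_crpLaw (hα0 : 0 ≤ α) (hα1 : α < 1) (hθ : -α < θ) :
    HasPrediction (crpLaw α θ) (crpRule α θ) := by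
  refine hasPrediction_of_eppf hα0 hα1 hθ (fun a n h => ?_)
    fun a n h => crpLaw_prefixSet hα0 hα1 hθ h
  rw [crpLaw, Measure.map_apply measurable_clip (measurableSet_prefixSet _ _)]
  convert! measure_empty (μ := (GEM α θ).bind labelKernel)
  ext L
  simp only [Set.mem_preimage, Set.mem_empty_iff_false, iff_false]
  exact fun hL => h ((restrictedGrowth_congr hL).1 (clip_spec L n).1)

end ClipLaw

/-! ### Ranking -/

section Rank

variable {ι κ : Type*}

/-- The entry of index `n` of the ranking exceeds `c` if and only if at least `n + 1` entries do. -/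
theorem lt_rank_iff {x : ι → ℝ} {M : ℝ} (hM : ∀ j, x j ≤ M) {c : ℝ} (hc : 0 ≤ c)
    (n : ℕ) : c < rank x n ↔ ∃ s : Finset ι, s.card = n + 1 ∧ ∀ j ∈ s, c < x j := by
  have hne (s : {s : Finset ι // s.card = n + 1}) : Nonempty s.1 := by
    have : s.1.Nonempty := Finset.card_pos.1 (by rw [s.2]; omega)
    exact this.to_subtype
  have hinf (s : {s : Finset ι // s.card = n + 1}) : c < ⨅ j : s.1, x j ↔ ∀ j ∈ s.1, c < x j := by
    have := hne s
    obtain ⟨j, hj⟩ := exists_eq_ciInf_of_finite (f := fun j : s.1 => x j)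
    constructor
    · intro h k hk
      exact h.trans_le (ciInf_le (Set.finite_range _).bddBelow (⟨k, hk⟩ : s.1))
    · intro h
      rw [← hj]
      exact h j j.2
  have hbdd : BddAbove (Set.range fun s : {s : Finset ι // s.card = n + 1} => ⨅ j : s.1, x j) := by
    refine ⟨M, ?_⟩
    rintro _ ⟨s, rfl⟩
    obtain ⟨j⟩ := hne s
    exact (ciInf_le (Set.finite_range _).bddBelow j).trans (hM j)
  rw [rank]
  constructor
  · intro h
    by_contra! hcon
    refine absurd h (not_lt.2 (Real.iSup_le (fun s => ?_) hc))
    by_contra! hlt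
    obtain ⟨j, hj, hjc⟩ := hcon s.1 s.2
    exact absurd ((hinf s).1 hlt j hj) (not_lt.2 hjc)
  · rintro ⟨s, hs, h⟩
    exact ((hinf ⟨s, hs⟩).2 h).trans_le (le_ciSup hbdd ⟨s, hs⟩)

theorem rank_nonneg {x : ι → ℝ} (h0 : ∀ j, 0 ≤ x j) (n : ℕ) : 0 ≤ rank x n :=
  Real.iSup_nonneg fun _ => Real.iInf_nonneg fun _ => h0 _

theorem eq_of_forall_nonneg_lt_iff {a b : ℝ} (ha : 0 ≤ a) (hb : 0 ≤ b)
    (h : ∀ c, 0 ≤ c → (c < a ↔ c < b)) : a = b := by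
  refine le_antisymm ?_ ?_
  · by_contra! hlt
    exact lt_irrefl _ ((h b hb).1 hlt)
  · by_contra! hlt
    exact lt_irrefl _ ((h a ha).2 hlt)

/-- Ranking ignores zeros and the names of the indices. -/
theorem rank_comp_injective {y : κ → ℝ} {M : ℝ} (h0 : ∀ j, 0 ≤ y j) (hM : ∀ j, y j ≤ M) {g : ι → κ}
    (hg : Function.Injective g) (hz : ∀ k ∉ Set.range g, y k = 0) : rank (y ∘ g) = rank y := by
  classical
  funext n
  refine eq_of_forall_nonneg_lt_iff (rank_nonneg (fun j => h0 _) n) (rank_nonneg h0 n)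
    fun c hc => ?_
  rw [lt_rank_iff (x := y ∘ g) (M := M) (fun j => hM _) hc, lt_rank_iff hM hc]
  constructor
  · rintro ⟨s, hs, h⟩
    refine ⟨s.map ⟨g, hg⟩, by simpa using hs, ?_⟩
    simpa using h
  · rintro ⟨s, hs, h⟩
    refine ⟨s.preimage g hg.injOn, ?_, fun j hj => h _ (Finset.mem_preimage.1 hj)⟩
    rw [Finset.card_preimage, Finset.filter_true_of_mem, hs]
    intro k hk
    by_contra hkr
    have := h k hk
    rw [hz k hkr] at this
    exact absurd this (not_lt.2 hc)

theorem rank_comp_equiv {y : κ → ℝ} {M : ℝ} (h0 : ∀ j, 0 ≤ y j) (hM : ∀ j, y j ≤ M) (e : ι ≃ κ) :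
    rank (y ∘ e) = rank y :=
  rank_comp_injective h0 hM e.injective fun k hk => absurd (e.surjective k) hk

theorem rank_of_antitone {x : ℕ → ℝ} (h0 : ∀ j, 0 ≤ x j) (h : Antitone x) : rank x = x := by
  funext n
  refine eq_of_forall_nonneg_lt_iff (rank_nonneg h0 n) (h0 n) fun c hc => ?_
  rw [lt_rank_iff (fun j => h (Nat.zero_le j)) hc]
  constructor
  · rintro ⟨s, hs, hsc⟩
    obtain ⟨j, hj, hjn⟩ : ∃ j ∈ s, n ≤ j := by
      by_contra! hcon
      have : s ⊆ Finset.range n := fun j hj => Finset.mem_range.2 (hcon j hj)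
      have := Finset.card_le_card this
      rw [Finset.card_range] at this
      omega
    exact (hsc j hj).trans_le (h hjn)
  · intro hcn
    refine ⟨Finset.range (n + 1), by simp, fun j hj => hcn.trans_le (h ?_)⟩
    exact Nat.lt_succ_iff.1 (Finset.mem_range.1 hj)

theorem rank_of_mem_massPartitions {x : ℕ → ℝ} (hx : x ∈ massPartitions) : rank x = x :=
  rank_of_antitone (fun j => (hx.1 j).le) hx.2.1

/-- A positive summable sequence is sorted by a permutation. -/
theorem exists_perm_antitone {x : ℕ → ℝ} (h0 : ∀ i, 0 < x i) (hs : Summable x) :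
    ∃ σ : Equiv.Perm ℕ, Antitone (x ∘ σ) := by
  classical
  let prec : ℕ → ℕ → Prop := fun j k => x k < x j ∨ (x j = x k ∧ j < k)
  have hfin (j : ℕ) : {k | prec k j}.Finite := by
    have : ∀ᶠ k in Filter.atTop, x k < x j := hs.tendsto_atTop_zero.eventually_lt_const (h0 j)
    obtain ⟨N, hN⟩ := Filter.eventually_atTop.1 this
    refine (Set.finite_Iio N).subset fun k hk => ?_
    by_contra! hlt
    have := hN k (not_lt.1 hlt)
    rcases hk with hk | hk <;> linarith
  have htrans : ∀ i j k, prec i j → prec j k → prec i k := by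
    rintro i j k (h1 | ⟨h1, h1'⟩) (h2 | ⟨h2, h2'⟩)
    · exact .inl (h2.trans h1)
    · exact .inl (h2 ▸ h1)
    · exact .inl (h1 ▸ h2)
    · exact .inr ⟨h1.trans h2, h1'.trans h2'⟩
  have hirr : ∀ i, ¬ prec i i := by
    rintro i (h | h)
    exacts [lt_irrefl _ h, lt_irrefl _ h.2]
  have htri : ∀ i j, i ≠ j → prec i j ∨ prec j i := by
    intro i j hij
    rcases lt_trichotomy (x i) (x j) with h | h | h
    · exact .inr (.inl h)
    · rcases lt_or_gt_of_ne hij with h' | h'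
      exacts [.inl (.inr ⟨h, h'⟩), .inr (.inr ⟨h.symm, h'⟩)]
    · exact .inl (.inl h)
  let N : ℕ → ℕ := fun j => {k | prec k j}.ncard
  have hmono : ∀ i j, prec i j → N i < N j := fun i j hij =>
    Set.ncard_lt_ncard ⟨fun k hk => htrans k i j hk hij, fun h => hirr i (h hij)⟩ (hfin j)
  have hinj : Function.Injective N := by
    intro i j hij
    by_contra hne
    rcases htri i j hne with h | h
    exacts [(hmono _ _ h).ne hij, (hmono _ _ h).ne' hij]
  have hsurj : Function.Surjective N := by
    intro n
    obtain ⟨j, hj⟩ : ∃ j, n < N j := by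
      by_contra! hcon
      refine Set.infinite_univ (α := ℕ) (Set.Finite.of_finite_image
        ((Set.finite_Iic n).subset ?_) hinj.injOn)
      rintro _ ⟨j, -, rfl⟩
      exact hcon j
    have himg : (hfin j).toFinset.image N = Finset.range (N j) := by
      refine Finset.eq_of_subset_of_card_le ?_ ?_
      · intro m hm
        obtain ⟨k, hk, rfl⟩ := Finset.mem_image.1 hm
        exact Finset.mem_range.2 (hmono k j ((hfin j).mem_toFinset.1 hk))
      · rw [Finset.card_range, Finset.card_image_of_injective _ hinj,
          ← Set.ncard_eq_toFinset_card _ (hfin j)]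
    have : n ∈ (hfin j).toFinset.image N := himg ▸ Finset.mem_range.2 hj
    obtain ⟨k, -, hk⟩ := Finset.mem_image.1 this
    exact ⟨k, hk⟩
  let e := Equiv.ofBijective N ⟨hinj, hsurj⟩
  refine ⟨e.symm, fun m n hmn => ?_⟩
  have hm : N (e.symm m) = m := e.apply_symm_apply m
  have hn : N (e.symm n) = n := e.apply_symm_apply n
  by_contra! hlt
  have := hmono (e.symm n) (e.symm m) (.inl hlt)
  omega

theorem le_one_of_hasSum {x : ι → ℝ} (h0 : ∀ i, 0 ≤ x i) (hs : HasSum x 1) (i : ι) : x i ≤ 1 :=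
  le_hasSum hs i fun j _ => h0 j

theorem exists_perm_rank {x : ℕ → ℝ} (h0 : ∀ i, 0 < x i) (hs : HasSum x 1) :
    ∃ σ : Equiv.Perm ℕ, rank x = x ∘ σ := by
  obtain ⟨σ, hσ⟩ := exists_perm_antitone h0 hs.summable
  refine ⟨σ, ?_⟩
  rw [← rank_comp_equiv (fun j => (h0 j).le) (le_one_of_hasSum (fun j => (h0 j).le) hs) σ]
  exact rank_of_antitone (fun j => (h0 _).le) hσ

theorem rank_mem_massPartitions {x : ℕ → ℝ} (h0 : ∀ i, 0 < x i) (hs : HasSum x 1) :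
    rank x ∈ massPartitions := by
  obtain ⟨σ, hσ⟩ := exists_perm_antitone h0 hs.summable
  have h : rank x = x ∘ σ := by
    rw [← rank_comp_equiv (fun j => (h0 j).le) (le_one_of_hasSum (fun j => (h0 j).le) hs) σ]
    exact rank_of_antitone (fun j => (h0 _).le) hσ
  rw [h]
  exact ⟨fun i => h0 _, hσ, (Equiv.hasSum_iff σ).2 hs⟩

end Rank

/-! ### Asymptotic frequencies of labels -/

section Freq

variable {ι κ : Type*} [DecidableEq ι] [DecidableEq κ]

open Filter Topology

/-- The asymptotic frequency of the label `z` in the sequence `L` (the limit superior, so that the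
value is meaningful without any convergence assumption). -/
noncomputable def freq (L : ℕ → ι) (z : ι) : ℝ :=
  limsup (fun n : ℕ => (occ L z n : ℝ) / n) atTop

/-- The label `z` has asymptotic frequency `f` in the sequence `L`. -/
def HasFreq (L : ℕ → ι) (z : ι) (f : ℝ) : Prop :=
  Tendsto (fun n : ℕ => (occ L z n : ℝ) / n) atTop (𝓝 f)

theorem HasFreq.freq_eq {L : ℕ → ι} {z : ι} {f : ℝ} (h : HasFreq L z f) : freq L z = f :=
  Tendsto.limsup_eq h

theorem occ_le (L : ℕ → ι) (z : ι) (n : ℕ) : occ L z n ≤ n := by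
  refine (Finset.card_filter_le _ _).trans ?_
  simp

theorem occ_div_mem (L : ℕ → ι) (z : ι) (n : ℕ) : (occ L z n : ℝ) / n ∈ Set.Icc (0 : ℝ) 1 :=
  ⟨by positivity, div_le_one_of_le₀ (by exact_mod_cast occ_le L z n) (by positivity)⟩

theorem freq_nonneg (L : ℕ → ι) (z : ι) : 0 ≤ freq L z := by
  refine le_limsup_of_frequently_le (Frequently.of_forall fun n => (occ_div_mem L z n).1) ?_
  exact isBoundedUnder_of ⟨1, fun n => (occ_div_mem L z n).2⟩

theorem freq_le_one (L : ℕ → ι) (z : ι) : freq L z ≤ 1 := by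
  refine limsup_le_of_le ?_ (Eventually.of_forall fun n => (occ_div_mem L z n).2)
  exact (isBoundedUnder_of ⟨0, fun n => (occ_div_mem L z n).1⟩ :
    IsBoundedUnder (· ≥ ·) atTop _).isCoboundedUnder_le

theorem freq_eq_zero {L : ℕ → ι} {z : ι} (h : ∀ m, L m ≠ z) : freq L z = 0 := by
  refine HasFreq.freq_eq ?_
  simp only [HasFreq, occ_eq_zero fun m _ => h m]
  simp

theorem freq_congr {L : ℕ → ι} {L' : ℕ → κ} {z : ι} {z' : κ} (h : ∀ m, L m = z ↔ L' m = z') :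
    freq L z = freq L' z' := by
  rw [freq, freq]
  simp only [occ_congr fun m _ => h m]

theorem measurable_freq [MeasurableSpace ι] [MeasurableSingletonClass ι] [Countable ι]
    [Nonempty ι] : Measurable (freq : (ℕ → ι) → ι → ℝ) := by
  refine measurable_pi_lambda _ fun z => Measurable.limsup fun n => ?_
  refine measurable_of_prefix n fun x y h => ?_
  rw [occ_congr fun m hm => by rw [h m hm]]

/-- Two labellings with the same classes have the same ranked frequencies. -/
theorem rank_freq_congr {L : ℕ → ι} {L' : ℕ → κ} (h : ∀ l m, L l = L m ↔ L' l = L' m) :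
    rank (freq L) = rank (freq L') := by
  let g : Set.range L → κ := fun z => L' z.2.choose
  have hg (n : ℕ) : g ⟨L n, n, rfl⟩ = L' n := by
    have : L (Exists.choose (⟨n, rfl⟩ : L n ∈ Set.range L)) = L n :=
      Exists.choose_spec (⟨n, rfl⟩ : L n ∈ Set.range L)
    exact (h _ _).1 this
  have hinj : Function.Injective g := by
    rintro ⟨_, l, rfl⟩ ⟨_, m, rfl⟩ hlm
    rw [hg, hg] at hlm
    exact Subtype.ext ((h l m).2 hlm)
  have h1 : rank (freq L ∘ (Subtype.val : Set.range L → ι)) = rank (freq L) :=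
    rank_comp_injective (freq_nonneg L) (freq_le_one L) Subtype.val_injective fun k hk =>
      freq_eq_zero fun m hm => hk ⟨⟨k, m, hm⟩, rfl⟩
  have h2 : rank (freq L' ∘ g) = rank (freq L') :=
    rank_comp_injective (freq_nonneg L') (freq_le_one L') hinj fun k hk =>
      freq_eq_zero fun m hm => hk ⟨⟨L m, m, rfl⟩, (hg m).trans hm⟩
  rw [← h1, ← h2]
  congr 1
  funext ⟨_, n, rfl⟩
  simp only [Function.comp_apply, hg]
  exact freq_congr fun m => h m n

/-- Frequencies do not depend on finitely many terms. -/
theorem hasFreq_iff_of_eventually {L : ℕ → ι} {L' : ℕ → κ} {z : ι} {z' : κ} {f : ℝ}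
    (h : ∀ᶠ m in atTop, (L m = z ↔ L' m = z')) : HasFreq L z f ↔ HasFreq L' z' f := by
  obtain ⟨N, hN⟩ := eventually_atTop.1 h
  have hd : ∀ n, N ≤ n → (occ L z n : ℝ) / n - (occ L' z' n : ℝ) / n =
      ((occ L z N : ℝ) - occ L' z' N) / n := by
    intro n hn
    rw [← sub_div]
    congr 1
    induction n, hn using Nat.le_induction with
    | base => rfl
    | succ n hn ih =>
      rw [occ_succ, occ_succ]
      have := hN n hn
      by_cases hz : L n = z
      · rw [if_pos hz, if_pos (this.1 hz)]; push_cast; linarith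
      · rw [if_neg hz, if_neg (fun h => hz (this.2 h))]; push_cast; linarith
  have hlim : Tendsto (fun n : ℕ => (occ L z n : ℝ) / n - (occ L' z' n : ℝ) / n) atTop (𝓝 0) := by
    refine (tendsto_const_div_atTop_nhds_zero_nat ((occ L z N : ℝ) - occ L' z' N)).congr' ?_
    filter_upwards [eventually_ge_atTop N] with n hn
    rw [hd n hn]
  constructor
  · intro h1
    simpa [HasFreq] using h1.sub hlim
  · intro h1
    simpa [HasFreq] using h1.add hlim

theorem hasFreq_shift_iff {L : ℕ → ι} {z : ι} {f : ℝ} :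
    HasFreq (fun n => L (n + 1)) z f ↔ HasFreq L z f := by
  have hocc (n : ℕ) : occ L z (n + 1) = occ (fun n => L (n + 1)) z n + occ L z 1 := by
    induction n with
    | zero => simp
    | succ n ih => rw [occ_succ L, ih, occ_succ (fun n => L (n + 1)), add_right_comm]
  have hr : Tendsto (fun n : ℕ => ((n + 1 : ℕ) : ℝ) / n) atTop (𝓝 1) := by
    have := (tendsto_const_nhds (x := (1 : ℝ))).add (tendsto_one_div_atTop_nhds_zero_nat (𝕜 := ℝ))
    rw [add_zero] at this
    refine this.congr' ?_
    filter_upwards [eventually_gt_atTop 0] with n hn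
    have : (n : ℝ) ≠ 0 := by exact_mod_cast hn.ne'
    push_cast
    field_simp
  have h0 := tendsto_const_div_atTop_nhds_zero_nat (𝕜 := ℝ) (occ L z 1 : ℝ)
  have key : ∀ᶠ n : ℕ in atTop, (occ L z (n + 1) : ℝ) / (n + 1 : ℕ) * (((n + 1 : ℕ) : ℝ) / n) =
      (occ (fun n => L (n + 1)) z n : ℝ) / n + (occ L z 1 : ℝ) / n := by
    filter_upwards [eventually_gt_atTop 0] with n hn
    have h1 : (n : ℝ) ≠ 0 := by exact_mod_cast hn.ne'
    have h2 : ((n + 1 : ℕ) : ℝ) ≠ 0 := by positivity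
    rw [hocc]
    field_simp
    push_cast
    ring
  constructor
  · intro h
    rw [HasFreq, ← tendsto_add_atTop_iff_nat 1]
    have h1 := (h.add h0).congr' (key.mono fun n hn => hn.symm)
    have h2 := h1.div hr one_ne_zero
    rw [add_zero, div_one] at h2
    refine h2.congr' ?_
    filter_upwards [eventually_gt_atTop 0] with n hn
    have h1 : (n : ℝ) ≠ 0 := by exact_mod_cast hn.ne'
    have h2 : ((n + 1 : ℕ) : ℝ) ≠ 0 := by positivity
    rw [Pi.div_apply]
    field_simp
  · intro h
    have h1 := (tendsto_add_atTop_iff_nat 1).2 h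
    have h2 := ((h1.mul hr).congr' key).sub h0
    simpa [HasFreq] using h2

/-- All labels of `L` have asymptotic frequencies, and these sum to one. -/
def ProperFreq (L : ℕ → ι) : Prop := (∀ z, HasFreq L z (freq L z)) ∧ HasSum (freq L) 1

theorem ProperFreq.tendsto_card {L : ℕ → ι} (h : ProperFreq L) (s : Set ι) [DecidablePred (· ∈ s)] :
    Tendsto (fun n : ℕ => (((Finset.range n).filter fun m => L m ∈ s).card : ℝ) / n) atTop
      (𝓝 (∑' k : s, freq L k)) := by
  have lower : ∀ (s : Set ι) [DecidablePred (· ∈ s)], ∀ a < ∑' k : s, freq L k, ∀ᶠ n : ℕ in atTop,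
      a < (((Finset.range n).filter fun m => L m ∈ s).card : ℝ) / n := by
    intro s _ a ha
    have hsum := (h.2.summable.subtype s).hasSum
    obtain ⟨t, ht⟩ := ((hsum.eventually_const_lt ha).exists : ∃ t : Finset s, _)
    have hlim : Tendsto (fun n : ℕ => ∑ k ∈ t, (occ L k.1 n : ℝ) / n) atTop
        (𝓝 (∑ k ∈ t, freq L k.1)) := tendsto_finsetSum _ fun k _ => h.1 k.1
    filter_upwards [hlim.eventually_const_lt ht] with n hn
    refine hn.trans_le ?_
    rw [← Finset.sum_div]
    refine div_le_div_of_nonneg_right ?_ n.cast_nonneg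
    rw [← Nat.cast_sum]
    refine Nat.cast_le.2 ?_
    simp only [occ]
    rw [← Finset.card_biUnion]
    · refine Finset.card_le_card fun m hm => ?_
      obtain ⟨k, -, hk⟩ := Finset.mem_biUnion.1 hm
      rw [Finset.mem_filter] at hk ⊢
      exact ⟨hk.1, hk.2 ▸ k.2⟩
    · intro k _ l _ hkl
      refine Finset.disjoint_filter.2 fun m _ hm hm' => hkl (Subtype.ext (hm.symm.trans hm'))
  have hcompl : ∑' k : s, freq L k + ∑' k : ↥sᶜ, freq L k = 1 := by
    rw [(h.2.summable.subtype s).tsum_add_tsum_compl (h.2.summable.subtype sᶜ), h.2.tsum_eq]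
  refine tendsto_order.2 ⟨fun a ha => ?_, fun a ha => ?_⟩
  · exact lower s a ha
  · filter_upwards [lower sᶜ (1 - a) (by linarith), eventually_gt_atTop 0] with n hn hn0
    have h1 : (n : ℝ) ≠ 0 := by exact_mod_cast hn0.ne'
    have hc := Finset.card_filter_add_card_filter_not (s := Finset.range n) (fun m => L m ∈ s)
    rw [Finset.card_range] at hc
    have hc' : (((Finset.range n).filter fun m => L m ∈ s).card : ℝ) / n +
        (((Finset.range n).filter fun m => L m ∈ sᶜ).card : ℝ) / n = 1 := by
      rw [← add_div, div_eq_one_iff_eq h1]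
      simp only [Set.mem_compl_iff]
      exact_mod_cast hc
    linarith

/-- Frequencies are transported by an arbitrary map of labels. -/
theorem ProperFreq.hasFreq_comp {L : ℕ → ι} (h : ProperFreq L) (g : ι → κ) (z : κ) :
    HasFreq (fun n => g (L n)) z (∑' k : g ⁻¹' {z}, freq L k) := by
  have : DecidablePred (· ∈ g ⁻¹' {z}) := fun k => decidable_of_iff (g k = z) Iff.rfl
  have := h.tendsto_card (g ⁻¹' {z})
  refine this.congr fun n => ?_
  rw [occ]
  congr 3
  exact Finset.filter_congr fun m _ => Iff.rfl

theorem HasFreq.hasFreq_freq {L : ℕ → ι} {z : ι} {f : ℝ} (h : HasFreq L z f) :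
    HasFreq L z (freq L z) := h.freq_eq.symm ▸ h

end Freq

/-! ### The frequencies of the Chinese restaurant process -/

section CRPFreq

open Filter Topology

/-- The strong law of large numbers, for the indicators of a label. -/
theorem ae_labelKernel_hasFreq {x : ℕ → ℝ} (h0 : ∀ i, 0 ≤ x i) (h1 : HasSum x 1) :
    ∀ᵐ L ∂labelKernel x, ∀ k, HasFreq L k (x k) := by
  refine ae_all_iff.2 fun k => ?_
  rw [labelKernel_apply]
  set μ := Measure.infinitePi fun _ : ℕ => labelLaw x
  let f : ℕ → ℝ := Set.indicator {k} 1
  have hf : Measurable f := measurable_of_countable f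
  let X : ℕ → (ℕ → ℕ) → ℝ := fun n L => f (L n)
  have hXm (n : ℕ) : Measurable (X n) := hf.comp (measurable_pi_apply n)
  have hmp (n : ℕ) : MeasurePreserving (Function.eval n) μ (labelLaw x) :=
    measurePreserving_eval_infinitePi (fun _ : ℕ => labelLaw x) n
  have hint : Integrable (X 0) μ := by
    refine Integrable.of_bound (hXm 0).aestronglyMeasurable 1 (ae_of_all _ fun L => ?_)
    simp only [X, f, Set.indicator]
    split_ifs <;> simp
  have hind : iIndepFun X μ := iIndepFun_infinitePi (X := fun _ => f) fun _ => hf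
  have hid (n : ℕ) : IdentDistrib (X n) (X 0) μ μ := by
    refine ⟨(hXm n).aemeasurable, (hXm 0).aemeasurable, ?_⟩
    have e (n : ℕ) : μ.map (X n) = (labelLaw x).map f := by
      rw [← (hmp n).map_eq, Measure.map_map hf (measurable_pi_apply n)]
      rfl
    rw [e, e]
  have hmean : ∫ L, X 0 L ∂μ = x k := by
    have : ∫ L, X 0 L ∂μ = ∫ i, f i ∂labelLaw x := by
      rw [← (hmp 0).map_eq, integral_map (measurable_pi_apply 0).aemeasurable
        hf.aestronglyMeasurable]
    rw [this, integral_indicator_one (measurableSet_singleton k), measureReal_def,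
      labelLaw_singleton h0 h1, ENNReal.toReal_ofReal (h0 k)]
  have := strong_law_ae_real X hint (fun i j hij => hind.indepFun hij) hid
  rw [hmean] at this
  filter_upwards [this] with L hL
  refine hL.congr fun n => ?_
  congr 1
  rw [occ, Finset.card_filter]
  push_cast
  refine Finset.sum_congr rfl fun m _ => ?_
  simp [X, f, Pi.single_apply]

theorem frequently_of_hasFreq_pos {ι : Type*} [DecidableEq ι] {L : ℕ → ι} {z : ι} {f : ℝ}
    (h : HasFreq L z f) (hf : 0 < f) (N : ℕ) : ∃ m, N ≤ m ∧ L m = z := by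
  by_contra! hcon
  have h1 : HasFreq L z 0 := by
    rw [hasFreq_iff_of_eventually (L' := fun _ : ℕ => false) (z' := true)]
    · simp only [HasFreq, occ_eq_zero (L := fun _ : ℕ => false) (z := true) (fun _ _ => by simp)]
      simp
    · filter_upwards [eventually_ge_atTop N] with m hm
      simp [hcon m hm]
  exact hf.ne' (tendsto_nhds_unique h h1)

theorem eventually_lt_clipState {L : ℕ → ℕ} (h : ∀ k N, ∃ m, N ≤ m ∧ L m = k) (k : ℕ) :
    ∀ᶠ n in atTop, k ≤ clipState L n := by
  have hmono : Monotone (clipState L) := monotone_nat_of_le_succ fun n => by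
    rw [clipState]; split_ifs <;> omega
  have : ∃ n, k ≤ clipState L n := by
    induction k with
    | zero => exact ⟨0, Nat.zero_le _⟩
    | succ k ih =>
      obtain ⟨n, hn⟩ := ih
      obtain ⟨m, hm, hmk⟩ := h k n
      by_cases hlt : k + 1 ≤ clipState L m
      · exact ⟨m, hlt⟩
      · have := hmono hm
        refine ⟨m + 1, ?_⟩
        rw [clipState, if_neg (by omega)]
        omega
  obtain ⟨n, hn⟩ := this
  filter_upwards [eventually_ge_atTop n] with m hm
  exact hn.trans (hmono hm)

/-- Clipping preserves frequencies: since every label occurs infinitely often, the number of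
blocks tends to infinity, so only finitely many terms that are affected involve a given label. -/
theorem hasFreq_clip {L : ℕ → ℕ} {x : ℕ → ℝ} (hx : ∀ i, 0 < x i) (h : ∀ k, HasFreq L k (x k))
    (k : ℕ) : HasFreq (clip L) k (x k) := by
  rw [hasFreq_iff_of_eventually (L' := L) (z' := k)]
  · exact h k
  have := eventually_lt_clipState (fun k N => frequently_of_hasFreq_pos (h k) (hx k) N) (k + 1)
  filter_upwards [this] with n hn
  rw [clip]
  omega

variable {α θ : ℝ}

theorem ae_compProd_labelKernel {μ : Measure (ℕ → ℝ)} [SFinite μ]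
    (h : ∀ᵐ x ∂μ, (∀ i, 0 < x i) ∧ HasSum x 1) :
    ∀ᵐ q ∂(μ ⊗ₘ labelKernel), ((∀ i, 0 < q.1 i) ∧ HasSum q.1 1) ∧ ∀ k, HasFreq q.2 k (q.1 k) := by
  refine Measure.ae_compProd_of_ae_ae ?_ ?_
  · refine MeasurableSet.inter ?_ ?_
    · exact measurable_fst measurableSet_pos_hasSum
    · have : {q : (ℕ → ℝ) × (ℕ → ℕ) | ∀ k, HasFreq q.2 k (q.1 k)} =
          ⋂ k, {q | HasFreq q.2 k (q.1 k)} := by ext; simp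
      change MeasurableSet {q : (ℕ → ℝ) × (ℕ → ℕ) | ∀ k, HasFreq q.2 k (q.1 k)}
      rw [this]
      refine MeasurableSet.iInter fun k => measurableSet_tendsto_fun (fun n => ?_) (by fun_prop)
      have : Measurable fun L : ℕ → ℕ => (occ L k n : ℝ) / n := measurable_of_prefix n
        fun x y h => by rw [occ_congr fun m hm => by rw [h m hm]]
      exact this.comp measurable_snd
  · filter_upwards [h] with x hx
    filter_upwards [ae_labelKernel_hasFreq (fun i => (hx.1 i).le) hx.2] with L hL
    exact ⟨hx, hL⟩

theorem crpLaw_eq_map (hα0 : 0 ≤ α) (hα1 : α < 1) (hθ : -α < θ) :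
    crpLaw α θ = (GEM α θ ⊗ₘ labelKernel).map fun q => clip q.2 := by
  have := isProbabilityMeasure_GEM hα0 hα1 hθ
  rw [crpLaw, ← Measure.snd_compProd, Measure.snd, Measure.map_map measurable_clip measurable_snd]
  rfl

/-- The frequencies of the blocks of the Chinese restaurant process, in order of appearance, have
the `GEM` law, being the frequencies of the labels that the process is constructed from. -/
theorem map_freq_crpLaw (hα0 : 0 ≤ α) (hα1 : α < 1) (hθ : -α < θ) :
    (crpLaw α θ).map freq = GEM α θ := by
  have := isProbabilityMeasure_GEM hα0 hα1 hθ
  have hc : Measurable fun q : (ℕ → ℝ) × (ℕ → ℕ) => clip q.2 := measurable_clip.comp measurable_snd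
  rw [crpLaw_eq_map hα0 hα1 hθ, Measure.map_map measurable_freq hc]
  conv_rhs => rw [← Measure.fst_compProd (GEM α θ) labelKernel, Measure.fst]
  refine Measure.map_congr ?_
  filter_upwards [ae_compProd_labelKernel (ae_GEM hα0 hα1 hθ)] with q hq
  funext k
  exact (hasFreq_clip hq.1.1 hq.2 k).freq_eq

theorem ae_crpLaw (hα0 : 0 ≤ α) (hα1 : α < 1) (hθ : -α < θ) :
    ∀ᵐ D ∂crpLaw α θ, ProperFreq D ∧ ∀ k, 0 < freq D k := by
  have := isProbabilityMeasure_GEM hα0 hα1 hθ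
  have hm : MeasurableSet {D : ℕ → ℕ | ProperFreq D ∧ ∀ k, 0 < freq D k} := by
    have h : {D : ℕ → ℕ | ProperFreq D ∧ ∀ k, 0 < freq D k} =
        (⋂ k, {D | HasFreq D k (freq D k)}) ∩
          freq ⁻¹' {x : ℕ → ℝ | (∀ i, 0 < x i) ∧ HasSum x 1} := by
      ext D
      simp only [ProperFreq, Set.mem_ofPred_eq, Set.mem_inter_iff, Set.mem_iInter,
        Set.mem_preimage]
      tauto
    rw [h]
    refine (MeasurableSet.iInter fun k => ?_).inter (measurable_freq measurableSet_pos_hasSum)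
    refine measurableSet_tendsto_fun (fun n => ?_) ((measurable_pi_apply k).comp measurable_freq)
    exact measurable_of_prefix n fun x y h => by rw [occ_congr fun m hm => by rw [h m hm]]
  have hc : Measurable fun q : (ℕ → ℝ) × (ℕ → ℕ) => clip q.2 := measurable_clip.comp measurable_snd
  rw [crpLaw_eq_map hα0 hα1 hθ, ae_map_iff hc.aemeasurable hm]
  filter_upwards [ae_compProd_labelKernel (ae_GEM hα0 hα1 hθ)] with q hq
  have h := hasFreq_clip hq.1.1 hq.2
  have hf : freq (clip q.2) = q.1 := funext fun k => (h k).freq_eq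
  refine ⟨⟨fun k => (h k).hasFreq_freq, ?_⟩, fun k => ?_⟩
  · rw [hf]; exact hq.1.2
  · rw [hf]; exact hq.1.1 k

end CRPFreq

/-! ### The exchangeable partition generated by independent labels -/

open Classical in
/-- For a probability vector `y`, the probability that `K` disjoint groups of labels, of sizes
`n 0, …, n (K - 1)`, sampled independently from `y`, are each constant, with distinct values. -/
noncomputable def classWeight (y : ℕ → ENNReal) {K : ℕ} (n : Fin K → ℕ) : ENNReal :=
  ∑' f : Fin K → ℕ, if Function.Injective f then ∏ i, y (f i) ^ n i else 0

theorem classWeight_comp_perm (y : ℕ → ENNReal) {K : ℕ} (n : Fin K → ℕ) (σ : Equiv.Perm ℕ) :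
    classWeight (y ∘ σ) n = classWeight y n := by
  classical
  rw [classWeight, classWeight, ← (Equiv.arrowCongr (Equiv.refl (Fin K)) σ).tsum_eq fun f =>
    if Function.Injective f then ∏ i, y (f i) ^ n i else 0]
  refine tsum_congr fun f => ?_
  have : Function.Injective (Equiv.arrowCongr (Equiv.refl (Fin K)) σ f) ↔ Function.Injective f :=
    σ.injective.of_comp_iff f
  simp only [this]
  rfl

/-- Isolating the value `0`: at most one of the groups of labels takes this value. -/
theorem classWeight_cons {y y' : ℕ → ENNReal} {β γ : ENNReal} (h0 : y' 0 = β)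
    (h1 : ∀ j, y' (j + 1) = γ * y j) {K : ℕ} (n : Fin (K + 1) → ℕ) :
    classWeight y' n = γ ^ (∑ i, n i) * classWeight y n +
      ∑ i, β ^ n i * γ ^ (∑ j, n (i.succAbove j)) * classWeight y fun j => n (i.succAbove j) := by
  classical
  let T : (Fin (K + 1) → ℕ) → ENNReal :=
    fun f => if Function.Injective f then ∏ i, y' (f i) ^ n i else 0
  have hT (f) : T f = (if ∀ i, f i ≠ 0 then T f else 0) + ∑ i, if f i = 0 then T f else 0 := by
    by_cases hf : Function.Injective f
    · by_cases h : ∀ i, f i ≠ 0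
      · rw [if_pos h, Finset.sum_eq_zero fun i _ => if_neg (h i), add_zero]
      · rw [if_neg h, zero_add]
        push Not at h
        obtain ⟨i, hi⟩ := h
        rw [Finset.sum_eq_single i, if_pos hi]
        · exact fun j _ hj => if_neg fun hj0 => hj (hf (hj0.trans hi.symm))
        · simp
    · have : T f = 0 := if_neg hf
      simp [this]
  have hsum : classWeight y' n = ∑' f, T f := rfl
  rw [hsum, tsum_congr hT, ENNReal.tsum_add, Summable.tsum_finsetSum fun _ _ => ENNReal.summable]
  congr 1
  · let s : (Fin (K + 1) → ℕ) → (Fin (K + 1) → ℕ) := fun g i => g i + 1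
    have hs : Function.Injective s := fun g g' h => funext fun i => by
      have := congrFun h i
      simpa [s] using this
    rw [← hs.tsum_eq, classWeight, ← ENNReal.tsum_mul_left]
    · refine tsum_congr fun g => ?_
      rw [if_pos fun i => Nat.succ_ne_zero _]
      have hinj : Function.Injective (s g) ↔ Function.Injective g :=
        (Nat.succ_injective).of_comp_iff g
      simp only [T, hinj]
      split_ifs
      · rw [← Finset.prod_pow_eq_pow_sum, ← Finset.prod_mul_distrib]
        exact Finset.prod_congr rfl fun i _ => by rw [h1, mul_pow]
      · rw [mul_zero]
    · intro f hf
      have h : ∀ i, f i ≠ 0 := by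
        by_contra hcon
        exact hf (if_neg hcon)
      exact ⟨fun i => f i - 1, funext fun i => Nat.succ_pred_eq_of_pos (Nat.pos_of_ne_zero (h i))⟩
  · refine Finset.sum_congr rfl fun i _ => ?_
    let s : (Fin K → ℕ) → (Fin (K + 1) → ℕ) :=
      fun g => Fin.insertNth (α := fun _ => ℕ) i 0 fun j => g j + 1
    have hsi (g) : s g i = 0 := Fin.insertNth_apply_same _ _ _
    have hsj (g j) : s g (i.succAbove j) = g j + 1 := Fin.insertNth_apply_succAbove _ _ _ _
    have hs : Function.Injective s := fun g g' h => funext fun j => by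
      have := congrFun h (i.succAbove j)
      rw [hsj, hsj] at this
      exact Nat.succ_injective this
    have hinj (g) : Function.Injective (s g) ↔ Function.Injective g := by
      constructor
      · intro h j j' hjj
        refine Fin.succAbove_right_injective (p := i) (h ?_)
        rw [hsj, hsj, hjj]
      · intro h a b hab
        rcases Fin.eq_self_or_eq_succAbove i a with ha | ⟨j, ha⟩ <;>
        rcases Fin.eq_self_or_eq_succAbove i b with hb | ⟨j', hb⟩
        · rw [ha, hb]
        · rw [ha, hb, hsi, hsj] at hab; omega
        · rw [ha, hb, hsi, hsj] at hab; omega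
        · rw [ha, hb, hsj, hsj] at hab
          rw [ha, hb, h (Nat.succ_injective hab)]
    rw [← hs.tsum_eq, classWeight, ← ENNReal.tsum_mul_left]
    · refine tsum_congr fun g => ?_
      rw [if_pos (hsi g)]
      simp only [T, hinj]
      split_ifs
      · rw [Fin.prod_univ_succAbove _ i, hsi, h0, mul_assoc, ← Finset.prod_pow_eq_pow_sum,
          ← Finset.prod_mul_distrib]
        congr 1
        exact Finset.prod_congr rfl fun j _ => by rw [hsj, h1, mul_pow]
      · rw [mul_zero]
    · intro f hf
      have hfi : f i = 0 := by
        by_contra hcon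
        exact hf (if_neg hcon)
      have hfinj : Function.Injective f := by
        by_contra hcon
        refine hf ?_
        simp [T, hcon]
      refine ⟨fun j => f (i.succAbove j) - 1, funext fun a => ?_⟩
      rcases Fin.eq_self_or_eq_succAbove i a with rfl | ⟨j, rfl⟩
      · rw [hsi, hfi]
      · rw [hsj]
        refine Nat.succ_pred_eq_of_pos (Nat.pos_of_ne_zero fun h => ?_)
        exact Fin.succAbove_ne i j (hfinj (h.trans hfi.symm))

theorem labelKernel_pi {x : ℕ → ℝ} (h0 : ∀ i, 0 ≤ x i) (h1 : HasSum x 1) (f : ℕ → ℕ) (n : ℕ) :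
    labelKernel x {L | ∀ m < n, L m = f m} = ∏ m ∈ Finset.range n, ENNReal.ofReal (x (f m)) := by
  have : {L : ℕ → ℕ | ∀ m < n, L m = f m} = Set.pi (Finset.range n) fun m => {f m} := by
    ext L; simp
  rw [this, labelKernel_apply, Measure.infinitePi_pi _ fun _ _ => .of_discrete]
  exact Finset.prod_congr rfl fun m _ => labelLaw_singleton h0 h1 _

theorem classWeight_le_one {x : ℕ → ℝ} (h0 : ∀ i, 0 ≤ x i) (h1 : HasSum x 1) {K : ℕ}
    {n : Fin K → ℕ} (hn : ∀ i, 0 < n i) : classWeight (fun j => ENNReal.ofReal (x j)) n ≤ 1 := by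
  classical
  have hone : (1 : ENNReal) = ∑' f : Fin K → ℕ, ∏ i, ENNReal.ofReal (x (f i)) := by
    let g : (ℕ → ℕ) → (Fin K → ℕ) := fun L i => L i.1
    have hg : Measurable g := by fun_prop
    rw [← measure_univ (μ := labelKernel x),
      measure_eq_tsum_inter_fiber _ hg MeasurableSet.univ]
    refine tsum_congr fun f => ?_
    have := labelKernel_pi h0 h1 (fun m => if h : m < K then f ⟨m, h⟩ else 0) K
    rw [Finset.prod_range] at this
    simp only [Fin.is_lt, dite_true, Fin.eta] at this
    rw [← this]
    congr 1
    ext L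
    simp only [g, Set.univ_inter, Set.mem_ofPred_eq, funext_iff, Fin.forall_iff]
    refine forall₂_congr fun m hm => ?_
    simp [hm]
  rw [hone, classWeight]
  refine ENNReal.tsum_le_tsum fun f => ?_
  split_ifs
  · refine Finset.prod_le_prod' fun i _ => ?_
    refine pow_le_of_le_one bot_le ?_ (hn i).ne'
    rw [ENNReal.ofReal_le_one]
    exact le_one_of_hasSum h0 h1 _
  · exact bot_le

theorem prod_range_eq_prod_pow_occ {M : Type*} [CommMonoid M] {d : ℕ → ℕ} {n K : ℕ}
    (h : ∀ m < n, d m < K) (φ : ℕ → M) :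
    ∏ m ∈ Finset.range n, φ (d m) = ∏ k ∈ Finset.range K, φ k ^ occ d k n := by
  induction n with
  | zero => simp
  | succ n ih =>
    simp_rw [occ_succ, pow_add]
    rw [Finset.prod_range_succ, ih fun m hm => h m (by omega), Finset.prod_mul_distrib]
    congr 1
    rw [Finset.prod_eq_single (d n)]
    · simp
    · intro k _ hk
      rw [if_neg hk.symm, pow_zero]
    · intro hk
      exact absurd (Finset.mem_range.2 (h n n.lt_succ_self)) hk

/-- The probability that independent labels form given classes. -/
theorem labelKernel_rg {x : ℕ → ℝ} (h0 : ∀ i, 0 ≤ x i) (h1 : HasSum x 1) {d : ℕ → ℕ} {n : ℕ}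
    (hd : RestrictedGrowth d n) :
    labelKernel x (rg ⁻¹' prefixSet d n) = classWeight (fun j => ENNReal.ofReal (x j))
      fun i : Fin (numBlocks d n) => occ d i n := by
  classical
  set K := numBlocks d n with hK
  have hpos (i : Fin K) : ∃ m < n, d m = i := hd.lt_numBlocks_iff.1 i.2
  choose pos hposn hposd using hpos
  let g : (ℕ → ℕ) → (Fin K → ℕ) := fun L i => L (pos i)
  have hg : Measurable g := by fun_prop
  rw [measure_eq_tsum_inter_fiber _ hg (measurable_rg (measurableSet_prefixSet _ _)), classWeight]
  refine tsum_congr fun f => ?_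
  have hiff (L : ℕ → ℕ) : L ∈ rg ⁻¹' prefixSet d n ↔ ∀ l < n, ∀ m < n, L l = L m ↔ d l = d m := by
    constructor
    · intro h l hl m hm
      rw [← rg_eq_iff, h l hl, h m hm]
    · intro h m hm
      rw [rg_congr_of_le (L' := d) fun l hl l' hl' => h l (by omega) l' (by omega)]
      exact hd.rg_eq hm
  split_ifs with hf
  · let F : ℕ → ℕ := fun k => if h : k < K then f ⟨k, h⟩ else 0
    have hF (i : Fin K) : F i = f i := by simp [F]
    have hset : rg ⁻¹' prefixSet d n ∩ {L | g L = f} = {L | ∀ m < n, L m = F (d m)} := by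
      ext L
      rw [Set.mem_inter_iff, hiff]
      constructor
      · rintro ⟨h, hgf⟩ m hm
        have hlt := hd.lt_numBlocks hm
        have h2 := (h m hm _ (hposn ⟨d m, hlt⟩)).2 (hposd ⟨d m, hlt⟩).symm
        rw [h2, show F (d m) = f ⟨d m, hlt⟩ from hF ⟨d m, hlt⟩]
        exact congrFun hgf ⟨d m, hlt⟩
      · intro h
        refine ⟨fun l hl m hm => ?_, funext fun i => ?_⟩
        · rw [h l hl, h m hm]
          constructor
          · intro hlm
            have e1 := hF ⟨d l, hd.lt_numBlocks hl⟩
            have e2 := hF ⟨d m, hd.lt_numBlocks hm⟩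
            simp only at e1 e2
            rw [e1, e2] at hlm
            exact congrArg Fin.val (hf hlm)
          · exact fun hlm => by rw [hlm]
        · change L (pos i) = f i
          rw [h _ (hposn i), hposd, hF]
    rw [hset, labelKernel_pi h0 h1,
      prod_range_eq_prod_pow_occ (fun m hm => hd.lt_numBlocks hm) fun k => ENNReal.ofReal (x (F k)),
      Finset.prod_range]
    exact Finset.prod_congr rfl fun i _ => by rw [hF]
  · convert! measure_empty (μ := labelKernel x)
    ext L
    simp only [Set.mem_inter_iff, Set.mem_empty_iff_false, iff_false, hiff]
    rintro ⟨h, rfl⟩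
    refine hf fun i j hij => ?_
    have := (h _ (hposn i) _ (hposn j)).1 hij
    rw [hposd, hposd] at this
    exact Fin.ext this

theorem measurable_classWeight {K : ℕ} (n : Fin K → ℕ) :
    Measurable fun x : ℕ → ℝ => classWeight (fun j => ENNReal.ofReal (x j)) n := by
  classical
  refine Measurable.tsum fun f => ?_
  split_ifs
  · fun_prop
  · fun_prop

section Paintbox

variable {α θ : ℝ}

/-- The recursion for `classWeight` under `GEM(α, θ)` that comes from breaking the first stick.
The coefficients are the beta moments of the first proportion. -/
theorem lintegral_classWeight_succ (hα0 : 0 ≤ α) (hα1 : α < 1) (hθ : -α < θ) {K : ℕ}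
    (n : Fin (K + 1) → ℕ) :
    ∫⁻ x, classWeight (fun j => ENNReal.ofReal (x j)) n ∂GEM α θ =
      ENNReal.ofReal (rising (θ + α) (∑ i, n i) / rising (θ + 1) (∑ i, n i)) *
          ∫⁻ x, classWeight (fun j => ENNReal.ofReal (x j)) n ∂GEM α (θ + α) +
        ∑ i, ENNReal.ofReal (rising (1 - α) (n i) * rising (θ + α) (∑ j, n (i.succAbove j)) /
            rising (θ + 1) (∑ i, n i)) *
          ∫⁻ x, classWeight (fun j => ENNReal.ofReal (x j)) (fun j => n (i.succAbove j))
            ∂GEM α (θ + α) := by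
  have h1 := isProbabilityMeasure_GEM hα0 hα1 (θ := θ + α) (by linarith)
  have h2 : IsProbabilityMeasure (betaMeasure (1 - α) (θ + α)) :=
    isProbabilityMeasureBeta (by linarith) (by linarith)
  have hbeta (u w : ℕ) := lintegral_betaMeasure (a := 1 - α) (c := θ + α) (by linarith)
    (by linarith) u w
  have e1 : 1 - α + (θ + α) = θ + 1 := by ring
  rw [GEM_eq_map_consStick hα0 hα1 hθ, 
    lintegral_map (measurable_classWeight n) measurable_consStick,
    lintegral_prod (fun q : ℝ × (ℕ → ℝ) =>
      classWeight (fun j => ENNReal.ofReal (consStick q.1 q.2 j)) n)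
      ((measurable_classWeight n).comp measurable_consStick).aemeasurable]
  have hrec : ∀ᵐ p ∂betaMeasure (1 - α) (θ + α), ∫⁻ x, classWeight
      (fun j => ENNReal.ofReal (consStick p x j)) n ∂GEM α (θ + α) =
        ENNReal.ofReal p ^ 0 * ENNReal.ofReal (1 - p) ^ (∑ i, n i) *
          ∫⁻ x, classWeight (fun j => ENNReal.ofReal (x j)) n ∂GEM α (θ + α) +
        ∑ i, ENNReal.ofReal p ^ n i * ENNReal.ofReal (1 - p) ^ (∑ j, n (i.succAbove j)) *
          ∫⁻ x, classWeight (fun j => ENNReal.ofReal (x j)) (fun j => n (i.succAbove j))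
            ∂GEM α (θ + α) := by
    filter_upwards [ae_betaMeasure_mem_Ioo (1 - α) (θ + α)] with p hp
    have hc (x : ℕ → ℝ) := classWeight_cons (y := fun j => ENNReal.ofReal (x j))
      (y' := fun j => ENNReal.ofReal (consStick p x j)) (β := ENNReal.ofReal p)
      (γ := ENNReal.ofReal (1 - p)) rfl
      (fun j => by rw [← ENNReal.ofReal_mul (by linarith [hp.2])]; rfl) n
    simp_rw [hc]
    rw [lintegral_add_left ((measurable_classWeight n).const_mul _),
      lintegral_const_mul _ (measurable_classWeight n), lintegral_finsetSum]
    · simp_rw [lintegral_const_mul _ (measurable_classWeight _), pow_zero, one_mul]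
    · exact fun i _ => (measurable_classWeight _).const_mul _
  rw [lintegral_congr_ae hrec, lintegral_add_left (by fun_prop),
    lintegral_mul_const _ (by fun_prop),
    hbeta, lintegral_finsetSum _ fun i _ => by fun_prop]
  congr 1
  · rw [rising_zero, one_mul, zero_add, e1]
  · refine Finset.sum_congr rfl fun i _ => ?_
    rw [lintegral_mul_const _ (by fun_prop), hbeta, e1, Fin.sum_univ_succAbove n i]

/-- The partition probability function `eppf`, as a function on families of block sizes. -/
noncomputable def eppfFin (α θ : ℝ) {K : ℕ} (n : Fin K → ℕ) : ℝ :=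
  (∏ i, rising (1 - α) (n i - 1)) * (∏ i ∈ Finset.range (K - 1), (θ + (i + 1) * α)) /
    rising (θ + 1) ((∑ i, n i) - 1)

theorem eppf_eq_eppfFin (K : ℕ) (c : ℕ → ℕ) : eppf α θ K c = eppfFin α θ fun i : Fin K => c i := by
  rw [eppf, eppfFin, Finset.prod_range, Finset.sum_range]

theorem eppfFin_nonneg (hα0 : 0 ≤ α) (hα1 : α < 1) (hθ : -α < θ) {K : ℕ} (n : Fin K → ℕ) :
    0 ≤ eppfFin α θ n := by
  refine div_nonneg (mul_nonneg (Finset.prod_nonneg fun k _ => ?_)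
    (Finset.prod_nonneg fun i _ => (stick_param_pos hα0 hθ i).le)) (rising_pos (by linarith) _).le
  exact (rising_pos (by linarith) _).le

theorem rising_mul_prod_div (hθ : -α < θ) {K N : ℕ} (hKN : K = 0 ↔ N = 0) :
    rising (θ + α) N * (∏ i ∈ Finset.range (K - 1), (θ + α + (i + 1) * α)) /
      rising (θ + α + 1) (N - 1) = ∏ i ∈ Finset.range K, (θ + (i + 1) * α) := by
  rcases Nat.eq_zero_or_pos K with rfl | hK
  · rw [hKN.1 rfl]; simp
  · have hN : N ≠ 0 := fun h => hK.ne' (hKN.2 h)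
    obtain ⟨k, rfl⟩ := Nat.exists_eq_succ_of_ne_zero hK.ne'
    obtain ⟨N, rfl⟩ := Nat.exists_eq_succ_of_ne_zero hN
    have := (rising_pos (by linarith : 0 < θ + α + 1) N).ne'
    simp only [Nat.succ_eq_add_one, Nat.add_sub_cancel]
    rw [rising_succ', Finset.prod_range_succ']
    push_cast
    field_simp
    rw [mul_comm]
    congr 1
    · exact Finset.prod_congr rfl fun i _ => by ring
    · ring

/-- The term of the recursion for the partition probability in which no block has the first
label. -/
theorem eppfFin_shift (hα1 : α < 1) (hθ : -α < θ) {K : ℕ} {n : Fin (K + 1) → ℕ}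
    (hn : 0 < ∑ i, n i) :
    rising (θ + α) (∑ i, n i) / rising (θ + 1) (∑ i, n i) * eppfFin α (θ + α) n =
      eppfFin α θ n * ((θ + (K + 1) * α) / (θ + (∑ i, n i : ℕ))) := by
  have h1 := rising_mul_prod_div hθ (K := K + 1) (N := ∑ i, n i) (by omega)
  obtain ⟨N, hN⟩ := Nat.exists_eq_succ_of_ne_zero hn.ne'
  rw [hN] at h1
  rw [eppfFin, eppfFin, hN]
  simp only [Nat.succ_eq_add_one, Nat.add_sub_cancel] at h1 ⊢
  have hN1 : θ + (N + 1 : ℕ) ≠ 0 := by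
    have : (0 : ℝ) ≤ N := N.cast_nonneg
    have : 0 < θ + (N + 1 : ℕ) := by push_cast; linarith
    exact this.ne'
  have hr := (rising_pos (by linarith : 0 < θ + 1) N).ne'
  have e : rising (θ + 1) (N + 1) = rising (θ + 1) N * (θ + (N + 1 : ℕ)) := by
    rw [rising_succ]; push_cast; ring
  have e2 : ∀ A B C D E : ℝ, A / B * (C * D / E) = C * (A * D / E) / B := fun A B C D E => by ring
  rw [e2, h1, e, Finset.prod_range_succ]
  field_simp

/-- The term of the recursion for the partition probability in which block `i` has the first
label. -/
theorem eppfFin_remove (hα1 : α < 1) (hθ : -α < θ) {K : ℕ} {n : Fin (K + 1) → ℕ}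
    (hn : ∀ i, 0 < n i) (i : Fin (K + 1)) :
    rising (1 - α) (n i) * rising (θ + α) (∑ j, n (i.succAbove j)) / rising (θ + 1) (∑ i, n i) *
        eppfFin α (θ + α) (fun j => n (i.succAbove j)) =
      eppfFin α θ n * ((n i - α) / (θ + (∑ i, n i : ℕ))) := by
  have hN0 : K = 0 ↔ ∑ j, n (i.succAbove j) = 0 := by
    constructor
    · rintro rfl; simp
    · intro h
      by_contra hK
      have := Finset.sum_eq_zero_iff.1 h ⟨0, Nat.pos_of_ne_zero hK⟩ (Finset.mem_univ _)
      exact (hn _).ne' this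
  have h1 := rising_mul_prod_div hθ hN0
  have hpos : 0 < ∑ i, n i := (hn i).trans_le
    (Finset.single_le_sum (f := n) (fun _ _ => Nat.zero_le _) (Finset.mem_univ i))
  obtain ⟨N, hN⟩ := Nat.exists_eq_succ_of_ne_zero hpos.ne'
  obtain ⟨k, hk⟩ := Nat.exists_eq_succ_of_ne_zero (hn i).ne'
  rw [eppfFin, eppfFin, hN, Fin.prod_univ_succAbove _ i, hk]
  simp only [Nat.succ_eq_add_one, Nat.add_sub_cancel]
  have hN1 : θ + (N + 1 : ℕ) ≠ 0 := by
    have : (0 : ℝ) ≤ N := N.cast_nonneg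
    have : 0 < θ + (N + 1 : ℕ) := by push_cast; linarith
    exact this.ne'
  have hr := (rising_pos (by linarith : 0 < θ + 1) N).ne'
  have e : rising (θ + 1) (N + 1) = rising (θ + 1) N * (θ + (N + 1 : ℕ)) := by
    rw [rising_succ]; push_cast; ring
  have e2 : ∀ A B C D E F : ℝ, F * A / B * (C * D / E) = F * C * (A * D / E) / B :=
    fun A B C D E F => by ring
  rw [e2, h1, e, rising_succ]
  field_simp
  push_cast
  ring

/-- The partition probability function satisfies the recursion that stick breaking imposes on
`classWeight`. -/
theorem eppfFin_rec (hα1 : α < 1) (hθ : -α < θ) {K : ℕ} {n : Fin (K + 1) → ℕ}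
    (hn : ∀ i, 0 < n i) :
    eppfFin α θ n =
      rising (θ + α) (∑ i, n i) / rising (θ + 1) (∑ i, n i) * eppfFin α (θ + α) n +
        ∑ i, rising (1 - α) (n i) * rising (θ + α) (∑ j, n (i.succAbove j)) /
          rising (θ + 1) (∑ i, n i) * eppfFin α (θ + α) (fun j => n (i.succAbove j)) := by
  have hpos : 0 < ∑ i, n i := (hn 0).trans_le
    (Finset.single_le_sum (f := n) (fun _ _ => Nat.zero_le _) (Finset.mem_univ 0))
  rw [eppfFin_shift hα1 hθ hpos, Finset.sum_congr rfl fun i _ => eppfFin_remove hα1 hθ hn i,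
    ← Finset.mul_sum, ← mul_add, ← Finset.sum_div, ← add_div, Finset.sum_sub_distrib]
  have hN1 : θ + (∑ i, n i : ℕ) ≠ 0 := by
    have : (1 : ℝ) ≤ (∑ i, n i : ℕ) := by exact_mod_cast hpos
    have : 0 < θ + (∑ i, n i : ℕ) := by linarith
    exact this.ne'
  have : θ + (K + 1) * α + (∑ i, (n i : ℝ) - ∑ _i : Fin (K + 1), α) = θ + (∑ i, n i : ℕ) := by
    simp
  rw [this, div_self hN1, mul_one]

theorem rising_div_rising_le (hα1 : α < 1) (hθ : -α < θ) {N : ℕ} (hN : 0 < N) :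
    rising (θ + α) N / rising (θ + 1) N ≤ (θ + α) / (θ + 1) := by
  obtain ⟨N, rfl⟩ := Nat.exists_eq_succ_of_ne_zero hN.ne'
  simp only [Nat.succ_eq_add_one]
  rw [rising_succ', rising_succ', mul_div_mul_comm]
  have h0 : 0 ≤ (θ + α) / (θ + 1) := div_nonneg (by linarith) (by linarith)
  refine mul_le_of_le_one_right h0 (div_le_one_of_le₀ ?_ (rising_pos (by linarith) _).le)
  refine Finset.prod_le_prod (fun i _ => ?_) fun i _ => by linarith
  have : (0 : ℝ) ≤ i := i.cast_nonneg
  linarith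

/-- The probability that given groups of labels form classes, for labels sampled from a `GEM`
vector. The difference of the two sides is multiplied by the moment `E (1 - b)^N` of the first
proportion when `θ` is replaced by `θ + α`, and the products of these moments tend to zero. -/
theorem lintegral_classWeight (hα0 : 0 ≤ α) (hα1 : α < 1) (hθ : -α < θ) {K : ℕ} {n : Fin K → ℕ}
    (hn : ∀ i, 0 < n i) :
    ∫⁻ x, classWeight (fun j => ENNReal.ofReal (x j)) n ∂GEM α θ =
      ENNReal.ofReal (eppfFin α θ n) := by
  induction K generalizing θ with
  | zero =>
    have := isProbabilityMeasure_GEM hα0 hα1 hθ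
    have h (x : ℕ → ℝ) : classWeight (fun j => ENNReal.ofReal (x j)) n = 1 := by
      rw [classWeight, tsum_eq_single default fun f hf => absurd (Subsingleton.elim f default) hf,
        if_pos (Function.injective_of_subsingleton _)]
      simp
    simp [h, eppfFin]
  | succ K ih =>
    set N := ∑ i, n i with hN
    have hNK : K + 1 ≤ N := by
      have := Finset.sum_le_sum fun i (_ : i ∈ Finset.univ) => Nat.succ_le_of_lt (hn i)
      simpa using this
    let q : ℝ → ENNReal := fun θ => ∫⁻ x, classWeight (fun j => ENNReal.ofReal (x j)) n ∂GEM α θ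
    have hq1 (θ : ℝ) (hθ : -α < θ) : q θ ≤ 1 := by
      have := isProbabilityMeasure_GEM hα0 hα1 hθ
      calc q θ ≤ ∫⁻ _, 1 ∂GEM α θ := lintegral_mono_ae (by
            filter_upwards [ae_GEM hα0 hα1 hθ] with x hx
            exact classWeight_le_one (fun i => (hx.1 i).le) hx.2 hn)
        _ = 1 := by simp
    -- Both sides satisfy the same recursion, and the terms with fewer groups agree by induction. So
    -- the error `D θ` is the moment `m θ` times the error at `θ + α`.
    let D : ℝ → ℝ := fun θ => (q θ).toReal - eppfFin α θ n
    let m : ℝ → ℝ := fun θ => rising (θ + α) N / rising (θ + 1) N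
    have hm0 (θ : ℝ) (hθ : -α < θ) : 0 ≤ m θ :=
      div_nonneg (rising_pos (by linarith) _).le (rising_pos (by linarith) _).le
    have hD (θ : ℝ) (hθ : -α < θ) : D θ = m θ * D (θ + α) := by
      have h1 := lintegral_classWeight_succ hα0 hα1 hθ n
      have hM (i : Fin (K + 1)) : 0 ≤ rising (1 - α) (n i) *
          rising (θ + α) (∑ j, n (i.succAbove j)) / rising (θ + 1) N :=
        div_nonneg (mul_nonneg (rising_pos (by linarith) _).le (rising_pos (by linarith) _).le)
          (rising_pos (by linarith) _).le
      have hE (i : Fin (K + 1)) := eppfFin_nonneg hα0 hα1 (θ := θ + α) (by linarith)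
        fun j => n (i.succAbove j)
      simp_rw [fun i : Fin (K + 1) =>
        ih (θ := θ + α) (by linarith) (n := fun j => n (i.succAbove j))
        fun j => hn _] at h1
      have h2 : (q θ).toReal = m θ * (q (θ + α)).toReal + ∑ i, rising (1 - α) (n i) *
          rising (θ + α) (∑ j, n (i.succAbove j)) / rising (θ + 1) N *
            eppfFin α (θ + α) (fun j => n (i.succAbove j)) := by
        have hfin : q (θ + α) ≠ ⊤ := ((hq1 (θ + α) (by linarith)).trans_lt ENNReal.one_lt_top).ne
        rw [show q θ = _ from h1, ENNReal.toReal_add, ENNReal.toReal_mul,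
          ENNReal.toReal_ofReal (hm0 θ hθ), ENNReal.toReal_sum]
        · congr 1
          refine Finset.sum_congr rfl fun i _ => ?_
          rw [ENNReal.toReal_mul, ENNReal.toReal_ofReal (hM i), ENNReal.toReal_ofReal (hE i)]
        · exact fun i _ => ENNReal.mul_ne_top ENNReal.ofReal_ne_top ENNReal.ofReal_ne_top
        · exact ENNReal.mul_ne_top ENNReal.ofReal_ne_top hfin
        · exact (ENNReal.sum_lt_top.2 fun i _ =>
            ENNReal.mul_lt_top ENNReal.ofReal_lt_top ENNReal.ofReal_lt_top).ne
      simp only [D]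
      rw [h2, eppfFin_rec hα1 hθ hn]
      simp only [m, ← hN]
      ring
    -- Iterating `J` times, the contribution of `q` is bounded through `q ≤ 1`, and that of
    -- `eppfFin` is computed by `eppfFin_shift`.
    have hbound (J : ℕ) : ∀ θ : ℝ, -α < θ → |D θ| ≤
        ∏ j ∈ Finset.range J, ((θ + α + j * α) / (θ + 1 + j * α)) + eppfFin α θ n *
          ∏ j ∈ Finset.range J, ((θ + (K + 1) * α + j * α) / (θ + N + j * α)) := by
      induction J with
      | zero =>
        intro θ hθ
        have h1 : (q θ).toReal ≤ 1 := by
          have := ENNReal.toReal_mono ENNReal.one_ne_top (hq1 θ hθ)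
          simpa using this
        have h2 := eppfFin_nonneg hα0 hα1 hθ n
        have h3 : 0 ≤ (q θ).toReal := ENNReal.toReal_nonneg
        simp only [Finset.range_zero, Finset.prod_empty, mul_one, D]
        rw [abs_le]
        constructor <;> linarith
      | succ J ihJ =>
        intro θ hθ
        have h1 := mul_le_mul_of_nonneg_left (ihJ (θ + α) (by linarith)) (hm0 θ hθ)
        rw [← abs_of_nonneg (hm0 θ hθ), ← abs_mul, ← hD θ hθ, abs_of_nonneg (hm0 θ hθ), mul_add,
          ← mul_assoc, eppfFin_shift hα1 hθ (by omega : 0 < ∑ i, n i), ← hN, mul_assoc] at h1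
        refine h1.trans ?_
        rw [Finset.prod_range_succ', Finset.prod_range_succ']
        have e1 : ∏ j ∈ Finset.range J, ((θ + α + α + j * α) / (θ + α + 1 + j * α)) =
            ∏ j ∈ Finset.range J, ((θ + α + (j + 1 : ℕ) * α) / (θ + 1 + (j + 1 : ℕ) * α)) :=
          Finset.prod_congr rfl fun j _ => by push_cast; congr 1 <;> ring
        have e2 : ∏ j ∈ Finset.range J, ((θ + α + (K + 1) * α + j * α) / (θ + α + N + j * α)) =
            ∏ j ∈ Finset.range J,
              ((θ + (K + 1) * α + (j + 1 : ℕ) * α) / (θ + N + (j + 1 : ℕ) * α)) :=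
          Finset.prod_congr rfl fun j _ => by push_cast; congr 1 <;> ring
        rw [e1, e2]
        refine add_le_add ?_ (le_of_eq ?_)
        · rw [mul_comm]
          refine mul_le_mul_of_nonneg_left ?_ (Finset.prod_nonneg fun j _ => ?_)
          · simpa using rising_div_rising_le hα1 hθ (by omega : 0 < N)
          · have : (0 : ℝ) ≤ (j + 1 : ℕ) * α := by positivity
            exact div_nonneg (by linarith) (by linarith)
        · rw [Nat.cast_zero, zero_mul, add_zero, add_zero]
          ring
    have hN' : ((K : ℝ) + 1) ≤ N := by exact_mod_cast hNK
    have hlim : Filter.Tendsto (fun J : ℕ =>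
        ∏ j ∈ Finset.range J, ((θ + α + j * α) / (θ + 1 + j * α)) + eppfFin α θ n *
          ∏ j ∈ Finset.range J, ((θ + (K + 1) * α + j * α) / (θ + N + j * α))) Filter.atTop
        (nhds (0 + eppfFin α θ n * 0)) := by
      refine (tendsto_prod_div_zero (by linarith) (by linarith) hα0).add
        ((tendsto_prod_div_zero ?_ ?_ hα0).const_mul _)
      · exact stick_param_pos hα0 hθ K
      · have : (0 : ℝ) ≤ K := K.cast_nonneg
        nlinarith
    rw [mul_zero, add_zero] at hlim
    have hD0 : |D θ| ≤ 0 := ge_of_tendsto' hlim fun J => hbound J θ hθ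
    have hD1 : (q θ).toReal = eppfFin α θ n := sub_eq_zero.1 (abs_nonpos_iff.1 hD0)
    rw [← hD1, ENNReal.ofReal_toReal ((hq1 θ hθ).trans_lt ENNReal.one_lt_top).ne]

/-- The law of the partition generated by independent labels sampled from a `PD(α, θ)` vector,
coded as a restricted growth sequence. -/
noncomputable def paintboxLaw (α θ : ℝ) : Measure (ℕ → ℕ) := ((PD α θ).bind labelKernel).map rg

theorem ae_PD (hα0 : 0 ≤ α) (hα1 : α < 1) (hθ : -α < θ) : ∀ᵐ x ∂PD α θ, x ∈ massPartitions := by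
  rw [PD]
  refine (ae_map_iff measurable_rank.aemeasurable (p := fun x => x ∈ massPartitions)
    measurableSet_massPartitions).2 ?_
  filter_upwards [ae_GEM hα0 hα1 hθ] with x hx
  exact rank_mem_massPartitions hx.1 hx.2

theorem isProbabilityMeasure_paintboxLaw (hα0 : 0 ≤ α) (hα1 : α < 1) (hθ : -α < θ) :
    IsProbabilityMeasure (paintboxLaw α θ) := by
  have := isProbabilityMeasure_PD hα0 hα1 hθ
  exact Measure.isProbabilityMeasure_map measurable_rg.aemeasurable

/-- The partition generated by independent labels sampled from a `PD(α, θ)` vector is a Chinese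
restaurant process. -/
theorem paintboxLaw_eq_crpLaw (hα0 : 0 ≤ α) (hα1 : α < 1) (hθ : -α < θ) :
    paintboxLaw α θ = crpLaw α θ := by
  have := isProbabilityMeasure_crpLaw hα0 hα1 hθ
  have := isProbabilityMeasure_paintboxLaw hα0 hα1 hθ
  refine HasPrediction.eq (hasPrediction_of_eppf hα0 hα1 hθ (fun a n h => ?_) fun d n hd => ?_)
    (hasPrediction_crpLaw hα0 hα1 hθ)
  · rw [paintboxLaw, Measure.map_apply measurable_rg (measurableSet_prefixSet _ _)]
    convert! measure_empty (μ := (PD α θ).bind labelKernel)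
    ext L
    simp only [Set.mem_preimage, Set.mem_empty_iff_false, iff_false]
    exact fun hL => h ((restrictedGrowth_congr hL).1 (restrictedGrowth_rg L n))
  · have hm : MeasurableSet ((rg : (ℕ → ℕ) → ℕ → ℕ) ⁻¹' prefixSet d n) :=
      measurable_rg (measurableSet_prefixSet d n)
    rw [paintboxLaw, Measure.map_apply measurable_rg (measurableSet_prefixSet _ _),
      Measure.bind_apply hm labelKernel.measurable.aemeasurable, PD,
      lintegral_map (labelKernel.measurable_coe hm) measurable_rank, eppf_eq_eppfFin,
      ← lintegral_classWeight hα0 hα1 hθ fun i => hd.occ_pos i.2]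
    refine lintegral_congr_ae ?_
    filter_upwards [ae_GEM hα0 hα1 hθ] with x hx
    have hr := rank_mem_massPartitions hx.1 hx.2
    rw [labelKernel_rg (fun i => (hr.1 i).le) hr.2.2 hd]
    obtain ⟨σ, hσ⟩ := exists_perm_rank hx.1 hx.2
    rw [hσ, ← classWeight_comp_perm (fun j => ENNReal.ofReal (x j)) _ σ]
    rfl

end Paintbox

/-! ### Recursive trees as sequences of parents -/

section Tree

/-- The prediction rule of the recursive tree, for the sequence whose `n`-th term is the parent of
vertex `n + 1`. -/
noncomputable def treeRule (α θ : ℝ) (n : ℕ) (a : ℕ → ℕ) (e : ℕ) : ENNReal :=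
  if n = 0 then if e = 0 then 1 else 0
  else if e = 0 then ENNReal.ofReal ((θ + α * occ a 0 n) / (θ + n))
  else if e ≤ n then ENNReal.ofReal ((1 - α + α * occ a e n) / (θ + n))
  else 0

/-- In the first `n` terms of `a`, the parent of each vertex is an earlier vertex. -/
def IsParentSeq (a : ℕ → ℕ) (n : ℕ) : Prop := ∀ m < n, a m ≤ m

variable {α θ : ℝ}

theorem treeRule_congr {n : ℕ} {a b : ℕ → ℕ} (h : ∀ m < n, a m = b m) (e : ℕ) :
    treeRule α θ n a e = treeRule α θ n b e := by
  have h' (z : ℕ) : occ a z n = occ b z n := occ_congr fun m hm => by rw [h m hm]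
  simp only [treeRule, h']

theorem le_of_treeRule_ne_zero {n : ℕ} {a : ℕ → ℕ} {e : ℕ} (h : treeRule α θ n a e ≠ 0) :
    e ≤ n := by
  by_contra hn
  refine h ?_
  rw [treeRule]
  split_ifs <;> first | rfl | omega

theorem HasPrediction.isParentSeq {μ : Measure (ℕ → ℕ)} (hμ : HasPrediction μ (treeRule α θ))
    {a : ℕ → ℕ} {n : ℕ} (h : μ (prefixSet a n) ≠ 0) : IsParentSeq a n :=
  fun m hm => le_of_treeRule_ne_zero (hμ.prefixSet_succ_ne_zero h m hm)

theorem occ_zero_pos {a : ℕ → ℕ} {n : ℕ} (ha : IsParentSeq a n) (hn : n ≠ 0) : 0 < occ a 0 n :=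
  occ_pos_iff.2 ⟨0, Nat.pos_of_ne_zero hn, Nat.le_zero.1 (ha 0 (Nat.pos_of_ne_zero hn))⟩

theorem add_natCast_pos (hα1 : α < 1) (hθ : -α < θ) {n : ℕ} (hn : n ≠ 0) : 0 < θ + n := by
  have : (1 : ℝ) ≤ n := by exact_mod_cast Nat.one_le_iff_ne_zero.2 hn
  linarith

theorem root_weight_pos (hα0 : 0 ≤ α) (hθ : -α < θ) {k : ℕ} (hk : 0 < k) : 0 < θ + α * k := by
  have : (1 : ℝ) ≤ k := by exact_mod_cast hk
  nlinarith

theorem sum_weights {a : ℕ → ℕ} {n : ℕ} (ha : IsParentSeq a n) :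
    (θ + α * occ a 0 n) + ∑ e ∈ Finset.range n, (1 - α + α * occ a (e + 1) n) = θ + n := by
  have h : ∑ e ∈ Finset.range (n + 1), occ a e n = n :=
    sum_occ fun m hm => (ha m hm).trans_lt (by omega)
  rw [Finset.sum_range_succ'] at h
  have h' : ∑ e ∈ Finset.range n, (occ a (e + 1) n : ℝ) + occ a 0 n = n := by exact_mod_cast h
  rw [Finset.sum_add_distrib, ← Finset.mul_sum, Finset.sum_const, Finset.card_range, nsmul_eq_mul]
  linear_combination α * h'

theorem sum_treeRule (hα0 : 0 ≤ α) (hα1 : α < 1) (hθ : -α < θ) {a : ℕ → ℕ} {n : ℕ}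
    (ha : IsParentSeq a n) : ∑ e ∈ Finset.range (n + 1), treeRule α θ n a e = 1 := by
  rcases eq_or_ne n 0 with rfl | hn
  · simp [treeRule]
  have hpos := add_natCast_pos hα1 hθ hn
  have hw (k : ℕ) : 0 ≤ (1 - α + α * k) / (θ + n) :=
    div_nonneg (by have := mul_nonneg hα0 k.cast_nonneg; linarith) hpos.le
  rw [Finset.sum_range_succ']
  have h1 : ∀ e ∈ Finset.range n, treeRule α θ n a (e + 1) =
      ENNReal.ofReal ((1 - α + α * occ a (e + 1) n) / (θ + n)) := fun e he => by
    rw [treeRule, if_neg hn, if_neg e.succ_ne_zero, if_pos (by simpa using he)]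
  rw [Finset.sum_congr rfl h1, ← ENNReal.ofReal_sum_of_nonneg fun e _ => hw _, treeRule, if_neg hn,
    if_pos rfl, ← ENNReal.ofReal_add (Finset.sum_nonneg fun e _ => hw _)
      (div_nonneg (root_weight_pos hα0 hθ (occ_zero_pos ha hn)).le hpos.le),
    ← Finset.sum_div, ← add_div, add_comm, sum_weights ha, div_self hpos.ne', ENNReal.ofReal_one]

theorem childCount_eq_occ (p : ℕ → ℕ) (n j : ℕ) :
    childCount p n j = occ (fun m => p (m + 1)) j n := by
  refine Finset.card_bij' (fun m _ => m - 1) (fun m _ => m + 1) ?_ ?_ ?_ ?_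
  · intro m hm
    simp only [Finset.mem_filter, Finset.mem_Icc, Finset.mem_range] at hm ⊢
    exact ⟨by omega, by rw [Nat.sub_add_cancel hm.1.1]; exact hm.2⟩
  · intro m hm
    simp only [Finset.mem_filter, Finset.mem_Icc, Finset.mem_range] at hm ⊢
    exact ⟨by omega, hm.2⟩
  · intro m hm
    simp only [Finset.mem_filter, Finset.mem_Icc] at hm
    omega
  · intro m _
    omega

theorem sum_vertexWeight {p : ℕ → ℕ} {n : ℕ} (hp : IsParentSeq (fun m => p (m + 1)) n) :
    ∑ l ∈ Finset.range (n + 1), vertexWeight α θ p n l = θ + n := by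
  rw [Finset.sum_range_succ', ← sum_weights (α := α) (θ := θ) hp, add_comm]
  simp [vertexWeight, childCount_eq_occ]

/-- The sequence of parents of a recursive tree follows the prediction rule `treeRule`. The events
in the definition of a recursive tree only concern the vertices `j ≤ n`; that the parent of
`n + 1` is one of them follows since their probabilities sum to one. -/
theorem IsRecursiveTree.hasPrediction (hα0 : 0 ≤ α) (hα1 : α < 1) (hθ : -α < θ) {Ω : Type*}
    [MeasurableSpace Ω] {P : Measure Ω} [IsProbabilityMeasure P] {par : ℕ → Ω → ℕ}
    (hT : IsRecursiveTree α θ par P) :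
    HasPrediction (P.map fun ω n => par (n + 1) ω) (treeRule α θ) := by
  set X : Ω → ℕ → ℕ := fun ω n => par (n + 1) ω with hXdef
  have hX : Measurable X := measurable_pi_lambda _ fun n => hT.measurable _
  have hprob : IsProbabilityMeasure (P.map X) := Measure.isProbabilityMeasure_map hX.aemeasurable
  have key (n : ℕ) (hV : ∀ a, P.map X (prefixSet a n) ≠ 0 → IsParentSeq a n) (a : ℕ → ℕ) (e : ℕ) :
      P.map X {x | (∀ m < n, x m = a m) ∧ x n = e} =
        P.map X (prefixSet a n) * treeRule α θ n a e := by
    by_cases h0 : P.map X (prefixSet a n) = 0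
    · rw [h0, zero_mul]
      exact measure_mono_null (fun x hx => hx.1) h0
    have ha := hV a h0
    have hle (e : ℕ) (he : e ≤ n) : P.map X {x | (∀ m < n, x m = a m) ∧ x n = e} =
        P.map X (prefixSet a n) * treeRule α θ n a e := by
      rw [prefixSet_update, Measure.map_apply hX (measurableSet_prefixSet _ _),
        Measure.map_apply hX (measurableSet_prefixSet _ _), ← prefixSet_update]
      rcases eq_or_ne n 0 with rfl | hn
      · obtain rfl : e = 0 := by omega
        have h1 : P (X ⁻¹' {x | (∀ m < 0, x m = a m) ∧ x 0 = 0}) = 1 := by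
          rw [← measure_univ (μ := P)]
          refine measure_congr ?_
          filter_upwards [hT.parent_one] with ω hω
          exact propext ⟨fun _ => trivial, fun _ => ⟨fun m hm => absurd hm (Nat.not_lt_zero m), hω⟩⟩
        rw [h1]
        simp [prefixSet, treeRule]
      · set p : ℕ → ℕ := fun m => a (m - 1) with hp
        have hpa : (fun m => p (m + 1)) = a := by funext m; simp [hp]
        have hset (ω : Ω) : (∀ m ∈ Finset.Icc 1 n, par m ω = p m) ↔ ∀ m < n, X ω m = a m := by
          simp only [Finset.mem_Icc, hXdef, hp]
          constructor
          · intro h m hm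
            simpa using h (m + 1) ⟨by omega, by omega⟩
          · rintro h m ⟨h1, h2⟩
            have := h (m - 1) (by omega)
            rwa [Nat.sub_add_cancel h1] at this
        have hatt := hT.attach n (Nat.one_le_iff_ne_zero.2 hn) p e he
        simp only [hset] at hatt
        rw [sum_vertexWeight (by rwa [hpa])] at hatt
        refine hatt.trans ?_
        congr 1
        rw [treeRule, if_neg hn, vertexWeight, childCount_eq_occ, childCount_eq_occ, hpa]
        split_ifs <;> rfl
    by_cases he : e ≤ n
    · exact hle e he
    · have h0 : treeRule α θ n a e = 0 := by
        by_contra h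
        exact he (le_of_treeRule_ne_zero h)
      rw [h0, mul_zero]
      have hd : P.map X (⋃ j ∈ Finset.range (n + 1), {x | (∀ m < n, x m = a m) ∧ x n = j}) =
          P.map X (prefixSet a n) := by
        rw [measure_biUnion_finset]
        · rw [Finset.sum_congr rfl fun j hj => hle j (by simpa [Nat.lt_succ_iff] using hj),
            ← Finset.mul_sum, sum_treeRule hα0 hα1 hθ ha, mul_one]
        · intro j _ k _ hjk
          exact Set.disjoint_left.2 fun x hx hx' => hjk (hx.2.symm.trans hx'.2)
        · intro j _
          rw [prefixSet_update]
          exact measurableSet_prefixSet _ _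
      have hsub : (⋃ j ∈ Finset.range (n + 1), {x | (∀ m < n, x m = a m) ∧ x n = j}) ⊆
          prefixSet a n := by
        simp only [Set.iUnion_subset_iff]
        exact fun j _ x hx => hx.1
      have hdm : MeasurableSet
          (⋃ j ∈ Finset.range (n + 1), {x : ℕ → ℕ | (∀ m < n, x m = a m) ∧ x n = j}) := by
        refine Finset.measurableSet_biUnion _ fun j _ => ?_
        rw [prefixSet_update]
        exact measurableSet_prefixSet _ _
      refine measure_mono_null (t := prefixSet a n \
        ⋃ j ∈ Finset.range (n + 1), {x | (∀ m < n, x m = a m) ∧ x n = j}) ?_ ?_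
      · rintro x ⟨hx, hxe⟩
        refine ⟨hx, ?_⟩
        simp only [Set.mem_iUnion, Finset.mem_range, Set.mem_ofPred_eq, not_exists]
        rintro j hj ⟨-, hxj⟩
        omega
      · rw [measure_sdiff hsub hdm.nullMeasurableSet (measure_ne_top _ _), hd, tsub_self]
  have hV : ∀ n a, P.map X (prefixSet a n) ≠ 0 → IsParentSeq a n := by
    intro n
    induction n with
    | zero => exact fun a _ m hm => absurd hm (Nat.not_lt_zero m)
    | succ n ih =>
      intro a h m hm
      rw [prefixSet_succ, key n ih] at h
      rcases Nat.lt_succ_iff_lt_or_eq.1 hm with hm | rfl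
      · exact ih a (left_ne_zero_of_mul h) m hm
      · exact le_of_treeRule_ne_zero (right_ne_zero_of_mul h)
  exact fun n => key n (hV n)

theorem HasPrediction.ae_isParentSeq {μ : Measure (ℕ → ℕ)} [IsProbabilityMeasure μ]
    (hμ : HasPrediction μ (treeRule α θ)) : ∀ᵐ x ∂μ, ∀ n, x n ≤ n := by
  rw [ae_all_iff]
  intro n
  rw [ae_iff]
  have hg : Measurable fun (x : ℕ → ℕ) (i : Fin (n + 1)) => x i := by fun_prop
  have hs : MeasurableSet {x : ℕ → ℕ | ¬ x n ≤ n} :=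
    measurableSet_of_prefix (n + 1) fun x y h => by
      simp only [Set.mem_ofPred_eq, h n n.lt_succ_self]
  rw [measure_eq_tsum_inter_fiber μ hg hs, ENNReal.tsum_eq_zero]
  intro c
  by_contra h
  let a : ℕ → ℕ := fun m => if h : m < n + 1 then c ⟨m, h⟩ else 0
  have hca : ∀ x : ℕ → ℕ, (fun i : Fin (n + 1) => x i) = c → x ∈ prefixSet a (n + 1) := by
    rintro x rfl m hm
    simp only [a]
    rw [dif_pos hm]
  have ha := hμ.isParentSeq (fun h0 => h (measure_mono_null (t := prefixSet a (n + 1))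
    (fun x hx => hca x hx.2) h0))
  obtain ⟨x, hx, hxc⟩ := nonempty_of_measure_ne_zero h
  refine hx ?_
  rw [hca x hxc n n.lt_succ_self]
  exact ha n n.lt_succ_self

end Tree

/-! ### Contracting the root with its first child -/

section Contract

variable {α θ : ℝ}

theorem HasPrediction.map_tail {E : Type*} [MeasurableSpace E] [MeasurableSingletonClass E]
    [Countable E] [Nonempty E]
    {μ : Measure (ℕ → E)} [IsProbabilityMeasure μ] {q r : ℕ → (ℕ → E) → E → ENNReal} {e0 : E}
    (hμ : HasPrediction μ r) (h0 : ∀ a, r 0 a e0 = 1)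
    (hr : ∀ n a e, r (n + 1) a e = q n (fun m => a (m + 1)) e) :
    HasPrediction (μ.map fun x n => x (n + 1)) q := by
  have hm : Measurable fun (x : ℕ → E) n => x (n + 1) := by fun_prop
  have h1 : ∀ᵐ x ∂μ, x 0 = e0 := by
    refine (prob_compl_eq_zero_iff (s := {x : ℕ → E | x 0 = e0})
      ((measurable_pi_apply 0 : Measurable fun x : ℕ → E => x 0) (measurableSet_singleton _))).2 ?_
    have := hμ 0 (fun _ => e0) e0
    simpa [prefixSet, h0] using this
  intro n a e
  let b : ℕ → E := fun m => m.casesOn e0 a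
  have hb (x : ℕ → E) (hx : x 0 = e0) :
      (∀ m < n + 1, x m = b m) ↔ ∀ m < n, x (m + 1) = a m := by
    constructor
    · exact fun h m hm => h (m + 1) (by omega)
    · rintro h (_ | m) hm
      · exact hx
      · exact h m (by omega)
  rw [prefixSet_update, Measure.map_apply hm (measurableSet_prefixSet _ _),
    Measure.map_apply hm (measurableSet_prefixSet _ _), ← prefixSet_update]
  have e1 : μ ((fun x n => x (n + 1)) ⁻¹' {x | (∀ m < n, x m = a m) ∧ x n = e}) =
      μ {x | (∀ m < n + 1, x m = b m) ∧ x (n + 1) = e} := by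
    refine measure_congr ?_
    filter_upwards [h1] with x hx
    exact propext (and_congr_left fun _ => (hb x hx).symm)
  have e2 : μ ((fun x n => x (n + 1)) ⁻¹' prefixSet a n) = μ (prefixSet b (n + 1)) := by
    refine measure_congr ?_
    filter_upwards [h1] with x hx
    exact propext (hb x hx).symm
  rw [e1, e2, hμ, hr]

/-- The tree obtained by contracting the vertices `0, …, i` into a single root, relabelled. -/
def contract (i : ℕ) (x : ℕ → ℕ) (n : ℕ) : ℕ := x (n + i) - i

theorem contract_succ (i : ℕ) (x : ℕ → ℕ) : contract 1 (contract i x) = contract (i + 1) x := by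
  funext n
  simp only [contract]
  rw [Nat.sub_sub, show n + 1 + i = n + (i + 1) by omega]

theorem measurable_contract (i : ℕ) : Measurable (contract i) :=
  measurable_pi_lambda _ fun n =>
    (measurable_of_countable (fun k : ℕ => k - i)).comp (measurable_pi_apply (n + i))

/-- Contracting the root and its first child turns an `(α, θ)`-recursive tree into an
`(α, θ + 1)`-recursive tree: the weights of the two vertices add up to the weight of the new
root. -/
theorem HasPrediction.map_contract_one (hα0 : 0 ≤ α) (hα1 : α < 1) (hθ : -α < θ)
    {μ : Measure (ℕ → ℕ)}
    [IsProbabilityMeasure μ] (hμ : HasPrediction μ (treeRule α θ)) :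
    HasPrediction (μ.map (contract 1)) (treeRule α (θ + 1)) := by
  let r : ℕ → (ℕ → ℕ) → ℕ → ENNReal := fun n b z =>
    if n = 0 then if z = 0 then 1 else 0 else treeRule α (θ + 1) (n - 1) (fun m => b (m + 1)) z
  have hv : HasPrediction (μ.map fun x n => x n - 1) r := by
    refine hμ.map (fun x y n h => by simp only [h n n.lt_succ_self]) (fun n b b' h z => ?_)
      fun n a h0 z => ?_
    · simp only [r]
      split_ifs
      · rfl
      · rfl
      · exact treeRule_congr (fun m hm => h (m + 1) (by omega)) z
    · have ha := hμ.isParentSeq h0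
      simp only [Function.update_self]
      have hz : ∑' e : ℕ, (open Classical in if e - 1 = z then treeRule α θ n a e else 0) =
          (if z = 0 then treeRule α θ n a 0 else 0) + treeRule α θ n a (z + 1) := by
        rw [tsum_eq_sum (s := {0, z + 1}), Finset.sum_pair (by omega)]
        · congr 1
          · simp [eq_comm]
          · simp
        · intro e he
          simp only [Finset.mem_insert, Finset.mem_singleton, not_or] at he
          rw [if_neg (by omega)]
      rw [hz]
      rcases n with _ | n
      · simp [r, treeRule]
      have ha0 : a 0 = 0 := Nat.le_zero.1 (ha 0 n.succ_pos)
      simp only [r, if_neg n.succ_ne_zero, Nat.add_sub_cancel]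
      have hocc (z : ℕ) : occ a (z + 1) (n + 1) +
          (if z = 0 then occ a 0 (n + 1) else 0) =
            occ (fun m => a (m + 1) - 1) z n + if z = 0 then 1 else 0 := by
        clear hz h0 hμ r ha
        induction n with
        | zero => by_cases hz : z = 0 <;> simp [occ_succ, ha0, hz]
        | succ n ih =>
          rw [occ_succ a (z + 1) (n + 1), occ_succ a 0 (n + 1), occ_succ _ z n]
          by_cases hz : z = 0
          · simp only [hz, if_true, zero_add] at ih ⊢
            rcases h : a (n + 1) with _ | _ | k <;> simp <;> omega
          · simp only [hz, if_false] at ih ⊢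
            rcases h : a (n + 1) with _ | k <;> simp <;> first | omega | grind
      have hoccz := hocc z
      have hpos := add_natCast_pos hα1 hθ n.succ_ne_zero
      have hw (k : ℕ) : 0 ≤ 1 - α + α * k := by have := mul_nonneg hα0 k.cast_nonneg; linarith
      push_cast at hpos
      rw [treeRule, treeRule, treeRule, if_neg n.succ_ne_zero, if_neg n.succ_ne_zero,
        if_pos rfl, if_neg z.succ_ne_zero]
      rcases eq_or_ne z 0 with rfl | hz0
      · rw [if_pos rfl, if_pos (by omega), ← ENNReal.ofReal_add
          (div_nonneg (root_weight_pos hα0 hθ (occ_zero_pos ha n.succ_ne_zero)).le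
            (by push_cast; exact hpos.le))
          (div_nonneg (hw _) (by push_cast; exact hpos.le)), ← add_div]
        simp only [if_true] at hoccz
        have hocc' : (occ a (0 + 1) (n + 1) : ℝ) + occ a 0 (n + 1) =
          occ (fun m => a (m + 1) - 1) 0 n + 1 := by exact_mod_cast hoccz
        rcases eq_or_ne n 0 with rfl | hn
        · rw [if_pos rfl]
          simp only [occ_zero, Nat.cast_zero] at hocc'
          rw [show θ + α * (occ a 0 (0 + 1) : ℝ) + (1 - α + α * (occ a (0 + 1) (0 + 1) : ℝ)) =
            θ + ((0 : ℕ) + 1 : ℕ) by push_cast; linear_combination α * hocc', div_self,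
            ENNReal.ofReal_one]
          · rfl
          · simpa using hpos.ne'
        · rw [if_neg hn, if_pos rfl]
          congr 2
          · linear_combination α * hocc'
          · push_cast; ring
      · simp only [if_neg hz0, add_zero, zero_add] at hoccz ⊢
        rcases eq_or_ne n 0 with rfl | hn
        · rw [if_neg (by omega), if_pos rfl]
        · rw [if_neg hn, hoccz]
          by_cases hzn : z ≤ n
          · rw [if_pos (by omega), if_pos hzn]
            congr 2
            push_cast; ring
          · rw [if_neg (by omega), if_neg hzn]
  have hm : Measurable fun (x : ℕ → ℕ) n => x n - 1 := measurable_pi_lambda _ fun n =>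
    (measurable_of_countable (fun k : ℕ => k - 1)).comp (measurable_pi_apply n)
  have hm' : Measurable fun (x : ℕ → ℕ) n => x (n + 1) := by fun_prop
  have := Measure.isProbabilityMeasure_map (μ := μ) hm.aemeasurable
  have h := hv.map_tail (q := treeRule α (θ + 1)) (e0 := 0) (fun a => by simp [r])
    fun n a e => by simp [r]
  rwa [Measure.map_map hm' hm] at h

theorem HasPrediction.map_contract (hα0 : 0 ≤ α) (hα1 : α < 1) (hθ : -α < θ)
    {μ : Measure (ℕ → ℕ)}
    [IsProbabilityMeasure μ] (hμ : HasPrediction μ (treeRule α θ)) (i : ℕ) :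
    HasPrediction (μ.map (contract i)) (treeRule α (θ + i)) := by
  induction i with
  | zero =>
    have : contract 0 = id := rfl
    rw [this, Measure.map_id, Nat.cast_zero, add_zero]
    exact hμ
  | succ i ih =>
    have := Measure.isProbabilityMeasure_map (μ := μ) (measurable_contract i).aemeasurable
    have h := ih.map_contract_one hα0 hα1 (by have := i.cast_nonneg (α := ℝ); linarith)
    rw [Measure.map_map (measurable_contract 1) (measurable_contract i)] at h
    have e : contract 1 ∘ contract i = contract (i + 1) := funext fun x => contract_succ i x
    rw [e] at h
    push_cast
    rwa [← add_assoc]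

end Contract

/-! ### The subtrees of the root form a Chinese restaurant process -/

section Root

/-- The index of the child of the root above the vertex with index `n`, where index `n` stands for
vertex `n + 1` (and an invalid parent is read as the root). -/
def root (x : ℕ → ℕ) (n : ℕ) : ℕ :=
  if h : x n = 0 ∨ n < x n then n else root x (x n - 1)
termination_by n
decreasing_by omega

variable {α θ : ℝ}

theorem root_of_eq_zero {x : ℕ → ℕ} {n : ℕ} (h : x n = 0) : root x n = n := by
  rw [root, dif_pos (.inl h)]

theorem root_of_pos {x : ℕ → ℕ} {n : ℕ} (h0 : x n ≠ 0) (hn : x n ≤ n) :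
    root x n = root x (x n - 1) := by
  rw [root, dif_neg (by omega)]

theorem root_le (x : ℕ → ℕ) (n : ℕ) : root x n ≤ n := by
  induction n using Nat.strong_induction_on with
  | _ n ih =>
    rw [root]
    split_ifs with h
    · rfl
    · exact (ih _ (by omega)).trans (by omega)

theorem root_congr {x y : ℕ → ℕ} {n : ℕ} (h : ∀ m < n + 1, x m = y m) : root x n = root y n := by
  induction n using Nat.strong_induction_on with
  | _ n ih =>
    rw [root, root.eq_1 y, h n n.lt_succ_self]
    split_ifs with h'
    · rfl
    · exact ih _ (by omega) fun m hm => h m (by omega)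

/-- The partition of the vertices into the subtrees of the children of the root, coded as a
restricted growth sequence. -/
noncomputable def subtreeSeq (x : ℕ → ℕ) : ℕ → ℕ := rg (root x)

theorem subtreeSeq_congr {x y : ℕ → ℕ} {n : ℕ} (h : ∀ m < n + 1, x m = y m) :
    subtreeSeq x n = subtreeSeq y n :=
  rg_prefix _ _ _ fun m hm => root_congr fun l hl => h l (by omega)

theorem numBlocks_subtreeSeq_congr {x y : ℕ → ℕ} {n : ℕ} (h : ∀ m < n, x m = y m) :
    numBlocks (subtreeSeq x) n = numBlocks (subtreeSeq y) n :=
  numBlocks_prefix fun _ hm => subtreeSeq_congr fun l hl => h l (by omega)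

theorem restrictedGrowth_subtreeSeq (x : ℕ → ℕ) (n : ℕ) : RestrictedGrowth (subtreeSeq x) n :=
  restrictedGrowth_rg (root x) n

theorem measurable_subtreeSeq : Measurable subtreeSeq :=
  measurable_pi_lambda _ fun n => measurable_of_prefix (n + 1) fun _ _ h => subtreeSeq_congr h

theorem subtreeSeq_of_eq_zero {x : ℕ → ℕ} {n : ℕ} (h : x n = 0) :
    subtreeSeq x n = numBlocks (subtreeSeq x) n := by
  rw [subtreeSeq, numBlocks_rg]
  refine rg_of_new fun m hm => ?_
  rw [root_of_eq_zero h]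
  exact ((root_le x m).trans_lt hm).ne

theorem subtreeSeq_of_pos {x : ℕ → ℕ} {n : ℕ} (h0 : x n ≠ 0) (hn : x n ≤ n) :
    subtreeSeq x n = subtreeSeq x (x n - 1) :=
  rg_eq_of_eq (root_of_pos h0 hn)

theorem numBlocks_subtreeSeq {a : ℕ → ℕ} {n : ℕ} (ha : IsParentSeq a n) :
    numBlocks (subtreeSeq a) n = occ a 0 n := by
  induction n with
  | zero => simp
  | succ n ih =>
    have ih' := ih fun m hm => ha m (by omega)
    rw [(restrictedGrowth_subtreeSeq a (n + 1)).numBlocks_succ]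
    rw [occ_succ, ← ih']
    by_cases h : a n = 0
    · rw [subtreeSeq_of_eq_zero h, if_neg (lt_irrefl _), if_pos h]
    · have hn := ha n n.lt_succ_self
      rw [subtreeSeq_of_pos h hn, if_neg h, if_pos, add_zero]
      exact (restrictedGrowth_subtreeSeq a n).lt_numBlocks (by omega)

/-- The number of edges within the subtree of index `z` is one less than its number of
vertices. -/
theorem sum_occ_subtreeSeq {a : ℕ → ℕ} {n : ℕ} (ha : IsParentSeq a n) (z : ℕ) :
    (∑ m ∈ Finset.range n, if subtreeSeq a m = z then occ a (m + 1) n else 0) +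
      (if z < numBlocks (subtreeSeq a) n then 1 else 0) = occ (subtreeSeq a) z n := by
  induction n with
  | zero => simp
  | succ n ih =>
    have ha' : IsParentSeq a n := fun m hm => ha m (by omega)
    have ih' := ih ha'
    have hn := ha n n.lt_succ_self
    have h1 : occ a (n + 1) n = 0 := occ_eq_zero fun m hm => by
      have := ha' m hm
      omega
    have h2 : (∑ m ∈ Finset.range (n + 1),
        if subtreeSeq a m = z then occ a (m + 1) (n + 1) else 0) =
        (∑ m ∈ Finset.range n, if subtreeSeq a m = z then occ a (m + 1) n else 0) +
          ∑ m ∈ Finset.range (n + 1), if a n = m + 1 then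
            (if subtreeSeq a m = z then 1 else 0) else 0 := by
      have h3 : (∑ m ∈ Finset.range n, if subtreeSeq a m = z then occ a (m + 1) n else 0) =
          ∑ m ∈ Finset.range (n + 1), if subtreeSeq a m = z then occ a (m + 1) n else 0 := by
        rw [Finset.sum_range_succ, h1, ite_self, add_zero]
      rw [h3, ← Finset.sum_add_distrib]
      refine Finset.sum_congr rfl fun m _ => ?_
      rw [occ_succ]
      split_ifs <;> rfl
    rw [h2, (restrictedGrowth_subtreeSeq a (n + 1)).numBlocks_succ, occ_succ, ← ih']
    by_cases h : a n = 0
    · have h4 : ∑ m ∈ Finset.range (n + 1), (if a n = m + 1 then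
          (if subtreeSeq a m = z then 1 else 0) else 0) = 0 :=
        Finset.sum_eq_zero fun m _ => if_neg (by omega)
      rw [h4, subtreeSeq_of_eq_zero h, if_neg (lt_irrefl _)]
      split_ifs <;> omega
    · have h4 : ∑ m ∈ Finset.range (n + 1), (if a n = m + 1 then
          (if subtreeSeq a m = z then 1 else 0) else 0) =
            if subtreeSeq a n = z then 1 else 0 := by
        rw [Finset.sum_eq_single (a n - 1), if_pos (by omega), ← subtreeSeq_of_pos h hn]
        · intro m _ hm
          exact if_neg (by omega)
        · intro hm
          exact absurd (Finset.mem_range.2 (by omega)) hm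
      rw [h4, if_pos ((subtreeSeq_of_pos h hn).trans_lt
        ((restrictedGrowth_subtreeSeq a n).lt_numBlocks (by omega)))]
      omega

/-- The subtrees of the root of an `(α, θ)`-recursive tree form a Chinese restaurant process: the
weights of the vertices of a subtree with `k` vertices add up to `k - α`. -/
theorem HasPrediction.map_subtreeSeq (hα0 : 0 ≤ α) (hα1 : α < 1) (hθ : -α < θ)
    {μ : Measure (ℕ → ℕ)} (hμ : HasPrediction μ (treeRule α θ)) :
    HasPrediction (μ.map subtreeSeq) (crpRule α θ) := by
  refine HasPrediction.map (v := subtreeSeq) (r := crpRule α θ) hμ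
    (fun _ _ _ h => subtreeSeq_congr h) (fun _ _ _ h z => crpRule_congr h z) fun n a h0 z => ?_
  have ha := hμ.isParentSeq h0
  rcases eq_or_ne n 0 with rfl | hn
  · rw [tsum_eq_single 0]
    · rw [subtreeSeq_of_eq_zero (Function.update_self _ _ _), numBlocks_zero]
      simp [treeRule, crpRule, eq_comm]
    · intro e he
      simp [treeRule, he]
  have hpos := add_natCast_pos hα1 hθ hn
  have hw (k : ℕ) : 0 ≤ (1 - α + α * k) / (θ + n) :=
    div_nonneg (by have := mul_nonneg hα0 k.cast_nonneg; linarith) hpos.le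
  have hupd (e : ℕ) : ∀ m < n, Function.update a n e m = a m := fun m hm =>
    Function.update_of_ne hm.ne _ _
  have h00 : subtreeSeq (Function.update a n 0) n = numBlocks (subtreeSeq a) n := by
    rw [subtreeSeq_of_eq_zero (Function.update_self _ _ _)]
    exact numBlocks_subtreeSeq_congr (hupd 0)
  have hpos' (m : ℕ) (hm : m < n) :
      subtreeSeq (Function.update a n (m + 1)) n = subtreeSeq a m := by
    rw [subtreeSeq_of_pos (by simp) (by simpa using hm)]
    simp only [Function.update_self, Nat.add_sub_cancel]
    exact subtreeSeq_congr fun l hl => hupd _ l (by omega)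
  have hsum : ∑' e : ℕ, (open Classical in if subtreeSeq (Function.update a n e) n = z then
      treeRule α θ n a e else 0) =
        (if z = numBlocks (subtreeSeq a) n then ENNReal.ofReal ((θ + α * occ a 0 n) / (θ + n))
          else 0) + ENNReal.ofReal (∑ m ∈ Finset.range n, if subtreeSeq a m = z then
            (1 - α + α * occ a (m + 1) n) / (θ + n) else 0) := by
    rw [tsum_eq_sum (s := Finset.range (n + 1)), Finset.sum_range_succ', add_comm,
      ENNReal.ofReal_sum_of_nonneg]
    · congr 1
      · rw [h00, treeRule, if_neg hn, if_pos rfl]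
        simp only [eq_comm]
      · refine Finset.sum_congr rfl fun m hm => ?_
        have hm := Finset.mem_range.1 hm
        rw [hpos' m hm, treeRule, if_neg hn, if_neg m.succ_ne_zero, if_pos (Nat.succ_le_of_lt hm)]
        split_ifs
        · rfl
        · rw [ENNReal.ofReal_zero]
    · intro m _
      split_ifs
      · exact hw _
      · rfl
    · intro e he
      have h0 : treeRule α θ n a e = 0 := by
        by_contra h
        exact he (Finset.mem_range.2 (Nat.lt_succ_of_le (le_of_treeRule_ne_zero h)))
      rw [h0, ite_self]
  refine Eq.trans (tsum_congr fun e => by congr) (hsum.trans ?_)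
  have hedge := sum_occ_subtreeSeq ha z
  have hcount : (∑ m ∈ Finset.range n, if subtreeSeq a m = z then
      (1 - α + α * (occ a (m + 1) n : ℝ)) / (θ + n) else 0) =
        (occ (subtreeSeq a) z n - α * if z < numBlocks (subtreeSeq a) n then 1 else 0) /
          (θ + n) := by
    have h1 : (occ (subtreeSeq a) z n : ℝ) =
        ∑ m ∈ Finset.range n, if subtreeSeq a m = z then (1 : ℝ) else 0 := by
      rw [occ, Finset.sum_boole]
    have h2 : (∑ m ∈ Finset.range n, if subtreeSeq a m = z then (occ a (m + 1) n : ℝ) else 0) +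
        (if z < numBlocks (subtreeSeq a) n then (1 : ℝ) else 0) = occ (subtreeSeq a) z n := by
      exact_mod_cast hedge
    have h3 : ∀ m, (if subtreeSeq a m = z then
        (1 - α + α * (occ a (m + 1) n : ℝ)) / (θ + n) else 0) =
          ((1 - α) * (if subtreeSeq a m = z then 1 else 0) +
            α * if subtreeSeq a m = z then (occ a (m + 1) n : ℝ) else 0) / (θ + n) := fun m => by
      split_ifs <;> simp
    simp only [h3]
    rw [← Finset.sum_div, Finset.sum_add_distrib, ← Finset.mul_sum, ← Finset.mul_sum, ← h1]
    congr 1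
    linear_combination α * h2
  rw [hcount, crpRule, if_neg hn]
  have hrg := restrictedGrowth_subtreeSeq a n
  rcases lt_trichotomy z (numBlocks (subtreeSeq a) n) with hz | hz | hz
  · rw [if_neg hz.ne, zero_add, if_pos hz, if_pos hz, mul_one]
  · have : occ (subtreeSeq a) z n = 0 := occ_eq_zero fun m hm =>
      ((hrg.lt_numBlocks hm).trans_eq hz.symm).ne
    rw [if_pos hz, if_neg hz.not_lt, if_neg hz.not_lt, if_pos hz, this,
      numBlocks_subtreeSeq ha]
    simp
  · have : occ (subtreeSeq a) z n = 0 := occ_eq_zero fun m hm =>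
      ((hrg.lt_numBlocks hm).trans hz).ne
    rw [if_neg hz.ne', if_neg hz.not_gt, if_neg hz.not_gt, if_neg hz.ne', this]
    simp

theorem HasPrediction.map_subtreeSeq_eq (hα0 : 0 ≤ α) (hα1 : α < 1) (hθ : -α < θ)
    {μ : Measure (ℕ → ℕ)} [IsProbabilityMeasure μ] (hμ : HasPrediction μ (treeRule α θ)) :
    μ.map subtreeSeq = crpLaw α θ := by
  have := isProbabilityMeasure_crpLaw hα0 hα1 hθ
  have := Measure.isProbabilityMeasure_map (μ := μ) measurable_subtreeSeq.aemeasurable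
  exact (hμ.map_subtreeSeq hα0 hα1 hθ).eq (hasPrediction_crpLaw hα0 hα1 hθ)

end Root

/-! ### Subtrees as connected components -/

section Geometry

variable {p : ℕ → ℕ}

theorem contract_parent_le (hp : ∀ n, p (n + 1) ≤ n) (i n : ℕ) :
    contract i (fun n => p (n + 1)) n ≤ n := by
  have := hp (n + i)
  simp only [contract]
  omega

theorem root_contract_of_adj (hp : ∀ n, p (n + 1) ≤ n) {i u v : ℕ} (hu : i < u)
    (hv : i < v) (h : p v = u) :
    root (contract i fun n => p (n + 1)) (v - i - 1) =
      root (contract i fun n => p (n + 1)) (u - i - 1) := by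
  have h1 : contract i (fun n => p (n + 1)) (v - i - 1) = u - i := by
    simp only [contract]
    rw [show v - i - 1 + i + 1 = v by omega, h]
  rw [root_of_pos (by omega) (contract_parent_le hp i _), h1]

theorem reachable_root (hp : ∀ n, p (n + 1) ≤ n) (i n : ℕ) :
    sameSubtree p i (n + i + 1) (root (contract i fun n => p (n + 1)) n + i + 1) := by
  have hmem (m : ℕ) : m + i + 1 ∈ Set.Ioi i := by
    simp only [Set.mem_Ioi]
    omega
  induction n using Nat.strong_induction_on with
  | _ n ih =>
    by_cases h : contract i (fun n => p (n + 1)) n = 0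
    · rw [root_of_eq_zero h]
      exact ⟨hmem n, hmem n, .rfl⟩
    · have hle := contract_parent_le hp i n
      rw [root_of_pos h hle]
      obtain ⟨h1, h2, hr⟩ := ih (contract i (fun n => p (n + 1)) n - 1) (by omega)
      refine ⟨hmem n, h2, SimpleGraph.Reachable.trans (SimpleGraph.Adj.reachable ?_) hr⟩
      have hpn : p (n + i + 1) = contract i (fun n => p (n + 1)) n - 1 + i + 1 := by
        simp only [contract] at h ⊢
        omega
      simp only [SimpleGraph.comap_adj, treeGraph, SimpleGraph.fromRel_adj,
        Function.Embedding.subtype_apply]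
      have := hp (n + i)
      exact ⟨by omega, .inr ⟨by omega, hpn⟩⟩

/-- Two vertices are connected in the forest if and only if they lie above the same child of the
contracted root. -/
theorem sameSubtree_eq (hp : ∀ n, p (n + 1) ≤ n) (i : ℕ) :
    sameSubtree p i =
      sameLabel (Set.Ioi i) fun v => root (contract i fun n => p (n + 1)) (v - i - 1) := by
  funext u v
  refine propext ⟨?_, ?_⟩
  · rintro ⟨hu, hv, ⟨w⟩⟩
    refine ⟨hu, hv, ?_⟩
    have key : ∀ {a b : Set.Ioi i}, ((treeGraph p).induce (Set.Ioi i)).Walk a b →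
        root (contract i fun n => p (n + 1)) (a - i - 1) =
          root (contract i fun n => p (n + 1)) (b - i - 1) := by
      intro a b w
      induction w with
      | nil => rfl
      | @cons a b c hab _ ih =>
        refine Eq.trans ?_ ih
        simp only [SimpleGraph.comap_adj, treeGraph, SimpleGraph.fromRel_adj,
          Function.Embedding.subtype_apply] at hab
        rcases hab with ⟨-, ⟨-, h⟩ | ⟨-, h⟩⟩
        · exact (root_contract_of_adj hp a.2 b.2 h).symm
        · exact root_contract_of_adj hp b.2 a.2 h
    exact key w
  · rintro ⟨hu, hv, h⟩
    simp only [Set.mem_Ioi] at hu hv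
    obtain ⟨h1, h2, h3⟩ := reachable_root hp i (u - i - 1)
    obtain ⟨h4, h5, h6⟩ := reachable_root hp i (v - i - 1)
    have eu : u - i - 1 + i + 1 = u := by omega
    have ev : v - i - 1 + i + 1 = v := by omega
    simp only [eu, ev] at h1 h3 h4 h6
    refine ⟨hu, hv, h3.trans ?_⟩
    simp only at h
    simp only [h]
    exact h6.symm

/-- The blocks of the forest obtained by removing the vertices `0, …, i` are the subtrees of the
root in the tree in which these vertices are contracted into the root. -/
theorem subtreeBlock_eq (hp : ∀ n, p (n + 1) ≤ n) (i : ℕ) :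
    subtreeBlock p i = classesFrom i (subtreeSeq (contract i fun n => p (n + 1))) := by
  have h : subtreeBlock p i = block (sameSubtree p i) := rfl
  rw [h, sameSubtree_eq hp, block_sameLabel, subtreeSeq]
  congr 2
  funext n
  congr 1
  omega

theorem ncard_classesFrom_inter (i : ℕ) (D : ℕ → ℕ) (k n : ℕ) :
    (classesFrom i D k ∩ Set.Icc 1 (n + i)).ncard = occ D k n := by
  rw [occ, ← Set.ncard_coe_finset]
  have h : classesFrom i D k ∩ Set.Icc 1 (n + i) =
      (fun m => m + i + 1) '' ((Finset.range n).filter fun m => D m = k : Finset ℕ) := by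
    ext v
    simp only [classesFrom, Set.mem_inter_iff, Set.mem_ofPred_eq, Set.mem_Icc, Set.mem_image,
      Finset.coe_filter, Finset.mem_range]
    constructor
    · rintro ⟨⟨h1, h2⟩, h3, h4⟩
      exact ⟨v - i - 1, ⟨by omega, h2⟩, by omega⟩
    · rintro ⟨m, ⟨h1, h2⟩, rfl⟩
      refine ⟨⟨by omega, ?_⟩, by omega, by omega⟩
      rwa [show m + i + 1 - i - 1 = m by omega]
  rw [h, Set.ncard_image_of_injective _ fun a b hab => by simpa using hab]

theorem ncard_Ioi_inter (i n : ℕ) : (Set.Ioi i ∩ Set.Icc 1 (n + i)).ncard = n := by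
  have h : Set.Ioi i ∩ Set.Icc 1 (n + i) = Set.Ioc i (n + i) := by
    ext v
    simp only [Set.mem_inter_iff, Set.mem_Ioi, Set.mem_Icc, Set.mem_Ioc]
    omega
  rw [h, ← Finset.coe_Ioc, Set.ncard_coe_finset, Nat.card_Ioc]
  omega

theorem hasFrequency_classesFrom_iff {i : ℕ} {D : ℕ → ℕ} {k : ℕ} {f : ℝ} :
    HasFrequency (Set.Ioi i) (classesFrom i D k) f ↔ HasFreq D k f := by
  rw [HasFrequency, ← Filter.tendsto_add_atTop_iff_nat i]
  simp only [ncard_classesFrom_inter, ncard_Ioi_inter]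
  rfl

theorem HasFrequency.frequency_eq {A B : Set ℕ} {f : ℝ} (h : HasFrequency A B f) :
    frequency A B = f := by
  have h' : ∃ f, HasFrequency A B f := ⟨f, h⟩
  rw [frequency, dif_pos h']
  exact tendsto_nhds_unique h'.choose_spec h

theorem subtreeFreq_eq (hp : ∀ n, p (n + 1) ≤ n) {i : ℕ}
    (h : ProperFreq (subtreeSeq (contract i fun n => p (n + 1)))) :
    subtreeFreq p i = freq (subtreeSeq (contract i fun n => p (n + 1))) := by
  funext k
  rw [subtreeFreq, subtreeBlock_eq hp]
  exact (hasFrequency_classesFrom_iff.2 (h.1 k)).frequency_eq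

theorem measurable_classesFrom (i : ℕ) : Measurable (classesFrom i) := by
  refine measurable_pi_lambda _ fun k => measurable_set_iff.2 fun v => ?_
  refine measurableSet_setOfPred.1 ((MeasurableSet.const _).inter ?_)
  exact (measurable_pi_apply (v - i - 1) : Measurable fun D : ℕ → ℕ => D (v - i - 1))
    (measurableSet_singleton k)

theorem exchangeablePartitionLaw_eq {α θ : ℝ} (hα0 : 0 ≤ α) (hα1 : α < 1) (hθ : -α < θ) (i : ℕ) :
    exchangeablePartitionLaw α θ (Set.Ioi i) = (crpLaw α θ).map (classesFrom i) := by
  have hshift : Measurable fun (L : ℕ → ℕ) n => L (n + i + 1) := by fun_prop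
  have hcr : Measurable fun L : ℕ → ℕ => classesFrom i (rg L) :=
    (measurable_classesFrom i).comp measurable_rg
  have h1 : Measurable fun L : ℕ → ℕ => block (sameLabel (Set.Ioi i) L) := by
    simp only [block_sameLabel]
    exact hcr.comp hshift
  have h2 : ∀ y : ℕ → ℝ, y ∈ massPartitions → (Measure.infinitePi fun _ : ℕ => pickLaw y).map
      (fun L => block (sameLabel (Set.Ioi i) L)) =
        (labelKernel y).map fun L => classesFrom i (rg L) := by
    intro y hy
    have h3 : (labelKernel y).map (fun (L : ℕ → ℕ) n => L (n + i + 1)) = labelKernel y := by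
      have := Measure.map_infinitePi_infinitePi_of_inj (P := fun _ : ℕ => labelLaw y)
        (f := fun n : ℕ => n + i + 1) (fun a b hab => by simpa using hab)
      exact this
    rw [← h3, Measure.map_map hcr hshift, labelKernel_apply, pickLaw_eq_labelLaw hy]
    congr 1
    funext L
    exact block_sameLabel i L
  have h4 : Measurable fun y => (Measure.infinitePi fun _ : ℕ => pickLaw y).map
      fun L => block (sameLabel (Set.Ioi i) L) :=
    (Measure.measurable_map _ h1).comp (measurable_infinitePi_const measurable_pickLaw)
  rw [← paintboxLaw_eq_crpLaw hα0 hα1 hθ, paintboxLaw, Measure.map_map (measurable_classesFrom i)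
    measurable_rg]
  ext s hs
  rw [exchangeablePartitionLaw, Measure.bind_apply hs h4.aemeasurable,
    show (classesFrom i ∘ rg) = fun L : ℕ → ℕ => classesFrom i (rg L) from rfl,
    Measure.map_apply hcr hs, Measure.bind_apply (hcr hs) labelKernel.measurable.aemeasurable]
  refine lintegral_congr_ae ?_
  filter_upwards [ae_PD hα0 hα1 hθ] with y hy
  rw [h2 y hy, Measure.map_apply hcr hs]

end Geometry

/-! ### Interleaving two sequences -/

section Interleave

variable {E F : Type*}

theorem HasPrediction.congr [MeasurableSpace E] {μ : Measure (ℕ → E)}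
    {q q' : ℕ → (ℕ → E) → E → ENNReal} (hμ : HasPrediction μ q)
    (h : ∀ n a, μ (prefixSet a n) ≠ 0 → ∀ e, q n a e = q' n a e) : HasPrediction μ q' := by
  intro n a e
  rw [hμ]
  by_cases h0 : μ (prefixSet a n) = 0
  · rw [h0, zero_mul, zero_mul]
  · rw [h n a h0]

open Classical in
/-- The sequence whose `n`-th term is the pair of `x n` and the next unused term of `b` if the event
`N x n` occurs, and of `x n` and a default value otherwise. -/
noncomputable def interleave (N : (ℕ → E) → ℕ → Prop) (f0 : F) (x : ℕ → E) (b : ℕ → F) (n : ℕ) :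
    E × F :=
  (x n, if N x n then b (Nat.count (N x) n) else f0)

open Classical in
/-- The terms of the second sequence that have been used in an interleaved sequence. -/
noncomputable def usedTerms (N : (ℕ → E) → ℕ → Prop) (z : ℕ → E × F) (k : ℕ) : F :=
  (z (Nat.nth (N fun m => (z m).1) k)).2

open Classical in
/-- The prediction rule of an interleaved sequence. -/
noncomputable def interleaveRule (N : (ℕ → E) → ℕ → Prop) (f0 : F)
    (q : ℕ → (ℕ → E) → E → ENNReal) (ρ : ℕ → (ℕ → F) → F → ENNReal) (n : ℕ) (z : ℕ → E × F)
    (e : E × F) : ENNReal :=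
  q n (fun m => (z m).1) e.1 *
    if N (Function.update (fun m => (z m).1) n e.1) n then
      ρ (Nat.count (N fun m => (z m).1) n) (usedTerms N z) e.2
    else if e.2 = f0 then 1 else 0

theorem interleaveRule_of {N : (ℕ → E) → ℕ → Prop} {f0 : F} {q : ℕ → (ℕ → E) → E → ENNReal}
    {ρ : ℕ → (ℕ → F) → F → ENNReal} {n : ℕ} {z : ℕ → E × F} {e : E} {f : F}
    (h : N (Function.update (fun m => (z m).1) n e) n) :
    interleaveRule N f0 q ρ n z (e, f) = q n (fun m => (z m).1) e *
      ρ (open Classical in Nat.count (N fun m => (z m).1) n) (usedTerms N z) f := by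
  rw [interleaveRule, if_pos h]

theorem interleaveRule_of_not {N : (ℕ → E) → ℕ → Prop} {f0 : F} {q : ℕ → (ℕ → E) → E → ENNReal}
    {ρ : ℕ → (ℕ → F) → F → ENNReal} {n : ℕ} {z : ℕ → E × F} {e : E} {f : F}
    (h : ¬ N (Function.update (fun m => (z m).1) n e) n) :
    interleaveRule N f0 q ρ n z (e, f) = q n (fun m => (z m).1) e *
      (open Classical in if f = f0 then 1 else 0) := by
  rw [interleaveRule, if_neg h]

open Classical in
theorem usedTerms_count {N : (ℕ → E) → ℕ → Prop} {z : ℕ → E × F} {n : ℕ}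
    (h : N (fun m => (z m).1) n) :
    usedTerms N z (Nat.count (N fun m => (z m).1) n) = (z n).2 := by
  rw [usedTerms, Nat.nth_count h]

open Classical in
theorem count_congr {p q : ℕ → Prop} {n : ℕ} (h : ∀ m < n, p m ↔ q m) :
    Nat.count p n = Nat.count q n := by
  induction n with
  | zero => simp
  | succ n ih =>
    rw [Nat.count_succ, Nat.count_succ, ih fun m hm => h m (by omega)]
    simp only [h n n.lt_succ_self]

open Classical in
theorem forall_lt_count_iff {p Q : ℕ → Prop} {n : ℕ} :
    (∀ k < Nat.count p n, Q k) ↔ ∀ m < n, p m → Q (Nat.count p m) := by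
  induction n with
  | zero => simp
  | succ n ih =>
    have h1 : (∀ m < n + 1, p m → Q (Nat.count p m)) ↔
        (∀ m < n, p m → Q (Nat.count p m)) ∧ (p n → Q (Nat.count p n)) := by
      simp only [Nat.lt_succ_iff_lt_or_eq, or_imp, forall_and, forall_eq]
    rw [h1, ← ih, Nat.count_succ]
    by_cases h : p n
    · rw [if_pos h]
      simp only [Nat.lt_succ_iff_lt_or_eq, or_imp, forall_and, forall_eq, h, true_imp_iff]
    · simp [h]

open Classical in
theorem exists_lt_count_iff {p Q : ℕ → Prop} {n : ℕ} :
    (∃ k < Nat.count p n, Q k) ↔ ∃ m < n, p m ∧ Q (Nat.count p m) := by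
  have h := (forall_lt_count_iff (p := p) (Q := fun k => ¬ Q k) (n := n)).not
  push Not at h
  exact h

open Classical in
theorem occ_usedTerms [DecidableEq F] (N : (ℕ → E) → ℕ → Prop) (z : ℕ → E × F) (f : F) (n : ℕ) :
    occ (usedTerms N z) f (Nat.count (N fun m => (z m).1) n) =
      Nat.count (fun m => N (fun m => (z m).1) m ∧ (z m).2 = f) n := by
  induction n with
  | zero => simp
  | succ n ih =>
    rw [Nat.count_succ, Nat.count_succ]
    by_cases h : N (fun m => (z m).1) n
    · rw [if_pos h, occ_succ, ih, usedTerms_count h]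
      simp [h]
    · simp [h, ih]

theorem interleave_mem_prefixSet_iff {N : (ℕ → E) → ℕ → Prop}
    (hN : ∀ x y n, (∀ m < n + 1, x m = y m) → (N x n ↔ N y n)) {f0 : F} {z : ℕ → E × F} {n : ℕ}
    (hz : ∀ m < n, ¬ N (fun m => (z m).1) m → (z m).2 = f0) {x : ℕ → E} {b : ℕ → F} :
    interleave N f0 x b ∈ prefixSet z n ↔ x ∈ prefixSet (fun m => (z m).1) n ∧
      b ∈ prefixSet (usedTerms N z)
        (open Classical in Nat.count (N fun m => (z m).1) n) := by
  classical
  change (∀ m < n, _) ↔ (∀ m < n, _) ∧ ∀ m < _, _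
  rw [forall_lt_count_iff]
  have hNx (hx : ∀ m < n, x m = (z m).1) (m : ℕ) (hm : m < n) : N x m ↔ N (fun m => (z m).1) m :=
    hN _ _ m fun l hl => hx l (by omega)
  have hc (hx : ∀ m < n, x m = (z m).1) (m : ℕ) (hm : m < n) :
      Nat.count (N x) m = Nat.count (N fun m => (z m).1) m :=
    count_congr fun l hl => hNx hx l (by omega)
  constructor
  · intro h
    have hx (m : ℕ) (hm : m < n) : x m = (z m).1 := congrArg Prod.fst (h m hm)
    refine ⟨hx, fun m hm hNm => ?_⟩
    have h2 := congrArg Prod.snd (h m hm)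
    simp only [interleave] at h2
    rw [if_pos ((hNx hx m hm).2 hNm), hc hx m hm] at h2
    rw [h2, usedTerms_count hNm]
  · rintro ⟨hx, hb⟩ m hm
    refine Prod.ext (hx m hm) ?_
    simp only [interleave]
    by_cases hNm : N (fun m => (z m).1) m
    · rw [if_pos ((hNx hx m hm).2 hNm), hc hx m hm, hb m hm hNm, usedTerms_count hNm]
    · rw [if_neg (mt (hNx hx m hm).1 hNm), hz m hm hNm]

theorem measurable_interleave [MeasurableSpace E] [Countable E] [MeasurableSingletonClass E]
    [Nonempty E] [MeasurableSpace F] {N : (ℕ → E) → ℕ → Prop}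
    (hN : ∀ x y n, (∀ m < n + 1, x m = y m) → (N x n ↔ N y n)) (f0 : F) :
    Measurable fun p : (ℕ → E) × (ℕ → F) => interleave N f0 p.1 p.2 := by
  classical
  refine measurable_pi_lambda _ fun n => ?_
  have h1 : Measurable fun x : ℕ → E => Nat.count (N x) n := measurable_of_prefix n fun x y h =>
    count_congr fun m hm => hN x y m fun l hl => h l (by omega)
  have h2 : MeasurableSet {p : (ℕ → E) × (ℕ → F) | N p.1 n} :=
    measurable_fst (measurableSet_of_prefix (s := {x | N x n}) (n + 1) fun x y h => hN x y n h)
  have h3 : Measurable fun q : ℕ × (ℕ → F) => q.2 q.1 :=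
    measurable_from_prod_countable_right fun k => measurable_pi_apply k
  have h4 : Measurable fun p : (ℕ → E) × (ℕ → F) => p.2 (Nat.count (N p.1) n) :=
    h3.comp ((h1.comp measurable_fst).prodMk measurable_snd)
  exact ((measurable_pi_apply n).comp measurable_fst).prodMk (Measurable.ite h2 h4 measurable_const)

/-- Interleaving two independent sequences: given the past, the next term of the first sequence
follows its rule, and if it requires a term of the second sequence, then this term follows the
rule of the second sequence given the terms used so far. The event `N x n` may depend on the
first `n + 1` terms of `x` only. -/
theorem HasPrediction.interleave [MeasurableSpace E] [Countable E] [MeasurableSingletonClass E]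
    [Nonempty E] [MeasurableSpace F] [MeasurableSingletonClass F]
    {μ : Measure (ℕ → E)} {ν : Measure (ℕ → F)}
    [IsProbabilityMeasure μ] [IsProbabilityMeasure ν] {q : ℕ → (ℕ → E) → E → ENNReal}
    {ρ : ℕ → (ℕ → F) → F → ENNReal} (hμ : HasPrediction μ q) (hν : HasPrediction ν ρ)
    (hρ : ∀ n a b, (∀ m < n, a m = b m) → ∀ e, ρ n a e = ρ n b e)
    {N : (ℕ → E) → ℕ → Prop} (hN : ∀ x y n, (∀ m < n + 1, x m = y m) → (N x n ↔ N y n)) (f0 : F) :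
    HasPrediction ((μ.prod ν).map fun p => FragCoag.interleave N f0 p.1 p.2)
      (interleaveRule N f0 q ρ) := by
  classical
  have hm := measurable_interleave hN f0
  have hM (z : ℕ → E × F) (n : ℕ) : ((μ.prod ν).map fun p => FragCoag.interleave N f0 p.1 p.2)
      (prefixSet z n) = if ∀ m < n, ¬ N (fun m => (z m).1) m → (z m).2 = f0 then
        μ (prefixSet (fun m => (z m).1) n) *
          ν (prefixSet (usedTerms N z) (Nat.count (N fun m => (z m).1) n)) else 0 := by
    rw [Measure.map_apply hm (measurableSet_prefixSet _ _)]
    split_ifs with hz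
    · rw [← Measure.prod_prod]
      congr 1
      ext p
      exact interleave_mem_prefixSet_iff hN hz
    · push Not at hz
      obtain ⟨m, hmn, hNm, hz⟩ := hz
      convert! measure_empty (μ := μ.prod ν)
      ext p
      simp only [Set.mem_preimage, Set.mem_empty_iff_false, iff_false]
      intro hp
      have h1 (l : ℕ) (hl : l < n) : p.1 l = (z l).1 := congrArg Prod.fst (hp l hl)
      have h2 := congrArg Prod.snd (hp m hmn)
      simp only [FragCoag.interleave] at h2
      rw [if_neg fun h => hNm ((hN _ _ m fun l hl => h1 l (by omega)).1 h)] at h2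
      exact hz h2.symm
  rintro n z ⟨e, f⟩
  rw [prefixSet_update, hM, hM]
  set z' := Function.update z n (e, f) with hz'
  set x : ℕ → E := fun m => (z m).1 with hx
  have hx' : (fun m => (z' m).1) = Function.update x n e := by
    funext m
    rcases eq_or_ne m n with rfl | hmn
    · simp [hz']
    · simp [hz', hmn, hx]
  have hxn (m : ℕ) (hm : m < n) : Function.update x n e m = x m := Function.update_of_ne hm.ne _ _
  have hNn (m : ℕ) (hm : m < n) : N (Function.update x n e) m ↔ N x m :=
    hN _ _ m fun l hl => hxn l (by omega)
  have hzm (m : ℕ) (hm : m < n) : z' m = z m := Function.update_of_ne hm.ne _ _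
  have hzn : z' n = (e, f) := Function.update_self _ _ _
  have hcount : Nat.count (N (Function.update x n e)) n = Nat.count (N x) n := count_congr hNn
  rw [hx']
  have hcond : (∀ m < n + 1, ¬ N (Function.update x n e) m → (z' m).2 = f0) ↔
      (∀ m < n, ¬ N x m → (z m).2 = f0) ∧ (¬ N (Function.update x n e) n → f = f0) := by
    simp only [Nat.lt_succ_iff_lt_or_eq, or_imp, forall_and, forall_eq, hzn]
    refine and_congr_left fun _ => forall₂_congr fun m hm => ?_
    rw [hNn m hm, hzm m hm]
  by_cases hc : ∀ m < n, ¬ N x m → (z m).2 = f0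
  swap
  · rw [if_neg (fun h => hc (hcond.1 h).1), if_neg hc, zero_mul]
  rw [if_pos hc]
  have hμ' : μ (prefixSet (Function.update x n e) (n + 1)) = μ (prefixSet x n) * q n x e := by
    rw [← prefixSet_update, hμ]
  have hused (k : ℕ) (hk : k < Nat.count (N x) n) : usedTerms N z' k = usedTerms N z k := by
    have key := (forall_lt_count_iff (p := N x)
      (Q := fun k => usedTerms N z' k = usedTerms N z k) (n := n)).2 fun m hm hNm => ?_
    · exact key k hk
    · rw [usedTerms, usedTerms, hx', Nat.nth_count hNm,
        ← count_congr (p := N (Function.update x n e)) fun l hl => hNn l (by omega),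
        Nat.nth_count ((hNn m hm).2 hNm), hzm m hm]
  simp only [interleaveRule]
  by_cases hNe : N (Function.update x n e) n
  · rw [if_pos (hcond.2 ⟨hc, fun h => absurd hNe h⟩), if_pos hNe, hμ', Nat.count_succ,
      if_pos hNe, hcount, prefixSet_succ]
    have h1 : usedTerms N z' (Nat.count (N x) n) = f := by
      rw [usedTerms, hx', ← hcount, Nat.nth_count hNe, hzn]
    rw [hν, h1, prefixSet_congr hused, hρ _ _ _ hused]
    ring
  · rw [if_neg hNe]
    by_cases hf : f = f0
    · rw [if_pos (hcond.2 ⟨hc, fun _ => hf⟩), if_pos hf, mul_one, hμ', Nat.count_succ, if_neg hNe,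
        hcount, add_zero, prefixSet_congr hused]
      ring
    · rw [if_neg fun h => hf ((hcond.1 h).2 hNe), if_neg hf, mul_zero, mul_zero]

end Interleave

/-! ### The random set of coagulating blocks -/

section CoagSet

variable {α θ : ℝ}

open Classical in
/-- The indicator sequence of a set. -/
noncomputable def memSeq (S : Set ℕ) (n : ℕ) : Bool := decide (n ∈ S)

theorem measurable_memSeq : Measurable memSeq := by
  refine measurable_pi_lambda _ fun n => ?_
  refine (measurable_of_countable (fun p : Prop => (open Classical in decide p))).comp
    (measurable_set_mem n)

/-- The prediction rule of the indicator sequence of the set of coagulating blocks. -/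
noncomputable def urnRule (α θ : ℝ) (n : ℕ) (b : ℕ → Bool) (f : Bool) : ENNReal :=
  ENNReal.ofReal ((if f then 1 - α + α * occ b true n else θ + α + α * occ b false n) /
    (θ + 1 + α * n))

theorem urnRule_congr {n : ℕ} {b c : ℕ → Bool} (h : ∀ m < n, b m = c m) (f : Bool) :
    urnRule α θ n b f = urnRule α θ n c f := by
  have h' (z : Bool) : occ b z n = occ c z n := occ_congr fun m hm => by rw [h m hm]
  simp only [urnRule, h']

theorem occ_true_add_occ_false (b : ℕ → Bool) (n : ℕ) : occ b true n + occ b false n = n := by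
  induction n with
  | zero => simp
  | succ n ih =>
    rw [occ_succ, occ_succ]
    rcases b n <;> simp <;> omega

theorem prod_range_eq_pow_occ {M : Type*} [CommMonoid M] (b : ℕ → Bool) (u v : M) (n : ℕ) :
    ∏ m ∈ Finset.range n, (if b m then u else v) = u ^ occ b true n * v ^ occ b false n := by
  induction n with
  | zero => simp
  | succ n ih =>
    rw [Finset.prod_range_succ, ih, occ_succ, occ_succ]
    rcases b n
    · simp [pow_succ, mul_assoc]
    · simp [pow_succ, mul_right_comm]

theorem setBernoulli_prefixSet (p : unitInterval) (b : ℕ → Bool) (n : ℕ) :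
    (setBernoulli Set.univ p : Measure (Set ℕ)) (memSeq ⁻¹' prefixSet b n) =
      ENNReal.ofReal p ^ occ b true n * ENNReal.ofReal (1 - p) ^ occ b false n := by
  have hm : Measurable fun p : ℕ → Prop => {i | p i} :=
    (MeasurableEquiv.setOfPred (α := ℕ)).measurable
  rw [setBernoulli_eq_map, Measure.map_apply hm
    (measurable_memSeq (measurableSet_prefixSet _ _))]
  have hset : (fun p : ℕ → Prop => {i | p i}) ⁻¹' (memSeq ⁻¹' prefixSet b n) =
      Set.pi (Finset.range n) fun m => {(b m = true : Prop)} := by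
    ext x
    simp only [Set.mem_preimage, prefixSet, Set.mem_ofPred_eq, memSeq, Set.mem_pi,
      Finset.coe_range, Set.mem_Iio, Set.mem_singleton_iff]
    refine forall₂_congr fun m _ => ?_
    by_cases hx : x m <;> cases b m <;> simp [hx]
  rw [hset, Measure.infinitePi_pi _ fun m _ => measurableSet_singleton _,
    ← prod_range_eq_pow_occ]
  refine Finset.prod_congr rfl fun m _ => ?_
  change (unitInterval.toNNReal p : ENNReal) * Measure.dirac (m ∈ Set.univ) {(b m = true : Prop)} +
    (unitInterval.toNNReal (unitInterval.symm p) : ENNReal) *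
      Measure.dirac False {(b m = true : Prop)} = _
  have h1 : (unitInterval.toNNReal p : ENNReal) = ENNReal.ofReal p :=
    (ENNReal.ofReal_eq_coe_nnreal p.2.1).symm
  have h2 : (unitInterval.toNNReal (unitInterval.symm p) : ENNReal) = ENNReal.ofReal (1 - p) :=
    (ENNReal.ofReal_eq_coe_nnreal (unitInterval.symm p).2.1).symm
  rw [h1, h2, Measure.dirac_apply, Measure.dirac_apply]
  cases b m <;> simp

theorem ae_proportionLaw (hα0 : 0 ≤ α) (hα1 : α < 1) (hθ : -α < θ) :
    ∀ᵐ b ∂proportionLaw α θ, b ∈ Set.Icc (0 : ℝ) 1 := by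
  rw [proportionLaw]
  split_ifs with h
  · subst h
    have hθ' : 0 < θ := by linarith
    refine (ae_dirac_iff (p := fun b => b ∈ Set.Icc (0 : ℝ) 1) measurableSet_Icc).2 ?_
    exact ⟨by positivity, by rw [div_le_one (by linarith)]; linarith⟩
  · filter_upwards [ae_betaMeasure_mem_Ioo ((1 - α) / α) ((θ + α) / α)] with b hb
    exact ⟨hb.1.le, hb.2.le⟩

theorem coagSetLaw_prefixSet (hα0 : 0 ≤ α) (hα1 : α < 1) (hθ : -α < θ) (b : ℕ → Bool) (n : ℕ) :
    (coagSetLaw α θ).map memSeq (prefixSet b n) =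
      ∫⁻ p, ENNReal.ofReal p ^ occ b true n * ENNReal.ofReal (1 - p) ^ occ b false n
        ∂proportionLaw α θ := by
  have hm : Measurable fun b : ℝ =>
      (setBernoulli Set.univ (Set.projIcc 0 1 zero_le_one b) : Measure (Set ℕ)) :=
    measurable_setBernoulli.comp continuous_projIcc.measurable
  have hs := measurable_memSeq (measurableSet_prefixSet b n)
  rw [Measure.map_apply measurable_memSeq (measurableSet_prefixSet _ _), coagSetLaw,
    Measure.bind_apply hs hm.aemeasurable]
  refine lintegral_congr_ae ?_
  filter_upwards [ae_proportionLaw hα0 hα1 hθ] with p hp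
  rw [setBernoulli_prefixSet, Set.projIcc_of_mem zero_le_one hp]

/-- The indicator sequence of the set of coagulating blocks is a Pólya urn. -/
theorem hasPrediction_memSeq (hα0 : 0 ≤ α) (hα1 : α < 1) (hθ : -α < θ) :
    HasPrediction ((coagSetLaw α θ).map memSeq) (urnRule α θ) := by
  intro n b f
  rw [prefixSet_update, coagSetLaw_prefixSet hα0 hα1 hθ, coagSetLaw_prefixSet hα0 hα1 hθ]
  have hocc (z : Bool) :
      occ (Function.update b n f) z (n + 1) = occ b z n + if f = z then 1 else 0 := by
    rw [occ_succ, Function.update_self]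
    congr 1
    exact occ_congr fun m hm => by rw [Function.update_of_ne hm.ne]
  have hn := occ_true_add_occ_false b n
  have hn' : (occ b true n : ℝ) + occ b false n = n := by exact_mod_cast hn
  rw [hocc, hocc, urnRule, proportionLaw]
  set s := occ b true n
  set t := occ b false n
  by_cases h : α = 0
  · subst h
    have hθ' : 0 < θ := by linarith
    rw [if_pos rfl, lintegral_dirac, lintegral_dirac]
    have h1 : (θ + 0 + 0 * (t : ℝ)) / (θ + 1 + 0 * n) = 1 - 1 / (θ + 1) := by field_simp; ring
    have h2 : (1 - 0 + 0 * (s : ℝ)) / (θ + 1 + 0 * n) = 1 / (θ + 1) := by field_simp; ring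
    rcases f
    · rw [if_neg Bool.false_ne_true, if_neg Bool.false_ne_true, if_pos rfl, h1, pow_succ, add_zero,
        mul_assoc]
    · rw [if_pos rfl, if_pos rfl, if_neg (by simp), h2, pow_succ, add_zero, mul_right_comm]
  · have hα : 0 < α := lt_of_le_of_ne hα0 (Ne.symm h)
    have ha : 0 < (1 - α) / α := div_pos (by linarith) hα
    have hc : 0 < (θ + α) / α := div_pos (by linarith) hα
    have hac := add_pos ha hc
    have hpos (u w : ℕ) : 0 ≤ rising ((1 - α) / α) u * rising ((θ + α) / α) w /
        rising ((1 - α) / α + (θ + α) / α) (u + w) :=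
      div_nonneg (mul_nonneg (rising_pos ha u).le (rising_pos hc w).le) (rising_pos hac _).le
    have hr := (rising_pos hac (s + t)).ne'
    have hden : (1 - α) / α + (θ + α) / α + (s + t : ℕ) = (θ + 1 + α * n) / α := by
      rw [hn]
      field_simp
      ring
    have hn0 : 0 < θ + 1 + α * n := by
      have := mul_nonneg hα0 (n.cast_nonneg (α := ℝ))
      linarith
    have h1 : (1 - α) / α + s = (1 - α + α * s) / α := by field_simp
    have h2 : (θ + α) / α + t = (θ + α + α * t) / α := by field_simp
    rw [if_neg h, lintegral_betaMeasure ha hc, lintegral_betaMeasure ha hc,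
      ← ENNReal.ofReal_mul (hpos _ _)]
    congr 1
    rcases f
    · rw [if_neg Bool.false_ne_true, if_neg Bool.false_ne_true, if_pos rfl, add_zero, ← add_assoc,
        rising_succ, rising_succ, h2, hden]
      field_simp
    · rw [if_pos rfl, if_pos rfl, if_neg (by simp), add_zero, add_right_comm, rising_succ,
        rising_succ, h1, hden]
      field_simp

end CoagSet

/-! ### Splitting the root: the reversed transition -/

section Expand

variable {α θ : ℝ}

/-- The sequence `x` preceded by the term `e0`. -/
def consSeq {E : Type*} (e0 : E) (x : ℕ → E) : ℕ → E
  | 0 => e0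
  | n + 1 => x n

theorem measurable_consSeq {E : Type*} [MeasurableSpace E] (e0 : E) :
    Measurable (consSeq e0 : (ℕ → E) → ℕ → E) := by
  refine measurable_pi_lambda _ fun n => ?_
  rcases n with _ | n
  · exact measurable_const
  · exact measurable_pi_apply n

theorem HasPrediction.map_consSeq {E : Type*} [MeasurableSpace E] [MeasurableSingletonClass E]
    {μ : Measure (ℕ → E)} [IsProbabilityMeasure μ] {q r : ℕ → (ℕ → E) → E → ENNReal} {e0 : E}
    (hμ : HasPrediction μ q) (h0 : ∀ a e, r 0 a e = (open Classical in if e = e0 then 1 else 0))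
    (hr : ∀ n a e, a 0 = e0 → r (n + 1) a e = q n (fun m => a (m + 1)) e) :
    HasPrediction (μ.map (consSeq e0)) r := by
  classical
  have hm : Measurable (consSeq e0 : (ℕ → E) → ℕ → E) := measurable_consSeq e0
  have hpre (a : ℕ → E) (n : ℕ) : μ.map (consSeq e0) (prefixSet a (n + 1)) =
      if a 0 = e0 then μ (prefixSet (fun m => a (m + 1)) n) else 0 := by
    rw [Measure.map_apply hm (measurableSet_prefixSet _ _)]
    split_ifs with ha
    · congr 1
      ext x
      constructor
      · exact fun h m hm => h (m + 1) (by omega)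
      · rintro h (_ | m) hm
        · exact ha.symm
        · exact h m (by omega)
    · convert! measure_empty (μ := μ)
      ext x
      simp only [Set.mem_preimage, Set.mem_empty_iff_false, iff_false]
      exact fun h => ha (h 0 n.succ_pos).symm
  intro n a e
  rw [prefixSet_update, hpre]
  rcases n with _ | n
  · have h1 : μ.map (consSeq e0) (prefixSet a 0) = 1 := by
      have := Measure.isProbabilityMeasure_map (μ := μ) hm.aemeasurable
      simp [prefixSet]
    rw [h1, h0, one_mul, Function.update_self]
    split_ifs <;> simp [prefixSet]
  · rw [hpre, Function.update_of_ne n.succ_ne_zero.symm]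
    split_ifs with ha
    · rw [hr n a e ha, ← hμ, prefixSet_update]
      congr 2
      funext m
      rcases eq_or_ne m n with rfl | hmn
      · simp
      · simp [hmn]
    · rw [zero_mul]

/-- The parent of a vertex after the root has been split in two vertices `0` and `1`, given its
parent before and the choice between the two vertices for a former child of the root. -/
def splitParent : ℕ × Bool → ℕ
  | (0, true) => 1
  | (0, false) => 0
  | (k + 1, _) => k + 2

/-- The `n`-th term of `x` is zero. -/
def ZeroAt (x : ℕ → ℕ) (n : ℕ) : Prop := x n = 0

theorem zeroAt_congr (x y : ℕ → ℕ) (n : ℕ) (h : ∀ m < n + 1, x m = y m) :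
    ZeroAt x n ↔ ZeroAt y n := by
  rw [ZeroAt, ZeroAt, h n n.lt_succ_self]

theorem count_zeroAt (x : ℕ → ℕ) (n : ℕ) :
    (open Classical in Nat.count (ZeroAt x) n) = occ x 0 n := by
  induction n with
  | zero => simp
  | succ n ih =>
    rw [Nat.count_succ, ih, occ_succ]
    congr

/-- The tree obtained by splitting the root of `x` in two vertices `0` and `1`, the latter a child
of the former; the `k`-th child of the root is attached to vertex `1` if `k ∈ S`, and to the root
otherwise. -/
noncomputable def splitRoot (x : ℕ → ℕ) (S : Set ℕ) : ℕ → ℕ :=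
  consSeq 0 fun n => splitParent (interleave ZeroAt false x (memSeq S) n)

theorem measurable_splitParent : Measurable fun (z : ℕ → ℕ × Bool) n => splitParent (z n) :=
  measurable_pi_lambda _ fun n => (measurable_of_countable splitParent).comp (measurable_pi_apply n)

theorem measurable_interleave_memSeq :
    Measurable fun p : (ℕ → ℕ) × Set ℕ => (p.1, memSeq p.2) :=
  measurable_fst.prodMk (measurable_memSeq.comp measurable_snd)

theorem measurable_splitRoot : Measurable fun p : (ℕ → ℕ) × Set ℕ => splitRoot p.1 p.2 :=
  (measurable_consSeq 0).comp (measurable_splitParent.comp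
    ((measurable_interleave zeroAt_congr false).comp measurable_interleave_memSeq))

theorem contract_splitRoot (x : ℕ → ℕ) (S : Set ℕ) : contract 1 (splitRoot x S) = x := by
  funext n
  have h : ∀ k b, splitParent (k, b) - 1 = k := by rintro (_ | k) (_ | _) <;> rfl
  exact h _ _

/-- Splitting the root of an `(α, θ + 1)`-recursive tree along an independent random set with the
law of the coagulating set yields an `(α, θ)`-recursive tree. -/
theorem HasPrediction.map_splitRoot (hα0 : 0 ≤ α) (hα1 : α < 1) (hθ : -α < θ)
    {μ : Measure (ℕ → ℕ)} [IsProbabilityMeasure μ] (hμ : HasPrediction μ (treeRule α (θ + 1))) :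
    HasPrediction ((μ.prod (coagSetLaw α θ)).map fun p => splitRoot p.1 p.2) (treeRule α θ) := by
  have := isProbabilityMeasure_coagSetLaw hα0 hα1 hθ
  have hβ := Measure.isProbabilityMeasure_map (μ := coagSetLaw α θ) measurable_memSeq.aemeasurable
  have hζ := hμ.interleave (hasPrediction_memSeq hα0 hα1 hθ) (fun n a b h e => urnRule_congr h e)
    zeroAt_congr false
  have hmi := measurable_interleave zeroAt_congr false
  set ζ := (μ.prod ((coagSetLaw α θ).map memSeq)).map
    fun p => FragCoag.interleave ZeroAt false p.1 p.2 with hζdef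
  have hζp : IsProbabilityMeasure ζ := Measure.isProbabilityMeasure_map hmi.aemeasurable
  have hmap : (μ.prod (coagSetLaw α θ)).map (fun p => splitRoot p.1 p.2) =
      (ζ.map fun z n => splitParent (z n)).map (consSeq 0) := by
    have h1 : μ.prod ((coagSetLaw α θ).map memSeq) =
        (μ.prod (coagSetLaw α θ)).map fun p => (p.1, memSeq p.2) := by
      have := Measure.map_prod_map μ (coagSetLaw α θ) measurable_id measurable_memSeq
      rwa [Measure.map_id] at this
    rw [hζdef, h1, Measure.map_map hmi measurable_interleave_memSeq,
      Measure.map_map measurable_splitParent (hmi.comp measurable_interleave_memSeq),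
      Measure.map_map (measurable_consSeq 0)
        (measurable_splitParent.comp (hmi.comp measurable_interleave_memSeq))]
    rfl
  rw [hmap]
  let r : ℕ → (ℕ → ℕ) → ℕ → ENNReal := fun n a e => treeRule α θ (n + 1) (consSeq 0 a) e
  have hsp : HasPrediction (ζ.map fun z n => splitParent (z n)) r := by
    refine HasPrediction.map (v := fun z n => splitParent (z n)) (r := r) hζ
      (fun x y n h => by simp only [h n n.lt_succ_self]) (fun n b b' h z => ?_) fun n a h0 z => ?_
    · refine treeRule_congr (fun m hm => ?_) z
      rcases m with _ | m
      · rfl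
      · exact h m (by omega)
    have hfac := hζ.prefixSet_succ_ne_zero h0
    set x : ℕ → ℕ := fun m => (a m).1 with hx
    have hpar : IsParentSeq x n := fun m hm =>
      le_of_treeRule_ne_zero (left_ne_zero_of_mul (hfac m hm))
    -- the choice between the two vertices is the default unless the parent is the root
    have hcons (m : ℕ) (hm : m < n) (h : x m ≠ 0) : (a m).2 = false := by
      have h1 := hfac m hm
      have h2 : a m = (x m, (a m).2) := rfl
      rw [h2, interleaveRule_of_not (by simpa [ZeroAt] using h)] at h1
      by_contra hf
      exact right_ne_zero_of_mul h1 (if_neg hf)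
    simp only [Function.update_self]
    set X : ℕ → ℕ := consSeq 0 fun m => splitParent (a m) with hX
    -- the first term of `X` is the parent `0` of the new vertex `1`
    have hoX (e m : ℕ) : occ X e (m + 1) = (if 0 = e then 1 else 0) +
        occ (fun m => splitParent (a m)) e m := by
      induction m with
      | zero =>
        rw [occ_succ, occ_zero, occ_zero, zero_add, add_zero]
        rfl
      | succ m ih => rw [occ_succ, ih, occ_succ _ e m, add_assoc]; rfl
    set b := usedTerms ZeroAt a with hb
    have hbits (f : Bool) : occ b f (occ x 0 n) =
        occ (fun m => splitParent (a m)) (if f then 1 else 0) n := by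
      clear hfac h0 hpar
      induction n with
      | zero => simp
      | succ n ih =>
        have ih' := ih fun m hm => hcons m (by omega)
        rw [occ_succ x, occ_succ, ← ih']
        by_cases h : x n = 0
        · rw [if_pos h, occ_succ]
          congr 1
          have h2 : b (occ x 0 n) = (a n).2 := by
            rw [← count_zeroAt]
            exact usedTerms_count (N := ZeroAt) (z := a) h
          have h3 : a n = (0, (a n).2) := Prod.ext h rfl
          rw [h2, h3]
          cases (a n).2 <;> cases f <;> simp [splitParent]
        · rw [if_neg h, add_zero]
          obtain ⟨k, hk⟩ := Nat.exists_eq_succ_of_ne_zero h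
          have h3 : a n = (k + 1, (a n).2) := Prod.ext hk rfl
          rw [h3]
          cases f <;> simp [splitParent]
    have hocck (k : ℕ) : occ (fun m => splitParent (a m)) (k + 2) n = occ x (k + 1) n := by
      refine occ_congr fun m _ => ?_
      have h3 : a m = (x m, (a m).2) := rfl
      rw [h3]
      rcases x m with _ | j
      · cases (a m).2 <;> simp [splitParent]
      · simp [splitParent]
    -- the weight of the root before splitting cancels against the denominator of the urn
    have hrule (f : Bool) : interleaveRule ZeroAt false (treeRule α (θ + 1))
        (urnRule α θ) n a (0, f) = ENNReal.ofReal ((if f then 1 - α + α * occ X 1 (n + 1)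
          else θ + α * occ X 0 (n + 1)) / (θ + (n + 1))) := by
      have h1 : treeRule α (θ + 1) n x 0 =
          ENNReal.ofReal ((θ + 1 + α * occ x 0 n) / (θ + 1 + n)) := by
        rw [treeRule]
        rcases eq_or_ne n 0 with rfl | hn
        · rw [if_pos rfl, if_pos rfl, occ_zero, Nat.cast_zero, mul_zero, add_zero,
            div_self (by linarith), ENNReal.ofReal_one]
        · rw [if_neg hn, if_pos rfl]
      have hpos : 0 < θ + 1 + α * occ x 0 n := by
        have := mul_nonneg hα0 ((occ x 0 n).cast_nonneg (α := ℝ))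
        linarith
      have hpos' : 0 < θ + 1 + n := by
        have := n.cast_nonneg (α := ℝ)
        linarith
      rw [interleaveRule_of (Function.update_self n 0 x), ← hx, h1, urnRule, ← hb, count_zeroAt,
        hbits, hbits, ← ENNReal.ofReal_mul (by positivity)]
      rw [mul_comm, div_mul_div_cancel₀ hpos.ne']
      congr 1
      rw [hoX, hoX]
      cases f
      · simp only [Bool.false_eq_true, if_false, if_true]
        push_cast
        congr 1 <;> ring
      · simp only [if_true]
        rw [if_neg (by omega)]
        push_cast
        congr 1 <;> ring
    have hrulek (k : ℕ) (f : Bool) : interleaveRule ZeroAt false (treeRule α (θ + 1))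
        (urnRule α θ) n a (k + 1, f) = if f then 0 else treeRule α θ (n + 1) X (k + 2) := by
      rw [interleaveRule_of_not (by simp [ZeroAt])]
      cases f
      · rw [if_pos rfl, mul_one, ← hx, treeRule, treeRule, hoX (k + 2), hocck,
          if_neg (show ¬ 0 = k + 2 by omega), zero_add]
        rcases eq_or_ne n 0 with rfl | hn
        · simp
        · simp only [if_neg hn, if_neg k.succ_ne_zero, if_neg n.succ_ne_zero,
            if_neg (k + 1).succ_ne_zero]
          simp only [Bool.false_eq_true, if_false]
          have hc : θ + 1 + n = θ + (n + 1 : ℕ) := by push_cast; ring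
          rw [hc]
          by_cases hk : k + 1 ≤ n
          · rw [if_pos hk, if_pos (by omega)]
          · rw [if_neg hk, if_neg (by omega)]
      · simp
    rcases z with _ | _ | k
    · rw [tsum_eq_single (0, false)]
      · rw [if_pos (show splitParent (0, false) = 0 from rfl), hrule]
        simp [r, treeRule, hX]
      · rintro ⟨_ | e, _ | _⟩ he <;> simp_all [splitParent]
    · rw [tsum_eq_single (0, true)]
      · rw [if_pos (show splitParent (0, true) = 0 + 1 from rfl), hrule]
        simp [r, treeRule, hX]
      · rintro ⟨_ | e, _ | _⟩ he <;> simp_all [splitParent]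
    · rw [tsum_eq_single (k + 1, false)]
      · rw [if_pos (show splitParent (k + 1, false) = k + 1 + 1 from rfl), hrulek]
        rfl
      · rintro ⟨_ | e, _ | _⟩ he
        · simp [splitParent]
        · simp [splitParent]
        · rw [if_neg]
          simpa [splitParent] using he
        · rw [hrulek]
          simp
  have := Measure.isProbabilityMeasure_map (μ := ζ) measurable_splitParent.aemeasurable
  refine hsp.map_consSeq (fun a e => ?_) fun n a e ha => ?_
  · simp [treeRule]
  · refine treeRule_congr (fun m _ => ?_) e
    rcases m with _ | m
    · exact ha
    · rfl

end Expand

/-! ### The coagulation kernel -/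

section Coalesce

variable {α θ : ℝ}

open Classical in
/-- The relabelling that merges all labels in `S`. -/
noncomputable def lumpLabel (S : Set ℕ) (k : ℕ) : Option ℕ := if k ∈ S then none else some k

theorem lumpLabel_eq_none {S : Set ℕ} {k : ℕ} : lumpLabel S k = none ↔ k ∈ S := by
  rw [lumpLabel]
  split_ifs with h <;> simp [h]

theorem lumpLabel_eq_some {S : Set ℕ} {k l : ℕ} : lumpLabel S k = some l ↔ k ∉ S ∧ k = l := by
  rw [lumpLabel]
  split_ifs with h <;> simp [h]

theorem ProperFreq.hasFreq_lumpLabel {D : ℕ → ℕ} (hD : ProperFreq D) (S : Set ℕ) (z : Option ℕ) :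
    HasFreq (fun n => lumpLabel S (D n)) z
      (open Classical in z.elim (∑' k, if k ∈ S then freq D k else 0)
        fun k => if k ∈ S then 0 else freq D k) := by
  classical
  have h := hD.hasFreq_comp (lumpLabel S) z
  rw [tsum_subtype] at h
  convert! h using 1
  rcases z with _ | l
  · simp only [Option.elim_none]
    refine tsum_congr fun k => ?_
    rw [Set.indicator_apply]
    simp only [Set.mem_preimage, Set.mem_singleton_iff, lumpLabel_eq_none]
  · simp only [Option.elim_some]
    rw [tsum_eq_single l]
    · rw [Set.indicator_apply]
      simp only [Set.mem_preimage, Set.mem_singleton_iff, lumpLabel_eq_some, and_true]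
      split_ifs <;> rfl
    · intro k hk
      rw [Set.indicator_of_notMem]
      simp only [Set.mem_preimage, Set.mem_singleton_iff, lumpLabel_eq_some]
      exact fun h => hk h.2

/-- The ranked frequencies of a partition obtained by merging blocks. -/
theorem ProperFreq.rank_freq_lumpLabel {D : ℕ → ℕ} (hD : ProperFreq D) (S : Set ℕ) :
    rank (freq fun n => lumpLabel S (D n)) = coalesce (freq D) S := by
  rw [coalesce]
  congr 1
  funext z
  rw [(hD.hasFreq_lumpLabel S z).freq_eq]

/-- After the root has been split along `S`, the children of the root in `S` are merged with
vertex `1`, whose label is `none`, into a single subtree. -/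
theorem root_splitRoot {x : ℕ → ℕ} (hx : ∀ n, x n ≤ n) (S : Set ℕ) (n : ℕ) :
    root (splitRoot x S) n =
      sInf {m | consSeq none (fun n => lumpLabel S (subtreeSeq x n)) m =
        consSeq none (fun n => lumpLabel S (subtreeSeq x n)) n} := by
  classical
  set o := consSeq none (fun n => lumpLabel S (subtreeSeq x n)) with ho
  have hfirst (n : ℕ) (h : ∀ m < n, o m ≠ o n) : sInf {m | o m = o n} = n := by
    refine le_antisymm (Nat.sInf_le rfl) ?_
    by_contra! hlt
    exact h _ hlt (Nat.sInf_mem (s := {m | o m = o n}) ⟨n, rfl⟩)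
  have hfirst' {m n : ℕ} (h : o m = o n) : sInf {l | o l = o m} = sInf {l | o l = o n} := by rw [h]
  have h0 : root (splitRoot x S) 0 = 0 := root_of_eq_zero rfl
  have h0' : sInf {m | o m = o 0} = 0 := hfirst 0 fun m hm => absurd hm m.not_lt_zero
  induction n using Nat.strong_induction_on with
  | _ n ih =>
    rcases n with _ | j
    · rw [h0, h0']
    have hsplit : splitRoot x S (j + 1) =
      splitParent (interleave ZeroAt false x (memSeq S) j) := rfl
    have hoj : o (j + 1) = lumpLabel S (subtreeSeq x j) := rfl
    rcases hxj : x j with _ | k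
    · have hnew : subtreeSeq x j = numBlocks (subtreeSeq x) j := subtreeSeq_of_eq_zero hxj
      have hocc : numBlocks (subtreeSeq x) j = occ x 0 j :=
        numBlocks_subtreeSeq fun m _ => hx m
      have hint : interleave ZeroAt false x (memSeq S) j =
          (0, memSeq S (subtreeSeq x j)) := by
        rw [interleave, if_pos (show ZeroAt x j from hxj), count_zeroAt, ← hocc, ← hnew, hxj]
      rw [hint] at hsplit
      by_cases hS : subtreeSeq x j ∈ S
      · have hm : memSeq S (subtreeSeq x j) = true := decide_eq_true hS
        rw [hm] at hsplit
        have hn : splitRoot x S (j + 1) = 1 := hsplit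
        rw [root_of_pos (by omega) (by omega), hn, Nat.sub_self, h0, ← hfirst' (m := 0), h0']
        rw [hoj, lumpLabel_eq_none.2 hS]
        rfl
      · have hm : memSeq S (subtreeSeq x j) = false := decide_eq_false hS
        rw [hm] at hsplit
        rw [root_of_eq_zero hsplit, hfirst]
        intro m hm
        have hoj' : o (j + 1) = some (subtreeSeq x j) := by
          rw [hoj]
          exact lumpLabel_eq_some.2 ⟨hS, rfl⟩
        rw [hoj']
        rcases m with _ | m
        · exact (Option.some_ne_none _).symm
        · change lumpLabel S (subtreeSeq x m) ≠ _
          rw [Ne, lumpLabel_eq_some, not_and]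
          intro _ h
          have := (restrictedGrowth_subtreeSeq x j).lt_numBlocks (show m < j by omega)
          omega
    · have hint : interleave ZeroAt false x (memSeq S) j = (k + 1, false) := by
        rw [interleave, if_neg (by rw [ZeroAt]; omega), hxj]
      rw [hint] at hsplit
      have hn : splitRoot x S (j + 1) = k + 2 := hsplit
      have hk := hx j
      rw [root_of_pos (by omega) (by omega), hn, show k + 2 - 1 = k + 1 by omega,
        ih (k + 1) (by omega)]
      refine hfirst' ?_
      rw [hoj, subtreeSeq_of_pos (by omega) (hx j), hxj]
      rfl

theorem root_splitRoot_eq_iff {x : ℕ → ℕ} (hx : ∀ n, x n ≤ n) (S : Set ℕ) (l m : ℕ) :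
    subtreeSeq (splitRoot x S) l = subtreeSeq (splitRoot x S) m ↔
      consSeq none (fun n => lumpLabel S (subtreeSeq x n)) l =
        consSeq none (fun n => lumpLabel S (subtreeSeq x n)) m := by
  rw [subtreeSeq, rg_eq_iff, root_splitRoot hx, root_splitRoot hx]
  set o := consSeq none (fun n => lumpLabel S (subtreeSeq x n))
  refine ⟨fun h => ?_, fun h => by rw [h]⟩
  rw [← firstOcc_spec o l, ← firstOcc_spec o m, h]

theorem rank_freq_consSeq {ι : Type*} [DecidableEq ι] {L : ℕ → ι} (e0 : ι)
    (h : ∀ z, HasFreq L z (freq L z)) : rank (freq (consSeq e0 L)) = rank (freq L) := by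
  congr 1
  funext z
  exact (hasFreq_shift_iff.1 (h z) : HasFreq (consSeq e0 L) z _).freq_eq

/-- The ranked frequencies of the subtrees of the root. -/
noncomputable def treeFreq (x : ℕ → ℕ) : ℕ → ℝ := rank (freq (subtreeSeq x))

theorem measurable_treeFreq : Measurable treeFreq :=
  measurable_rank.comp (measurable_freq.comp measurable_subtreeSeq)

theorem treeFreq_splitRoot {x : ℕ → ℕ} (hx : ∀ n, x n ≤ n) (hf : ProperFreq (subtreeSeq x))
    (S : Set ℕ) : treeFreq (splitRoot x S) = coalesce (freq (subtreeSeq x)) S := by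
  rw [treeFreq, rank_freq_congr (root_splitRoot_eq_iff hx S), rank_freq_consSeq,
    hf.rank_freq_lumpLabel]
  exact fun z => (hf.hasFreq_lumpLabel S z).hasFreq_freq

theorem coalesce_comp_perm {x : ℕ → ℝ} (h0 : ∀ i, 0 ≤ x i) (h1 : HasSum x 1)
    (σ : Equiv.Perm ℕ) (S : Set ℕ) : coalesce (x ∘ σ) (σ ⁻¹' S) = coalesce x S := by
  classical
  have hs (k : ℕ) : (if k ∈ S then x k else 0) = S.indicator x k := (Set.indicator_apply S x k).symm
  have hle : ∑' k, (if k ∈ S then x k else 0) ≤ 1 := by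
    simp only [hs]
    rw [← h1.tsum_eq]
    exact Summable.tsum_le_tsum (fun k => Set.indicator_le_self' (fun k _ => h0 k) k)
      (h1.summable.indicator S) h1.summable
  have hnn : 0 ≤ ∑' k, (if k ∈ S then x k else 0) :=
    tsum_nonneg fun k => by split_ifs; exacts [h0 k, le_rfl]
  have key := rank_comp_equiv (M := 1) (y := fun j : Option ℕ =>
    j.elim (∑' k, if k ∈ S then x k else 0) fun k => if k ∈ S then 0 else x k) ?_ ?_ σ.optionCongr
  · rw [coalesce, coalesce]
    convert! key using 2
    funext j
    rcases j with _ | k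
    · exact σ.tsum_eq fun k => if k ∈ S then x k else 0
    · rfl
  · rintro (_ | k)
    · exact hnn
    · simp only [Option.elim_some]
      split_ifs
      exacts [le_rfl, h0 k]
  · rintro (_ | k)
    · exact hle
    · simp only [Option.elim_some]
      split_ifs
      exacts [zero_le_one, le_one_of_hasSum h0 h1 k]

theorem measurable_preimage_perm (σ : Equiv.Perm ℕ) :
    Measurable fun S : Set ℕ => σ ⁻¹' S :=
  measurable_set_iff.2 fun n => measurable_set_mem (σ n)

theorem map_setBernoulli_preimage (σ : Equiv.Perm ℕ) (p : unitInterval) :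
    (setBernoulli Set.univ p : Measure (Set ℕ)).map (fun S => σ ⁻¹' S) =
      setBernoulli Set.univ p := by
  have hm : Measurable fun p : ℕ → Prop => {i | p i} :=
    (MeasurableEquiv.setOfPred (α := ℕ)).measurable
  have hσ : Measurable fun (q : ℕ → Prop) i => q (σ i) := by fun_prop
  rw [setBernoulli_eq_map, Measure.map_map (measurable_preimage_perm σ) hm]
  have h := Measure.map_infinitePi_infinitePi_of_inj (P := fun _ : ℕ =>
    unitInterval.toNNReal p • Measure.dirac True +
      unitInterval.toNNReal (unitInterval.symm p) • Measure.dirac False) σ.injective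
  have h2 : (fun i : ℕ => unitInterval.toNNReal p • Measure.dirac (i ∈ Set.univ) +
      unitInterval.toNNReal (unitInterval.symm p) • Measure.dirac False) = fun _ : ℕ =>
    unitInterval.toNNReal p • Measure.dirac True +
      unitInterval.toNNReal (unitInterval.symm p) • Measure.dirac False := by
    funext i
    simp
  rw [h2]
  conv_rhs => rw [← h, Measure.map_map hm hσ]
  rfl

theorem map_coagSetLaw_preimage (σ : Equiv.Perm ℕ) :
    (coagSetLaw α θ).map (fun S => σ ⁻¹' S) = coagSetLaw α θ := by
  have hm : Measurable fun b : ℝ =>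
      (setBernoulli Set.univ (Set.projIcc 0 1 zero_le_one b) : Measure (Set ℕ)) :=
    measurable_setBernoulli.comp continuous_projIcc.measurable
  ext s hs
  have hs' := measurable_preimage_perm σ hs
  rw [Measure.map_apply (measurable_preimage_perm σ) hs, coagSetLaw,
    Measure.bind_apply hs' hm.aemeasurable, Measure.bind_apply hs hm.aemeasurable]
  refine lintegral_congr fun b => ?_
  conv_rhs => rw [← map_setBernoulli_preimage σ, Measure.map_apply (measurable_preimage_perm σ) hs]

/-- The law of the coagulation of a sequence depends on its ranking only. -/
theorem coagLaw_rank {x : ℕ → ℝ} (h0 : ∀ i, 0 < x i) (h1 : HasSum x 1) :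
    coagLaw α θ (rank x) = (coagSetLaw α θ).map (coalesce x) := by
  obtain ⟨σ, hσ⟩ := exists_perm_rank h0 h1
  have hc (y : ℕ → ℝ) : Measurable (coalesce y) := by
    have h : Measurable ((fun p : (ℕ → ℝ) × Set ℕ => coalesce p.1 p.2) ∘ Prod.mk y) :=
      measurable_coalesce.comp measurable_prodMk_left
    exact h
  rw [coagLaw, hσ]
  conv_lhs => rw [← map_coagSetLaw_preimage σ, Measure.map_map (hc _) (measurable_preimage_perm σ)]
  congr 1
  funext S
  exact coalesce_comp_perm (fun i => (h0 i).le) h1 σ S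

/-- Conditional laws given by a random function: if `S` is independent of `x`, the conditional law
of `f (x, S)` given `g x` is `κ (g x)` provided that `f (x, ·)` has law `κ (g x)` for almost
every `x`. -/
theorem map_prod_eq_compProd {A B T Y : Type*} [MeasurableSpace A] [MeasurableSpace B]
    [MeasurableSpace T] [MeasurableSpace Y] {μ : Measure A} [IsProbabilityMeasure μ]
    {σ : Measure B} [IsProbabilityMeasure σ] {g : A → T} (hg : Measurable g) {f : A → B → Y}
    (hf : Measurable fun p : A × B => f p.1 p.2) {κ : Kernel T Y} [IsMarkovKernel κ]
    (h : ∀ᵐ x ∂μ, σ.map (f x) = κ (g x)) :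
    (μ.prod σ).map (fun p => (g p.1, f p.1 p.2)) = (μ.map g) ⊗ₘ κ := by
  have := Measure.isProbabilityMeasure_map (μ := μ) hg.aemeasurable
  have hm : Measurable fun p : A × B => (g p.1, f p.1 p.2) := (hg.comp measurable_fst).prodMk hf
  ext s hs
  rw [Measure.map_apply hm hs, Measure.prod_apply (hm hs), Measure.compProd_apply hs,
    lintegral_map (Kernel.measurable_kernel_prodMk_left hs) hg]
  refine lintegral_congr_ae ?_
  filter_upwards [h] with x hx
  have hfx : Measurable (f x) := hf.comp measurable_prodMk_left
  rw [← hx, Measure.map_apply hfx (measurable_prodMk_left hs)]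
  rfl

theorem HasPrediction.ae_properFreq (hα0 : 0 ≤ α) (hα1 : α < 1) (hθ : -α < θ)
    {μ : Measure (ℕ → ℕ)} [IsProbabilityMeasure μ] (hμ : HasPrediction μ (treeRule α θ)) :
    ∀ᵐ x ∂μ, ProperFreq (subtreeSeq x) ∧ ∀ k, 0 < freq (subtreeSeq x) k := by
  have h := ae_crpLaw hα0 hα1 hθ
  rw [← hμ.map_subtreeSeq_eq hα0 hα1 hθ] at h
  exact ae_of_ae_map measurable_subtreeSeq.aemeasurable h

/-- The reversed transition: given the tree in which the root and its first child have been
contracted, the ranked frequencies of the original tree are obtained by coagulation. -/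
theorem HasPrediction.map_contract_treeFreq (hα0 : 0 ≤ α) (hα1 : α < 1) (hθ : -α < θ)
    {μ : Measure (ℕ → ℕ)} [IsProbabilityMeasure μ] (hμ : HasPrediction μ (treeRule α θ))
    {T : Type*} [MeasurableSpace T] {g : (ℕ → ℕ) → T} (hg : Measurable g) {e : T → ℕ → ℝ}
    (he : Measurable e) (hge : ∀ x, e (g x) = treeFreq x) :
    μ.map (fun x => (g (contract 1 x), treeFreq x)) =
      (μ.map fun x => g (contract 1 x)) ⊗ₘ (coagKernel α θ).comap e he := by
  have := isProbabilityMeasure_coagSetLaw hα0 hα1 hθ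
  have := isMarkovKernel_coagKernel hα0 hα1 hθ
  have hc := measurable_contract 1
  have hμ' := hμ.map_contract_one hα0 hα1 hθ
  have hp := Measure.isProbabilityMeasure_map (μ := μ) hc.aemeasurable
  set ν := μ.map (contract 1) with hν
  have hsplit : μ = (ν.prod (coagSetLaw α θ)).map fun p => splitRoot p.1 p.2 := by
    have := Measure.isProbabilityMeasure_map (μ := ν.prod (coagSetLaw α θ))
      measurable_splitRoot.aemeasurable
    exact hμ.eq (hμ'.map_splitRoot hα0 hα1 hθ)
  have h1 : μ.map (fun x => g (contract 1 x)) = ν.map g := by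
    rw [hν, Measure.map_map hg hc]
    rfl
  have hgt : Measurable fun x => (g (contract 1 x), treeFreq x) :=
    (hg.comp hc).prodMk measurable_treeFreq
  rw [h1]
  conv_lhs => rw [hsplit]
  rw [Measure.map_map hgt measurable_splitRoot]
  have hmf : Measurable fun p : (ℕ → ℕ) × Set ℕ => treeFreq (splitRoot p.1 p.2) :=
    measurable_treeFreq.comp measurable_splitRoot
  rw [← map_prod_eq_compProd (σ := coagSetLaw α θ)
    (f := fun x S => treeFreq (splitRoot x S)) hg hmf]
  · congr 1
    funext p
    simp only [Function.comp_apply, contract_splitRoot]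
  · filter_upwards [hμ'.ae_isParentSeq, hμ'.ae_properFreq hα0 hα1 (by linarith)] with x hx hf
    rw [Kernel.comap_apply, hge]
    change _ = coagLaw α θ (rank _)
    rw [coagLaw_rank hf.2 hf.1.2]
    congr 1
    funext S
    exact treeFreq_splitRoot hx hf.1 S

end Coalesce

/-! ### Fragmenting a block of a Chinese restaurant process -/

section Split

variable {α θ : ℝ}

/-- The `n`-th term of the restricted growth sequence `x` starts a new block. -/
def NewBlockAt (x : ℕ → ℕ) (n : ℕ) : Prop := x n = numBlocks x n

theorem newBlockAt_congr (x y : ℕ → ℕ) (n : ℕ) (h : ∀ m < n + 1, x m = y m) :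
    NewBlockAt x n ↔ NewBlockAt y n := by
  rw [NewBlockAt, NewBlockAt, h n n.lt_succ_self, numBlocks_prefix fun m hm => h m (by omega)]

theorem newBlockAt_rg {ι : Type*} {L : ℕ → ι} {n : ℕ} :
    NewBlockAt (rg L) n ↔ ∀ m < n, L m ≠ L n := by
  rw [NewBlockAt, numBlocks_rg]
  constructor
  · intro h m hm hmn
    have := (restrictedGrowth_rg L n).lt_numBlocks hm
    rw [numBlocks_rg, rg_eq_of_eq hmn] at this
    omega
  · exact rg_of_new

open Classical in
theorem numBlocks_succ {ι : Type*} (L : ℕ → ι) (n : ℕ) :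
    numBlocks L (n + 1) = numBlocks L n + if ∃ m < n, L m = L n then 0 else 1 := by
  split_ifs with h
  · obtain ⟨m, hm, hmn⟩ := h
    exact numBlocks_succ_of_mem hm hmn
  · push Not at h
    exact numBlocks_succ_of_new h

theorem numBlocks_succ_add {ι κ : Type*} {L : ℕ → ι} {L' : ℕ → κ} {n k : ℕ}
    (h : (∃ m < n, L m = L n) ↔ ∃ m < k, L' m = L' k) :
    numBlocks L (n + 1) + numBlocks L' k = numBlocks L' (k + 1) + numBlocks L n := by
  rw [numBlocks_succ, numBlocks_succ]
  by_cases h' : ∃ m < n, L m = L n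
  · rw [if_pos h', if_pos (h.1 h')]
    omega
  · rw [if_neg h', if_neg (mt h.2 h')]
    omega

open Classical in
theorem count_newBlockAt_rg {ι : Type*} (L : ℕ → ι) (n : ℕ) :
    Nat.count (NewBlockAt (rg L)) n = numBlocks L n := by
  induction n with
  | zero => simp
  | succ n ih =>
    rw [Nat.count_succ, ih, numBlocks_succ]
    congr 1
    simp only [newBlockAt_rg]
    split_ifs <;> grind

/-- Labels of a partition in which the block of label `0` of a restricted growth sequence is split
further: the first component is the block in the restricted growth sequence `0, (z 0).1, (z 1).1, …`
and the second component is the block within the block of label `0`. The conditions are those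
satisfied by the first `n` terms. -/
structure IsSplitSeq (z : ℕ → ℕ × ℕ) (n : ℕ) : Prop where
  snd_eq_zero : ∀ m < n, (z m).1 ≠ 0 → (z m).2 = 0
  growth_fst : RestrictedGrowth (consSeq 0 fun m => (z m).1) (n + 1)
  growth_snd : RestrictedGrowth (usedTerms ZeroAt z) (occ (fun m => (z m).1) 0 n)

variable {z : ℕ → ℕ × ℕ} {n : ℕ}

theorem occ_mono {ι : Type*} [DecidableEq ι] (L : ℕ → ι) (e : ι) : Monotone (occ L e) :=
  monotone_nat_of_le_succ fun n => by rw [occ_succ]; omega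

theorem IsSplitSeq.mono {m : ℕ} (h : IsSplitSeq z n) (hmn : m ≤ n) : IsSplitSeq z m :=
  ⟨fun l hl => h.snd_eq_zero l (by omega), h.growth_fst.mono (by omega),
    h.growth_snd.mono (occ_mono _ _ hmn)⟩

theorem occ_consSeq {ι : Type*} [DecidableEq ι] (e0 : ι) (x : ℕ → ι) (e : ι) (n : ℕ) :
    occ (consSeq e0 x) e (n + 1) = occ x e n + if e0 = e then 1 else 0 := by
  induction n with
  | zero =>
    rw [occ_succ, occ_zero, occ_zero]
    rfl
  | succ n ih =>
    rw [occ_succ, ih, occ_succ, add_right_comm]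
    rfl

theorem usedTerms_zeroAt {n : ℕ} (h : (z n).1 = 0) :
    usedTerms ZeroAt z (occ (fun m => (z m).1) 0 n) = (z n).2 := by
  rw [← count_zeroAt]
  exact usedTerms_count (N := ZeroAt) h

theorem exists_fst_eq_zero_iff {f : ℕ} :
    (∃ m < n, z m = (0, f)) ↔
      ∃ k < occ (fun m => (z m).1) 0 n, usedTerms ZeroAt z k = f := by
  classical
  rw [← count_zeroAt, exists_lt_count_iff]
  refine exists_congr fun m => and_congr_right fun _ => ?_
  constructor
  · intro h
    have h0 : (z m).1 = 0 := by rw [h]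
    refine ⟨h0, ?_⟩
    rw [count_zeroAt, usedTerms_zeroAt h0, h]
  · rintro ⟨h0, h⟩
    rw [count_zeroAt, usedTerms_zeroAt h0] at h
    exact Prod.ext h0 h

theorem occ_usedTerms_zeroAt (f : ℕ) :
    occ (usedTerms ZeroAt z) f (occ (fun m => (z m).1) 0 n) = occ z (0, f) n := by
  induction n with
  | zero => simp
  | succ n ih =>
    rw [occ_succ _ _ n, occ_succ z]
    by_cases h : (z n).1 = 0
    · rw [if_pos h, occ_succ, ih, usedTerms_zeroAt h]
      congr 1
      have : z n = (0, f) ↔ (z n).2 = f := ⟨fun h => by rw [h], fun h' => Prod.ext h h'⟩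
      simp only [this]
    · rw [if_neg h, if_neg fun h' => h (by rw [h']), add_zero, add_zero, ih]

theorem IsSplitSeq.exists_fst_ne_zero_iff (h : IsSplitSeq z n) {e : ℕ} (he : e ≠ 0) :
    (∃ m < n, z m = (e, 0)) ↔ ∃ m < n + 1, consSeq 0 (fun m => (z m).1) m = e := by
  constructor
  · rintro ⟨m, hm, hme⟩
    refine ⟨m + 1, by omega, ?_⟩
    change (z m).1 = e
    rw [hme]
  · rintro ⟨m, hm, hme⟩
    rcases m with _ | m
    · exact absurd hme.symm he
    · have hme : (z m).1 = e := hme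
      refine ⟨m, by omega, Prod.ext hme ?_⟩
      exact h.snd_eq_zero m (by omega) (by omega)

/-- The blocks after fragmentation are the fragments of the first block and the other blocks. The
number of blocks before fragmentation includes the first one, which accounts for the summand `1`. -/
theorem IsSplitSeq.numBlocks_add_one (h : IsSplitSeq z n) :
    numBlocks z n + 1 = numBlocks (usedTerms ZeroAt z) (occ (fun m => (z m).1) 0 n) +
      numBlocks (consSeq 0 fun m => (z m).1) (n + 1) := by
  classical
  induction n with
  | zero => simp [numBlocks_succ]
  | succ n ih =>
    have ih' := ih (h.mono n.le_succ)
    rw [occ_succ]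
    have hd : consSeq 0 (fun m => (z m).1) (n + 1) = (z n).1 := rfl
    by_cases h0 : (z n).1 = 0
    · rw [if_pos h0, numBlocks_succ_of_mem (L := consSeq 0 fun m => (z m).1)
        (show 0 < n + 1 by omega) (by rw [hd, h0]; rfl)]
      have : (∃ m < n, z m = z n) ↔
          ∃ k < occ (fun m => (z m).1) 0 n, usedTerms ZeroAt z k = (z n).2 := by
        rw [← exists_fst_eq_zero_iff, ← h0]
      rw [← usedTerms_zeroAt h0] at this
      have := numBlocks_succ_add this
      omega
    · have h2 := h.snd_eq_zero n n.lt_succ_self h0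
      have : (∃ m < n, z m = z n) ↔ ∃ m < n + 1, consSeq 0 (fun m => (z m).1) m =
          consSeq 0 (fun m => (z m).1) (n + 1) := by
        rw [hd, ← (h.mono n.le_succ).exists_fst_ne_zero_iff h0]
        rw [show z n = ((z n).1, 0) from Prod.ext rfl h2]
      have := numBlocks_succ_add this
      rw [if_neg h0, add_zero]
      omega

open Classical in
/-- The number of fragments of the first block is the number of new blocks that are marked. -/
theorem IsSplitSeq.count_new_left (h : IsSplitSeq z n) :
    Nat.count (fun m => NewBlockAt (rg z) m ∧ (z m).1 = 0) n =
      numBlocks (usedTerms ZeroAt z) (occ (fun m => (z m).1) 0 n) := by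
  induction n with
  | zero => simp
  | succ n ih =>
    rw [Nat.count_succ, ih (h.mono n.le_succ), occ_succ]
    by_cases h0 : (z n).1 = 0
    · rw [if_pos h0, numBlocks_succ (usedTerms ZeroAt z), usedTerms_zeroAt h0]
      have : (∃ m < n, z m = z n) ↔
          ∃ k < occ (fun m => (z m).1) 0 n, usedTerms ZeroAt z k = (z n).2 := by
        rw [← exists_fst_eq_zero_iff, ← h0]
      rw [newBlockAt_rg]
      simp only [h0, and_true, ← this]
      congr 1
      split_ifs <;> grind
    · simp [h0]

/-- The prediction rule of a Chinese restaurant process whose first block is fragmented. -/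
noncomputable def splitRule (α θ : ℝ) : ℕ → (ℕ → ℕ × ℕ) → ℕ × ℕ → ENNReal :=
  interleaveRule ZeroAt 0 (fun n x e => crpRule α θ (n + 1) (consSeq 0 x) e) (crpRule α (1 - α))

theorem splitRule_left (e : ℕ) : splitRule α θ n z (0, e) =
    crpRule α θ (n + 1) (consSeq 0 fun m => (z m).1) 0 *
      crpRule α (1 - α) (occ (fun m => (z m).1) 0 n) (usedTerms ZeroAt z) e := by
  rw [splitRule, interleaveRule_of (Function.update_self n 0 _), count_zeroAt]

theorem splitRule_right {e f : ℕ} (he : e ≠ 0) : splitRule α θ n z (e, f) =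
    crpRule α θ (n + 1) (consSeq 0 fun m => (z m).1) e * if f = 0 then 1 else 0 := by
  rw [splitRule, interleaveRule_of_not (by simpa [ZeroAt] using he)]
  congr

theorem isSplitSeq_of_splitRule (h : ∀ m < n, splitRule α θ m z (z m) ≠ 0) : IsSplitSeq z n := by
  refine ⟨fun m hm h0 => ?_, ?_, ?_⟩
  · have h1 := h m hm
    rw [show z m = ((z m).1, (z m).2) from rfl, splitRule_right h0] at h1
    by_contra hf
    exact right_ne_zero_of_mul h1 (if_neg hf)
  · refine restrictedGrowth_of_crpRule (α := α) (θ := θ) fun m hm => ?_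
    rcases m with _ | m
    · simp [crpRule, consSeq]
    · have h1 := h m (by omega)
      change crpRule α θ (m + 1) _ (z m).1 ≠ 0
      by_cases h0 : (z m).1 = 0
      · rw [show z m = (0, (z m).2) from Prod.ext h0 rfl, splitRule_left] at h1
        rw [h0]
        exact left_ne_zero_of_mul h1
      · rw [show z m = ((z m).1, (z m).2) from rfl, splitRule_right h0] at h1
        exact left_ne_zero_of_mul h1
  · refine restrictedGrowth_of_crpRule (α := α) (θ := 1 - α) ?_
    classical
    rw [← count_zeroAt, forall_lt_count_iff]
    intro m hm h0
    have h0 : (z m).1 = 0 := h0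
    rw [count_zeroAt, usedTerms_zeroAt h0]
    have h1 := h m hm
    rw [show z m = (0, (z m).2) from Prod.ext h0 rfl, splitRule_left] at h1
    exact right_ne_zero_of_mul h1

theorem ofReal_div_mul_div {a b c : ℝ} (hb : 0 < b) (hc : 0 < c) :
    ENNReal.ofReal (b / c) * ENNReal.ofReal (a / b) = ENNReal.ofReal (a / c) := by
  rw [← ENNReal.ofReal_mul (by positivity)]
  congr 1
  field_simp

theorem crpRule_consSeq_zero :
    crpRule α θ (n + 1) (consSeq 0 fun m => (z m).1) 0 =
      ENNReal.ofReal ((1 - α + occ (fun m => (z m).1) 0 n) / (θ + 1 + n)) := by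
  rw [crpRule, if_neg n.succ_ne_zero, if_pos (numBlocks_pos _ n.succ_pos), occ_consSeq, if_pos rfl]
  congr 2
  · push_cast; ring
  · push_cast; ring

/-- A block that exists already is joined with the probability of a Chinese restaurant process
with parameters `(α, θ + 1)`. For a fragment of the first block, the size of the first block
(which includes the initial label) minus `α` cancels against the denominator of the fragmenting
process. -/
theorem IsSplitSeq.splitRule_old (hα1 : α < 1) (hθ : -α < θ) (h : IsSplitSeq z n) {p : ℕ × ℕ}
    (hp : ∃ m < n, z m = p) :
    splitRule α θ n z p = ENNReal.ofReal ((occ z p n - α) / (θ + 1 + n)) := by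
  have hpos : 0 < θ + 1 + n := by
    have := n.cast_nonneg (α := ℝ)
    linarith
  obtain ⟨e, f⟩ := p
  rcases eq_or_ne e 0 with rfl | he
  · have hex := exists_fst_eq_zero_iff.1 hp
    have hlt := h.growth_snd.lt_numBlocks_iff.2 hex
    have ht : occ (fun m => (z m).1) 0 n ≠ 0 := by
      obtain ⟨k, hk, -⟩ := hex
      omega
    rw [splitRule_left, crpRule_consSeq_zero, crpRule, if_neg ht, if_pos hlt, occ_usedTerms_zeroAt,
      ofReal_div_mul_div _ hpos]
    have := (occ (fun m => (z m).1) 0 n).cast_nonneg (α := ℝ)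
    linarith
  · obtain ⟨m, hm, hmp⟩ := hp
    have hf : f = 0 := by
      have := h.snd_eq_zero m hm
      rw [hmp] at this
      exact this he
    subst hf
    have hlt := h.growth_fst.lt_numBlocks_iff.2 ((h.exists_fst_ne_zero_iff he).1 ⟨m, hm, hmp⟩)
    have hocc : occ (consSeq 0 fun m => (z m).1) e (n + 1) = occ z (e, 0) n := by
      rw [occ_consSeq, if_neg he.symm, add_zero]
      refine occ_congr fun m hm => ⟨fun h' => Prod.ext h' ?_, fun h' => by rw [h']⟩
      exact h.snd_eq_zero m hm (by omega)
    rw [splitRule_right he, crpRule, if_neg n.succ_ne_zero, if_pos hlt, hocc, if_pos rfl, mul_one]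
    congr 2
    push_cast; ring

/-- The probability of a new fragment of the first block. -/
theorem IsSplitSeq.splitRule_new_left (hα1 : α < 1) (hθ : -α < θ)
    (h : IsSplitSeq z n) {f : ℕ} (hp : ∀ m < n, z m ≠ (0, f)) :
    splitRule α θ n z (0, f) =
      if f = numBlocks (usedTerms ZeroAt z) (occ (fun m => (z m).1) 0 n) then
        ENNReal.ofReal ((1 - α + α * numBlocks (usedTerms ZeroAt z)
          (occ (fun m => (z m).1) 0 n)) / (θ + 1 + n)) else 0 := by
  have hpos : 0 < θ + 1 + n := by
    have := n.cast_nonneg (α := ℝ)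
    linarith
  have hnew : ¬ f < numBlocks (usedTerms ZeroAt z) (occ (fun m => (z m).1) 0 n) := fun hlt => by
    obtain ⟨m, hm, hme⟩ := exists_fst_eq_zero_iff.2 (h.growth_snd.lt_numBlocks_iff.1 hlt)
    exact hp m hm hme
  rw [splitRule_left, crpRule_consSeq_zero, crpRule]
  set t := occ (fun m => (z m).1) 0 n
  rcases eq_or_ne t 0 with ht | ht
  · rw [if_pos ht, ht, numBlocks_zero]
    split_ifs
    · simp
    · rw [mul_zero]
  · rw [if_neg ht, if_neg hnew]
    split_ifs
    · rw [ofReal_div_mul_div _ hpos]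
      have := t.cast_nonneg (α := ℝ)
      linarith
    · rw [mul_zero]

/-- The probability of a new block outside of the first block. -/
theorem IsSplitSeq.splitRule_new_right (h : IsSplitSeq z n) {e f : ℕ} (he : e ≠ 0)
    (hp : ∀ m < n, z m ≠ (e, f)) :
    splitRule α θ n z (e, f) =
      if (e, f) = (numBlocks (consSeq 0 fun m => (z m).1) (n + 1), 0) then
        ENNReal.ofReal ((θ + α * numBlocks (consSeq 0 fun m => (z m).1) (n + 1)) / (θ + 1 + n))
      else 0 := by
  rw [splitRule_right he]
  rcases eq_or_ne f 0 with rfl | hf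
  · have hnew : ¬ e < numBlocks (consSeq 0 fun m => (z m).1) (n + 1) := fun hlt => by
      obtain ⟨m, hm, hme⟩ :=
        (h.exists_fst_ne_zero_iff he).2 (h.growth_fst.lt_numBlocks_iff.1 hlt)
      exact hp m hm hme
    rw [crpRule, if_neg n.succ_ne_zero, if_neg hnew, if_pos rfl, mul_one]
    simp only [Prod.mk.injEq, and_true]
    split_ifs
    · congr 2
      push_cast; ring
    · rfl
  · rw [if_neg hf, mul_zero, if_neg]
    simp [hf]

end Split

section SplitLaw

variable {α θ : ℝ} {z : ℕ → ℕ × ℕ} {n : ℕ}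

theorem rg_update_of_mem {ι : Type*} {a : ℕ → ι} {m n : ℕ} (hm : m < n) :
    rg (Function.update a n (a m)) n = rg a m := by
  rw [← rg_eq_of_eq (L := Function.update a n (a m)) (m := m) (n := n)]
  · exact rg_prefix _ _ m fun l hl => Function.update_of_ne (by omega) _ _
  · rw [Function.update_self, Function.update_of_ne hm.ne]

theorem newBlockAt_rg_update {ι : Type*} {a : ℕ → ι} {n : ℕ} {e : ι} :
    NewBlockAt (rg (Function.update a n e)) n ↔ ∀ m < n, a m ≠ e := by
  rw [newBlockAt_rg]
  refine forall₂_congr fun m hm => ?_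
  rw [Function.update_self, Function.update_of_ne hm.ne]

theorem rg_update_of_new {ι : Type*} {a : ℕ → ι} {n : ℕ} {e : ι} (h : ∀ m < n, a m ≠ e) :
    rg (Function.update a n e) n = numBlocks a n := by
  rw [newBlockAt_rg_update.2 h, numBlocks_rg]
  exact numBlocks_prefix fun m hm => Function.update_of_ne hm.ne _ _

theorem crpRule_of_lt {a : ℕ → ℕ} {k : ℕ} (hn : n ≠ 0) (hk : k < numBlocks a n) :
    crpRule α θ n a k = ENNReal.ofReal ((occ a k n - α) / (θ + n)) := by
  rw [crpRule, if_neg hn, if_pos hk]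

theorem crpRule_of_gt {a : ℕ → ℕ} {k : ℕ} (hk : numBlocks a n < k) : crpRule α θ n a k = 0 := by
  rw [crpRule, if_neg (by omega : ¬ k < _), if_neg (by omega : ¬ k = numBlocks a n),
    if_neg (by omega : ¬ k = 0), ite_self]

open Classical in
/-- The restricted growth sequence of a labelling by pairs, together with the indicator of the terms
that start a new block contained in the block of first label `0`. -/
noncomputable def splitMark (z : ℕ → ℕ × ℕ) (n : ℕ) : ℕ × Bool :=
  (rg z n, decide (NewBlockAt (rg z) n ∧ (z n).1 = 0))

theorem splitMark_prefix (x y : ℕ → ℕ × ℕ) (n : ℕ) (h : ∀ m < n + 1, x m = y m) :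
    splitMark x n = splitMark y n := by
  have h1 : NewBlockAt (rg x) n ↔ NewBlockAt (rg y) n :=
    newBlockAt_congr _ _ n fun m hm => rg_prefix _ _ m fun l hl => h l (by omega)
  refine Prod.ext (rg_prefix _ _ n h) (decide_eq_decide.2 ?_)
  rw [h1, h n n.lt_succ_self]

theorem splitMark_update_of_mem {m : ℕ} (hm : m < n) :
    splitMark (Function.update z n (z m)) n = (rg z m, false) := by
  classical
  refine Prod.ext (rg_update_of_mem hm) ?_
  have h : ¬ (NewBlockAt (rg (Function.update z n (z m))) n ∧
      (Function.update z n (z m) n).1 = 0) :=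
    fun h => newBlockAt_rg_update.1 h.1 m hm rfl
  rw [splitMark]
  exact decide_eq_false h

theorem splitMark_update_of_new {p : ℕ × ℕ} (h : ∀ m < n, z m ≠ p) :
    splitMark (Function.update z n p) n = (numBlocks z n, decide (p.1 = 0)) := by
  refine Prod.ext (rg_update_of_new h) ?_
  simp only [splitMark]
  refine decide_eq_decide.2 ?_
  rw [Function.update_self, and_iff_right (newBlockAt_rg_update.2 h)]

/-- The prediction rule of a Chinese restaurant process whose blocks carry independent marks, the
marks having the law of the set of coagulating blocks. -/
noncomputable def markedRule (α θ : ℝ) : ℕ → (ℕ → ℕ × Bool) → ℕ × Bool → ENNReal :=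
  interleaveRule NewBlockAt false (crpRule α (θ + 1)) (urnRule α θ)

theorem markedRule_congr {a b : ℕ → ℕ × Bool} (h : ∀ m < n, a m = b m) (e : ℕ × Bool) :
    markedRule α θ n a e = markedRule α θ n b e := by
  classical
  have h1 (m : ℕ) (hm : m < n) : (a m).1 = (b m).1 := by rw [h m hm]
  have hN (m : ℕ) (hm : m < n) :
      NewBlockAt (fun m => (a m).1) m ↔ NewBlockAt (fun m => (b m).1) m :=
    newBlockAt_congr _ _ m fun l hl => h1 l (by omega)
  have hN' : NewBlockAt (Function.update (fun m => (a m).1) n e.1) n ↔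
      NewBlockAt (Function.update (fun m => (b m).1) n e.1) n := by
    refine newBlockAt_congr _ _ n fun m hm => ?_
    rcases eq_or_ne m n with rfl | hmn
    · simp
    · rw [Function.update_of_ne hmn, Function.update_of_ne hmn, h1 m (by omega)]
  have hc (m : ℕ) (hm : m ≤ n) : Nat.count (NewBlockAt fun m => (a m).1) m =
      Nat.count (NewBlockAt fun m => (b m).1) m := count_congr fun l hl => hN l (by omega)
  have hu : urnRule α θ (Nat.count (NewBlockAt fun m => (a m).1) n) (usedTerms NewBlockAt a) e.2 =
      urnRule α θ (Nat.count (NewBlockAt fun m => (b m).1) n) (usedTerms NewBlockAt b) e.2 := by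
    rw [← hc n le_rfl]
    refine urnRule_congr ((forall_lt_count_iff (Q := fun k =>
      usedTerms NewBlockAt a k = usedTerms NewBlockAt b k)).2 fun m hm hNm => ?_) _
    rw [usedTerms_count hNm, hc m hm.le, usedTerms_count ((hN m hm).1 hNm), h m hm]
  rw [markedRule, interleaveRule, interleaveRule, crpRule_congr h1]
  congr 1
  by_cases hn : NewBlockAt (Function.update (fun m => (a m).1) n e.1) n
  · rw [if_pos hn, if_pos (hN'.1 hn)]
    convert! hu
  · rw [if_neg hn, if_neg (mt hN'.2 hn)]

theorem newBlockAt_update_rg {ι : Type*} {a : ℕ → ι} {k : ℕ} :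
    NewBlockAt (Function.update (rg a) n k) n ↔ k = numBlocks a n := by
  rw [NewBlockAt, Function.update_self,
    numBlocks_prefix (y := rg a) fun m hm => Function.update_of_ne hm.ne _ _, numBlocks_rg]

theorem markedRule_of_ne {k : ℕ} (hk : k ≠ numBlocks z n) (f : Bool) :
    markedRule α θ n (splitMark z) (k, f) =
      crpRule α (θ + 1) n (rg z) k * if f = false then 1 else 0 := by
  rw [markedRule, interleaveRule_of_not]
  · congr
  · exact mt newBlockAt_update_rg.1 hk

/-- The probability of a new block with a given mark: the number of marked blocks is the number
of fragments of the first block, and the total weight of a new block cancels against the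
denominator of the urn. -/
theorem IsSplitSeq.markedRule_new (hα0 : 0 ≤ α) (hα1 : α < 1) (hθ : -α < θ) (h : IsSplitSeq z n)
    (f : Bool) : markedRule α θ n (splitMark z) (numBlocks z n, f) =
      ENNReal.ofReal ((if f then 1 - α + α * numBlocks (usedTerms ZeroAt z)
          (occ (fun m => (z m).1) 0 n)
        else θ + α * numBlocks (consSeq 0 fun m => (z m).1) (n + 1)) / (θ + 1 + n)) := by
  classical
  have hfst : (fun m => (splitMark z m).1) = rg z := rfl
  have hcount : Nat.count (NewBlockAt (rg z)) n = numBlocks z n := count_newBlockAt_rg z n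
  have htrue : occ (usedTerms NewBlockAt (splitMark z)) true (numBlocks z n) =
      numBlocks (usedTerms ZeroAt z) (occ (fun m => (z m).1) 0 n) := by
    rw [← h.count_new_left, ← hcount]
    refine Eq.trans ?_ ((occ_usedTerms NewBlockAt (splitMark z) true n).trans ?_)
    · congr
    · refine Eq.trans ?_ ((count_congr
        (p := fun m => NewBlockAt (rg z) m ∧ (splitMark z m).2 = true)
        (q := fun m => NewBlockAt (rg z) m ∧ (z m).1 = 0) (n := n) fun m _ => ?_).trans ?_)
      · congr
      · simp only [splitMark, decide_eq_true_iff]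
        tauto
      · congr
  have hsum := occ_true_add_occ_false (usedTerms NewBlockAt (splitMark z)) (numBlocks z n)
  have hblocks := h.numBlocks_add_one
  have hpos : 0 < θ + 1 + α * numBlocks z n := by
    have := mul_nonneg hα0 (numBlocks z n).cast_nonneg (α := ℝ)
    linarith
  have hpos' : 0 < θ + 1 + n := by
    have := n.cast_nonneg (α := ℝ)
    linarith
  have hcrp (x : ℝ) : crpRule α (θ + 1) n (rg z) (numBlocks z n) *
      ENNReal.ofReal (x / (θ + 1 + α * numBlocks z n)) = ENNReal.ofReal (x / (θ + 1 + n)) := by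
    rw [crpRule, numBlocks_rg]
    rcases eq_or_ne n 0 with rfl | hn
    · simp
    · rw [if_neg hn, if_neg (lt_irrefl _), if_pos rfl, ofReal_div_mul_div hpos hpos']
  rw [markedRule, interleaveRule_of (newBlockAt_update_rg.2 rfl), hfst]
  refine Eq.trans ?_ (hcrp _)
  congr 1
  have : urnRule α θ (numBlocks z n) (usedTerms NewBlockAt (splitMark z)) f =
      ENNReal.ofReal ((if f then 1 - α + α * numBlocks (usedTerms ZeroAt z)
          (occ (fun m => (z m).1) 0 n)
        else θ + α * numBlocks (consSeq 0 fun m => (z m).1) (n + 1)) /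
          (θ + 1 + α * numBlocks z n)) := by
    rw [urnRule, htrue]
    rcases f
    · rw [if_neg Bool.false_ne_true, if_neg Bool.false_ne_true]
      congr 2
      rw [htrue] at hsum
      have h1 : (numBlocks (consSeq 0 fun m => (z m).1) (n + 1) : ℝ) =
          occ (usedTerms NewBlockAt (splitMark z)) false (numBlocks z n) + 1 := by
        exact_mod_cast (by omega : numBlocks (consSeq 0 fun m => (z m).1) (n + 1) =
          occ (usedTerms NewBlockAt (splitMark z)) false (numBlocks z n) + 1)
      rw [h1]
      ring
    · rfl
  rw [← this, ← hcount]

/-- Fragmenting the first block of a Chinese restaurant process turns its prediction rule into that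
of a marked Chinese restaurant process. -/
theorem IsSplitSeq.tsum_splitRule (hα0 : 0 ≤ α) (hα1 : α < 1) (hθ : -α < θ) (h : IsSplitSeq z n)
    (p : ℕ × Bool) :
    ∑' e, (open Classical in
      if splitMark (Function.update z n e) n = p then splitRule α θ n z e else 0) =
        markedRule α θ n (splitMark z) p := by
  classical
  obtain ⟨k, f⟩ := p
  have hcases (e : ℕ × ℕ) : (∃ m < n, z m = e) ∨ ∀ m < n, z m ≠ e := by
    by_cases he : ∃ m < n, z m = e
    · exact Or.inl he
    · push Not at he
      exact Or.inr he
  have hlt {m : ℕ} (hm : m < n) : rg z m < numBlocks z n := by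
    have := (restrictedGrowth_rg z n).lt_numBlocks hm
    rwa [numBlocks_rg] at this
  rcases lt_trichotomy k (numBlocks z n) with hk | rfl | hk
  · -- the label of an existing block comes from exactly one value of the next pair
    obtain ⟨m, hm, rfl⟩ := (restrictedGrowth_rg z n).lt_numBlocks_iff.1
      (show k < numBlocks (rg z) n by rwa [numBlocks_rg])
    rw [markedRule_of_ne hk.ne, tsum_eq_single (z m), splitMark_update_of_mem hm,
      h.splitRule_old hα1 hθ ⟨m, hm, rfl⟩, crpRule_of_lt (by omega) (by rwa [numBlocks_rg]),
      occ_congr (L := rg z) (L' := z) (z' := z m) fun l _ => rg_eq_iff]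
    · rcases f <;> simp
    · intro e he
      rw [if_neg]
      rcases hcases e with ⟨l, hl, rfl⟩ | hnew
      · rw [splitMark_update_of_mem hl]
        exact fun h' => he (rg_eq_iff.1 (congrArg Prod.fst h'))
      · rw [splitMark_update_of_new hnew]
        exact fun h' => hk.ne (congrArg Prod.fst h').symm
  · rw [h.markedRule_new hα0 hα1 hθ]
    rcases f
    · -- an unmarked new block lies outside of the fragmented one
      have hD : numBlocks (consSeq 0 fun m => (z m).1) (n + 1) ≠ 0 :=
        (numBlocks_pos _ n.succ_pos).ne'
      have hnew : ∀ m < n, z m ≠ (numBlocks (consSeq 0 fun m => (z m).1) (n + 1), 0) := by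
        intro m hm he
        have := h.growth_fst.lt_numBlocks_iff.2 ((h.exists_fst_ne_zero_iff hD).1 ⟨m, hm, he⟩)
        exact lt_irrefl _ this
      rw [tsum_eq_single (numBlocks (consSeq 0 fun m => (z m).1) (n + 1), 0),
        splitMark_update_of_new hnew, h.splitRule_new_right hD hnew, if_pos rfl, if_pos]
      · rfl
      · simp [hD]
      · rintro ⟨e, g⟩ he
        rw [ite_eq_right_iff]
        intro h'
        rcases hcases (e, g) with ⟨l, hl, hle⟩ | hnew'
        · rw [← hle, splitMark_update_of_mem hl] at h'
          exact absurd (congrArg Prod.fst h') (hlt hl).ne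
        · rw [splitMark_update_of_new hnew'] at h'
          have he0 : e ≠ 0 := by simpa using congrArg Prod.snd h'
          rw [h.splitRule_new_right he0 hnew', if_neg he]
    · -- a marked new block is a new fragment
      set s := numBlocks (usedTerms ZeroAt z) (occ (fun m => (z m).1) 0 n) with hs
      have hnew : ∀ m < n, z m ≠ (0, s) := by
        intro m hm he
        have := h.growth_snd.lt_numBlocks_iff.2 (exists_fst_eq_zero_iff.1 ⟨m, hm, he⟩)
        exact lt_irrefl _ this
      rw [tsum_eq_single (0, s), splitMark_update_of_new hnew, h.splitRule_new_left hα1 hθ hnew,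
        if_pos hs, if_pos]
      · rfl
      · rfl
      · rintro ⟨e, g⟩ he
        rw [ite_eq_right_iff]
        intro h'
        rcases hcases (e, g) with ⟨l, hl, hle⟩ | hnew'
        · rw [← hle, splitMark_update_of_mem hl] at h'
          exact absurd (congrArg Prod.snd h') Bool.false_ne_true
        · rw [splitMark_update_of_new hnew'] at h'
          have he0 : e = 0 := by simpa using congrArg Prod.snd h'
          subst he0
          rw [h.splitRule_new_left hα1 hθ hnew', if_neg]
          exact fun hg => he (by rw [hg])
  · -- a label that skips a value has probability zero on both sides
    rw [markedRule_of_ne hk.ne', crpRule_of_gt (by rwa [numBlocks_rg]), zero_mul,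
      ENNReal.tsum_eq_zero]
    intro e
    rw [if_neg]
    rcases hcases e with ⟨l, hl, rfl⟩ | hnew
    · rw [splitMark_update_of_mem hl]
      intro h'
      have h1 : rg z l = k := congrArg Prod.fst h'
      have := hlt hl
      omega
    · rw [splitMark_update_of_new hnew]
      exact fun h' => hk.ne (congrArg Prod.fst h')

end SplitLaw

section MarkedLaw

variable {α θ : ℝ}

theorem hasPrediction_tail_crpLaw (hα0 : 0 ≤ α) (hα1 : α < 1) (hθ : -α < θ) :
    HasPrediction ((crpLaw α θ).map fun x n => x (n + 1))
      fun n x e => crpRule α θ (n + 1) (consSeq 0 x) e := by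
  have := isProbabilityMeasure_crpLaw hα0 hα1 hθ
  have h := hasPrediction_crpLaw hα0 hα1 hθ
  refine HasPrediction.map_tail (e0 := 0)
    (r := fun n a e => crpRule α θ n (consSeq 0 fun m => a (m + 1)) e)
    (h.congr fun n a ha e => crpRule_congr (fun m hm => ?_) e) (fun a => by simp [crpRule])
    fun n a e => rfl
  rcases m with _ | m
  · have := h.restrictedGrowth ha 0 hm
    rw [numBlocks_zero] at this
    exact Nat.le_zero.1 this
  · rfl

/-- Fragmenting the block of the first label of an `(α, θ)` Chinese restaurant process by means of
an independent `(α, 1 - α)` Chinese restaurant process, and marking the fragments, is the same as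
marking the blocks of an `(α, θ + 1)` Chinese restaurant process with the coagulating set. The
first label itself is dropped from the fragmented process. -/
theorem map_splitMark_eq (hα0 : 0 ≤ α) (hα1 : α < 1) (hθ : -α < θ) :
    ((crpLaw α θ).prod (crpLaw α (1 - α))).map
        (fun p => splitMark (interleave ZeroAt 0 (fun n => p.1 (n + 1)) p.2)) =
      ((crpLaw α (θ + 1)).prod (coagSetLaw α θ)).map
        fun p => interleave NewBlockAt false p.1 (memSeq p.2) := by
  have hα : -α < 1 - α := by linarith
  have hθ1 : -α < θ + 1 := by linarith
  have := isProbabilityMeasure_crpLaw hα0 hα1 hθ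
  have := isProbabilityMeasure_crpLaw hα0 hα1 hα
  have := isProbabilityMeasure_crpLaw hα0 hα1 hθ1
  have := isProbabilityMeasure_coagSetLaw hα0 hα1 hθ
  have htail : Measurable fun (x : ℕ → ℕ) n => x (n + 1) := by fun_prop
  have := Measure.isProbabilityMeasure_map (μ := crpLaw α θ) htail.aemeasurable
  have := Measure.isProbabilityMeasure_map (μ := coagSetLaw α θ) measurable_memSeq.aemeasurable
  have hm1 := measurable_interleave (E := ℕ) (F := ℕ) zeroAt_congr 0
  have hm2 := measurable_interleave (E := ℕ) (F := Bool) newBlockAt_congr false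
  have hmark : Measurable splitMark := measurable_pi_lambda _ fun n =>
    measurable_of_prefix (n + 1) fun x y h => splitMark_prefix x y n h
  have h1 := (hasPrediction_tail_crpLaw hα0 hα1 hθ).interleave
    (hasPrediction_crpLaw hα0 hα1 hα) (fun n a b h e => crpRule_congr h e) zeroAt_congr 0
  have h2 := h1.map (v := splitMark) (r := markedRule α θ) splitMark_prefix
    (fun n b b' h z => markedRule_congr h z) fun n a ha z => by
      refine Eq.trans (tsum_congr fun e => ?_)
        ((isSplitSeq_of_splitRule (h1.prefixSet_succ_ne_zero ha)).tsum_splitRule hα0 hα1 hθ z)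
      by_cases he : splitMark (Function.update a n e) n = z
      · rw [if_pos he, if_pos he]
        rfl
      · rw [if_neg he, if_neg he]
  have h3 := (hasPrediction_crpLaw hα0 hα1 hθ1).interleave
    (hasPrediction_memSeq hα0 hα1 hθ) (fun n a b h e => urnRule_congr h e) newBlockAt_congr false
  have e1 : ((crpLaw α θ).map fun x n => x (n + 1)).prod (crpLaw α (1 - α)) =
      ((crpLaw α θ).prod (crpLaw α (1 - α))).map fun p => (fun n => p.1 (n + 1), p.2) := by
    have := Measure.map_prod_map (crpLaw α θ) (crpLaw α (1 - α)) htail measurable_id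
    rwa [Measure.map_id] at this
  have e2 : (crpLaw α (θ + 1)).prod ((coagSetLaw α θ).map memSeq) =
      ((crpLaw α (θ + 1)).prod (coagSetLaw α θ)).map fun p => (p.1, memSeq p.2) := by
    have := Measure.map_prod_map (crpLaw α (θ + 1)) (coagSetLaw α θ) measurable_id measurable_memSeq
    rwa [Measure.map_id] at this
  have hp1 : Measurable fun p : (ℕ → ℕ) × (ℕ → ℕ) => ((fun n => p.1 (n + 1), p.2) :
      (ℕ → ℕ) × (ℕ → ℕ)) := (htail.comp measurable_fst).prodMk measurable_snd
  rw [e1, Measure.map_map hm1 hp1, Measure.map_map hmark (hm1.comp hp1)] at h2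
  rw [e2, Measure.map_map hm2 measurable_interleave_memSeq] at h3
  have := Measure.isProbabilityMeasure_map (μ := (crpLaw α θ).prod (crpLaw α (1 - α)))
    (hmark.comp (hm1.comp hp1)).aemeasurable
  have := Measure.isProbabilityMeasure_map (μ := (crpLaw α (θ + 1)).prod (coagSetLaw α θ))
    (f := fun p => interleave NewBlockAt false p.1 (memSeq p.2))
    (hm2.comp measurable_interleave_memSeq).aemeasurable
  exact h2.eq h3

/-- The labels of a marked sequence, after merging the labels that carry a mark. -/
noncomputable def mergeMarked (w : ℕ → ℕ × Bool) (n : ℕ) : Option ℕ :=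
  lumpLabel {k | ∃ m ≤ n, w m = (k, true)} (w n).1

theorem measurable_rank_freq_mergeMarked : Measurable fun w => rank (freq (mergeMarked w)) := by
  refine measurable_rank.comp (measurable_pi_lambda _ fun z => Measurable.limsup fun n => ?_)
  refine measurable_of_prefix n fun x y h => ?_
  rw [occ_congr (L := mergeMarked x) (L' := mergeMarked y) (z' := z) fun m hm => ?_]
  have : {k | ∃ l ≤ m, x l = (k, true)} = {k | ∃ l ≤ m, y l = (k, true)} := by
    ext k
    exact exists_congr fun l => and_congr_right fun hl => by rw [h l (by omega)]
  rw [mergeMarked, mergeMarked, this, h m hm]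

/-- Merging the marked blocks coagulates the blocks whose index lies in `S`. -/
theorem mergeMarked_interleave {C : ℕ → ℕ} (hC : rg C = C) (S : Set ℕ) (n : ℕ) :
    mergeMarked (interleave NewBlockAt false C (memSeq S)) n = lumpLabel S (C n) := by
  classical
  have hnew {m : ℕ} (h : NewBlockAt C m) :
      interleave NewBlockAt false C (memSeq S) m = (C m, memSeq S (C m)) := by
    have hc := count_newBlockAt_rg C m
    rw [hC] at hc
    rw [interleave, if_pos h]
    have h' : C m = numBlocks C m := h
    refine Prod.ext rfl (congrArg (memSeq S) ?_)
    rw [h', ← hc]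
  have hiff : (∃ m ≤ n, interleave NewBlockAt false C (memSeq S) m = (C n, true)) ↔ C n ∈ S := by
    constructor
    · rintro ⟨m, -, hm⟩
      by_cases h : NewBlockAt C m
      · rw [hnew h, Prod.mk.injEq] at hm
        rw [← hm.1]
        exact of_decide_eq_true hm.2
      · rw [interleave, if_neg h] at hm
        exact absurd (congrArg Prod.snd hm) Bool.false_ne_true
    · intro h
      refine ⟨sInf {m | C m = C n}, firstOcc_le C rfl, ?_⟩
      rw [hnew, firstOcc_spec C]
      · exact Prod.ext rfl (decide_eq_true h)
      · have h1 : NewBlockAt (rg C) (sInf {m | C m = C n}) := by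
          rw [newBlockAt_rg, firstOcc_spec C]
          exact fun m hm => firstOcc_new C n hm
        rwa [hC] at h1
  change lumpLabel {k | ∃ m ≤ n, _ = (k, true)} (C n) = _
  by_cases h : C n ∈ S
  · rw [lumpLabel_eq_none.2 h, lumpLabel_eq_none]
    exact hiff.2 h
  · rw [lumpLabel_eq_some.2 ⟨h, rfl⟩, lumpLabel_eq_some]
    exact ⟨mt hiff.1 h, rfl⟩

theorem mergeMarked_splitMark (z : ℕ → ℕ × ℕ) (n : ℕ) :
    mergeMarked (splitMark z) n = if (z n).1 = 0 then none else some (rg z n) := by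
  classical
  have hiff : (∃ m ≤ n, splitMark z m = (rg z n, true)) ↔ (z n).1 = 0 := by
    constructor
    · rintro ⟨m, -, hm⟩
      have h1 : rg z m = rg z n := congrArg Prod.fst hm
      have h2 := of_decide_eq_true (congrArg Prod.snd hm)
      rw [← rg_eq_iff.1 h1]
      exact h2.2
    · intro h
      refine ⟨sInf {m | z m = z n}, firstOcc_le z rfl,
        Prod.ext (rg_eq_of_eq (firstOcc_spec z n)) ?_⟩
      rw [splitMark]
      refine decide_eq_true ⟨?_, ?_⟩
      · rw [newBlockAt_rg, firstOcc_spec z]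
        exact fun m hm => firstOcc_new z n hm
      · rw [firstOcc_spec z, h]
  change lumpLabel {k | ∃ m ≤ n, _ = (k, true)} (rg z n) = _
  split_ifs with h
  · exact lumpLabel_eq_none.2 (hiff.2 h)
  · exact lumpLabel_eq_some.2 ⟨mt hiff.1 h, rfl⟩

/-- Merging the marked fragments recovers the partition before fragmentation. -/
theorem mergeMarked_splitMark_interleave_eq_iff (X E : ℕ → ℕ) (l m : ℕ) :
    mergeMarked (splitMark (interleave ZeroAt 0 X E)) l =
      mergeMarked (splitMark (interleave ZeroAt 0 X E)) m ↔ X l = X m := by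
  classical
  rw [mergeMarked_splitMark, mergeMarked_splitMark]
  have h (n : ℕ) : (interleave ZeroAt 0 X E n).1 = X n := rfl
  have h' (n : ℕ) (hn : X n ≠ 0) : interleave ZeroAt 0 X E n = (X n, 0) := by
    rw [interleave, if_neg (show ¬ ZeroAt X n from hn)]
  rw [h, h]
  by_cases hl : X l = 0 <;> by_cases hm : X m = 0
  · simp [hl, hm]
  · simp [hl, hm, Ne.symm hm]
  · simp [hl, hm]
  · rw [if_neg hl, if_neg hm, Option.some_inj, rg_eq_iff, h' l hl, h' m hm]
    simp

end MarkedLaw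

/-! ### The fragmentation kernel and the duality -/

section Fragment

open Filter Topology

variable {α θ : ℝ}

open Classical in
/-- Independent labels in which the repetitions of the first label are replaced by the successive
terms of another sequence. The first label itself is dropped. -/
noncomputable def relabelFirst (L E : ℕ → ℕ) (n : ℕ) : {j : ℕ // j ≠ L 0} ⊕ ℕ :=
  if h : L (n + 1) = L 0 then Sum.inr (E (occ (fun m => L (m + 1)) (L 0) n))
  else Sum.inl ⟨L (n + 1), h⟩

theorem occ_relabelFirst_inr (L E : ℕ → ℕ) (j n : ℕ) :
    occ (relabelFirst L E) (Sum.inr j) n = occ E j (occ (fun m => L (m + 1)) (L 0) n) := by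
  induction n with
  | zero => simp
  | succ n ih =>
    rw [occ_succ, ih, occ_succ _ (L 0), relabelFirst]
    by_cases h : L (n + 1) = L 0
    · rw [dif_pos h, if_pos h, occ_succ]
      simp only [Sum.inr.injEq]
    · rw [dif_neg h, if_neg h]
      simp

/-- The block of the first label is replaced by fragments whose frequencies relative to it are
those of `E`. -/
theorem freq_relabelFirst {y : ℕ → ℝ} {L E : ℕ → ℕ} (hy : ∀ k, 0 < y k)
    (hL : ∀ k, HasFreq L k (y k)) (hE : ProperFreq E) :
    freq (relabelFirst L E) =
      Sum.elim (fun j : {j : ℕ // j ≠ L 0} => y j) fun j => y (L 0) * freq E j := by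
  have hL' (k : ℕ) : HasFreq (fun m => L (m + 1)) k (y k) := hasFreq_shift_iff.2 (hL k)
  funext z
  refine HasFreq.freq_eq ?_
  rcases z with ⟨j, hj⟩ | j
  · refine (hasFreq_iff_of_eventually (L' := fun m => L (m + 1)) (z' := j)
      (Eventually.of_forall fun m => ?_)).2 (hL' j)
    rw [relabelFirst]
    split_ifs with h
    · rw [h]
      simp [Ne.symm hj]
    · simp
  · have h0 := hL' (L 0)
    set t : ℕ → ℕ := fun n => occ (fun m => L (m + 1)) (L 0) n with ht
    have ht' : Tendsto t atTop atTop := by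
      have h1 : Tendsto (fun n : ℕ => (t n : ℝ) / n * n) atTop atTop :=
        h0.pos_mul_atTop (hy _) tendsto_natCast_atTop_atTop
      refine tendsto_natCast_atTop_iff.1 (h1.congr' ?_)
      filter_upwards [eventually_ne_atTop 0] with n hn
      field_simp
    have h2 : Tendsto (fun n => (t n : ℝ) / n * ((occ E j (t n) : ℝ) / t n)) atTop
        (𝓝 (y (L 0) * freq E j)) := h0.mul ((hE.1 j).comp ht')
    refine h2.congr fun n => ?_
    rw [occ_relabelFirst_inr]
    change (t n : ℝ) / n * ((occ E j (t n) : ℝ) / t n) = (occ E j (t n) : ℝ) / n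
    rcases eq_or_ne (t n) 0 with h | h
    · simp [h]
    · field_simp

/-- Fragments may be listed in any order. -/
theorem fragment_rank {y η : ℕ → ℝ} (hy : y ∈ massPartitions) (i : ℕ) (h0 : ∀ j, 0 < η j)
    (h1 : HasSum η 1) : fragment y i (rank η) = fragment y i η := by
  obtain ⟨σ, hσ⟩ := exists_perm_rank h0 h1
  have hy1 := le_one_of_hasSum (fun j => (hy.1 j).le) hy.2.2
  have hη1 := le_one_of_hasSum (fun j => (h0 j).le) h1
  have key := rank_comp_equiv (M := 1)
    (y := Sum.elim (fun j : {j : ℕ // j ≠ i} => y j) fun j : ℕ => y i * η j) ?_ ?_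
    (Equiv.sumCongr (Equiv.refl _) σ)
  · rw [fragment, fragment, hσ, ← key]
    congr 1
    funext z
    rcases z with z | z <;> rfl
  · rintro (j | j)
    · exact (hy.1 j).le
    · exact (mul_pos (hy.1 i) (h0 j)).le
  · rintro (j | j)
    · exact hy1 j
    · exact mul_le_one₀ (hy1 i) (h0 j).le (hη1 j)

/-- The labels after fragmenting the block of the first label. -/
theorem interleave_rg_eq_iff (L E : ℕ → ℕ) (l m : ℕ) :
    interleave ZeroAt 0 (fun n => rg L (n + 1)) E l =
      interleave ZeroAt 0 (fun n => rg L (n + 1)) E m ↔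
        relabelFirst L E l = relabelFirst L E m := by
  classical
  have h0 : rg L 0 = 0 := by
    rw [rg_of_new fun m hm => absurd hm m.not_lt_zero, numBlocks_zero]
  have hz (n : ℕ) : rg L (n + 1) = 0 ↔ L (n + 1) = L 0 := by
    rw [← rg_eq_iff (L := L), h0]
  have hocc (n : ℕ) : occ (fun m => rg L (m + 1)) 0 n = occ (fun m => L (m + 1)) (L 0) n :=
    occ_congr fun m _ => hz m
  have h1 (n : ℕ) (h : L (n + 1) = L 0) : interleave ZeroAt 0 (fun n => rg L (n + 1)) E n =
      (0, E (occ (fun m => L (m + 1)) (L 0) n)) := by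
    rw [interleave, if_pos (show ZeroAt (fun n => rg L (n + 1)) n from (hz n).2 h),
      count_zeroAt, hocc]
    exact Prod.ext ((hz n).2 h) rfl
  have h2 (n : ℕ) (h : L (n + 1) ≠ L 0) : interleave ZeroAt 0 (fun n => rg L (n + 1)) E n =
      (rg L (n + 1), 0) := by
    rw [interleave, if_neg (show ¬ ZeroAt (fun n => rg L (n + 1)) n from mt (hz n).1 h)]
  rw [relabelFirst, relabelFirst]
  by_cases hl : L (l + 1) = L 0 <;> by_cases hm : L (m + 1) = L 0
  · rw [h1 l hl, h1 m hm, dif_pos hl, dif_pos hm]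
    simp
  · rw [h1 l hl, h2 m hm, dif_pos hl, dif_neg hm]
    have := mt (hz m).1 hm
    simp [Ne.symm this]
  · rw [h2 l hl, h1 m hm, dif_neg hl, dif_pos hm]
    have := mt (hz l).1 hl
    simp [this]
  · rw [h2 l hl, h2 m hm, dif_neg hl, dif_neg hm]
    simp [rg_eq_iff]

/-- Extending a joint law by independent randomness: if `b` has law `κ y` given `y`, and `c` is
independent of both with law `ρ`, then `f y b c` has law `η y` given `y`. -/
theorem map_compProd_prod {A B C Y : Type*} [MeasurableSpace A] [MeasurableSpace B]
    [MeasurableSpace C] [MeasurableSpace Y] {μ : Measure A} [SFinite μ] {κ : Kernel A B}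
    [IsSFiniteKernel κ] {ρ : Measure C} [SFinite ρ] {f : A → B → C → Y}
    (hf : Measurable fun q : (A × B) × C => f q.1.1 q.1.2 q.2) {η : Kernel A Y} [IsSFiniteKernel η]
    (h : ∀ᵐ y ∂μ, ((κ y).prod ρ).map (fun p => f y p.1 p.2) = η y) :
    ((μ ⊗ₘ κ).prod ρ).map (fun q => (q.1.1, f q.1.1 q.1.2 q.2)) = μ ⊗ₘ η := by
  have hm : Measurable fun q : (A × B) × C => (q.1.1, f q.1.1 q.1.2 q.2) :=
    (measurable_fst.comp measurable_fst).prodMk hf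
  ext s hs
  rw [Measure.map_apply hm hs, Measure.prod_apply (hm hs), Measure.compProd_apply hs,
    Measure.lintegral_compProd (measurable_measure_prodMk_left (hm hs))]
  refine lintegral_congr_ae ?_
  filter_upwards [h] with y hy
  have hfy : Measurable fun p : B × C => f y p.1 p.2 := by
    have : Measurable ((fun q : (A × B) × C => f q.1.1 q.1.2 q.2) ∘
        fun p : B × C => ((y, p.1), p.2)) := hf.comp (by fun_prop)
    exact this
  rw [← hy, Measure.map_apply hfy (measurable_prodMk_left hs),
    Measure.prod_apply (hfy (measurable_prodMk_left hs))]
  rfl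

theorem map_rank_freq_crpLaw (hα0 : 0 ≤ α) (hα1 : α < 1) (hθ : -α < θ) :
    (crpLaw α θ).map (fun D => rank (freq D)) = PD α θ := by
  rw [PD, ← map_freq_crpLaw hα0 hα1 hθ, Measure.map_map measurable_rank measurable_freq]
  rfl

/-- The ranked frequencies before and after fragmenting the block of the first label of a Chinese
restaurant process. -/
theorem map_rank_freq_interleave (hα0 : 0 ≤ α) (hα1 : α < 1) (hθ : -α < θ) :
    ((crpLaw α θ).prod (crpLaw α (1 - α))).map (fun p => (rank (freq fun n => p.1 (n + 1)),
        rank (freq (interleave ZeroAt 0 (fun n => p.1 (n + 1)) p.2)))) =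
      PD α θ ⊗ₘ fragKernel α := by
  have hα : -α < 1 - α := by linarith
  have := isProbabilityMeasure_PD hα0 hα1 hθ
  have := isProbabilityMeasure_crpLaw hα0 hα1 hα
  have := isMarkovKernel_fragKernel hα0 hα1
  set ρ := crpLaw α (1 - α) with hρ
  have hrg : Measurable fun q : (ℕ → ℝ) × (ℕ → ℕ) => rg q.2 := measurable_rg.comp measurable_snd
  have hcrp : crpLaw α θ = (PD α θ ⊗ₘ labelKernel).map fun q => rg q.2 := by
    rw [← paintboxLaw_eq_crpLaw hα0 hα1 hθ, paintboxLaw, ← Measure.snd_compProd, Measure.snd,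
      Measure.map_map measurable_rg measurable_snd]
    rfl
  have htail : Measurable fun (x : ℕ → ℕ) n => x (n + 1) := by fun_prop
  have hprod : (crpLaw α θ).prod ρ =
      ((PD α θ ⊗ₘ labelKernel).prod ρ).map fun q => (rg q.1.2, q.2) := by
    have := Measure.map_prod_map (PD α θ ⊗ₘ labelKernel) ρ hrg measurable_id
    rw [Measure.map_id] at this
    rw [hcrp, this]
    rfl
  have hm1 : Measurable fun q : ((ℕ → ℝ) × (ℕ → ℕ)) × (ℕ → ℕ) => (rg q.1.2, q.2) :=
    (hrg.comp measurable_fst).prodMk measurable_snd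
  have hm2 : Measurable fun p : (ℕ → ℕ) × (ℕ → ℕ) => (rank (freq fun n => p.1 (n + 1)),
      rank (freq (interleave ZeroAt 0 (fun n => p.1 (n + 1)) p.2))) := by
    refine Measurable.prodMk ?_ ?_
    · exact measurable_rank.comp (measurable_freq.comp (htail.comp measurable_fst))
    · exact measurable_rank.comp (measurable_freq.comp ((measurable_interleave zeroAt_congr 0).comp
        ((htail.comp measurable_fst).prodMk measurable_snd)))
  have hrf : Measurable fun E : ℕ → ℕ => rank (freq E) := measurable_rank.comp measurable_freq
  have hf : Measurable fun q : ((ℕ → ℝ) × (ℕ → ℕ)) × (ℕ → ℕ) =>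
      fragment q.1.1 (q.1.2 0) (rank (freq q.2)) := by
    have : Measurable fun q : ((ℕ → ℝ) × (ℕ → ℕ)) × (ℕ → ℕ) =>
        (q.1.1, q.1.2 0, rank (freq q.2)) :=
      (measurable_fst.comp measurable_fst).prodMk (((measurable_pi_apply 0).comp
        (measurable_snd.comp measurable_fst)).prodMk (hrf.comp measurable_snd))
    exact measurable_fragment.comp this
  rw [hprod, Measure.map_map hm2 hm1, ← map_compProd_prod (κ := labelKernel) (ρ := ρ)
    (f := fun y L E => fragment y (L 0) (rank (freq E))) hf]
  · refine Measure.map_congr ?_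
    have h1 : ∀ᵐ q ∂(PD α θ ⊗ₘ labelKernel).prod ρ,
        (((∀ i, 0 < q.1.1 i) ∧ HasSum q.1.1 1) ∧ ∀ k, HasFreq q.1.2 k (q.1.1 k)) ∧
          q.1.1 ∈ massPartitions := by
      refine Measure.quasiMeasurePreserving_fst.ae
        (p := fun q : (ℕ → ℝ) × (ℕ → ℕ) =>
          (((∀ i, 0 < q.1 i) ∧ HasSum q.1 1) ∧ ∀ k, HasFreq q.2 k (q.1 k)) ∧
          q.1 ∈ massPartitions) ?_
      have hPD := ae_PD hα0 hα1 hθ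
      have hfst : ∀ᵐ q ∂(PD α θ ⊗ₘ labelKernel), q.1 ∈ massPartitions := by
        rw [← Measure.fst_compProd (PD α θ) labelKernel] at hPD
        exact ae_of_ae_map measurable_fst.aemeasurable hPD
      filter_upwards [hfst, ae_compProd_labelKernel (hPD.mono fun x hx => ⟨hx.1, hx.2.2⟩)]
        with q h1 h2
      exact ⟨h2, h1⟩
    have h2 : ∀ᵐ q ∂(PD α θ ⊗ₘ labelKernel).prod ρ,
        ProperFreq q.2 ∧ ∀ k, 0 < freq q.2 k :=
      Measure.quasiMeasurePreserving_snd.ae (p := fun E => ProperFreq E ∧ ∀ k, 0 < freq E k)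
        (ae_crpLaw hα0 hα1 hα)
    filter_upwards [h1, h2] with q hq hE
    obtain ⟨⟨⟨hy0, hy1⟩, hL⟩, hy⟩ := hq
    refine Prod.ext ?_ ?_
    · change rank (freq fun n => rg q.1.2 (n + 1)) = q.1.1
      have : freq (fun n => q.1.2 (n + 1)) = q.1.1 := by
        funext k
        exact (hasFreq_shift_iff.2 (hL k)).freq_eq
      rw [rank_freq_congr (L' := fun n => q.1.2 (n + 1)) fun l m => rg_eq_iff, this,
        rank_of_mem_massPartitions hy]
    · change rank (freq (interleave ZeroAt 0 (fun n => rg q.1.2 (n + 1)) q.2)) =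
        fragment q.1.1 (q.1.2 0) (rank (freq q.2))
      rw [rank_freq_congr (interleave_rg_eq_iff q.1.2 q.2), freq_relabelFirst hy0 hL hE.1,
        fragment_rank hy _ hE.2 hE.1.2]
      rfl
  · filter_upwards [ae_PD hα0 hα1 hθ] with y hy
    have hfy : Measurable fun p : ℕ × (ℕ → ℝ) => fragment y p.1 p.2 := by
      have : Measurable ((fun p : (ℕ → ℝ) × ℕ × (ℕ → ℝ) => fragment p.1 p.2.1 p.2.2) ∘
        Prod.mk y) := measurable_fragment.comp measurable_prodMk_left
      exact this
    have hpick : (labelKernel y).map (fun L => L 0) = pickLaw y := by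
      rw [pickLaw_eq_labelLaw hy, labelKernel_apply]
      exact Measure.infinitePi_map_eval _ 0
    have hprod' : (pickLaw y).prod (PD α (1 - α)) =
        ((labelKernel y).prod ρ).map fun p => (p.1 0, rank (freq p.2)) := by
      rw [← hpick, ← map_rank_freq_crpLaw hα0 hα1 hα]
      exact Measure.map_prod_map _ _ (measurable_pi_apply 0) hrf
    change _ = fragLaw α y
    rw [fragLaw, hprod', Measure.map_map hfy
      (((measurable_pi_apply 0).comp measurable_fst).prodMk (hrf.comp measurable_snd))]
    rfl

/-- The duality between fragmentation and coagulation. -/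
theorem swap_compProd_fragKernel (hα0 : 0 ≤ α) (hα1 : α < 1) (hθ : -α < θ) :
    (PD α θ ⊗ₘ fragKernel α).map Prod.swap = PD α (θ + 1) ⊗ₘ coagKernel α θ := by
  have hα : -α < 1 - α := by linarith
  have hθ1 : -α < θ + 1 := by linarith
  have := isProbabilityMeasure_crpLaw hα0 hα1 hθ
  have := isProbabilityMeasure_crpLaw hα0 hα1 hα
  have := isProbabilityMeasure_crpLaw hα0 hα1 hθ1
  have := isProbabilityMeasure_coagSetLaw hα0 hα1 hθ
  have := isMarkovKernel_coagKernel hα0 hα1 hθ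
  have htail : Measurable fun (x : ℕ → ℕ) n => x (n + 1) := by fun_prop
  have hrf : Measurable fun E : ℕ → ℕ => rank (freq E) := measurable_rank.comp measurable_freq
  let Φ : (ℕ → ℕ × Bool) → (ℕ → ℝ) × (ℕ → ℝ) := fun w =>
    (rank (freq fun n => (w n).1), rank (freq (mergeMarked w)))
  have hΦ : Measurable Φ :=
    (hrf.comp (by fun_prop : Measurable fun (w : ℕ → ℕ × Bool) n => (w n).1)).prodMk
      measurable_rank_freq_mergeMarked
  have hmark : Measurable splitMark := measurable_pi_lambda _ fun n =>
    measurable_of_prefix (n + 1) fun x y h => splitMark_prefix x y n h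
  have hm1 : Measurable fun p : (ℕ → ℕ) × (ℕ → ℕ) =>
      splitMark (interleave ZeroAt 0 (fun n => p.1 (n + 1)) p.2) :=
    hmark.comp ((measurable_interleave zeroAt_congr 0).comp
      ((htail.comp measurable_fst).prodMk measurable_snd))
  have hm2 : Measurable fun p : (ℕ → ℕ) × Set ℕ => interleave NewBlockAt false p.1 (memSeq p.2) :=
    (measurable_interleave newBlockAt_congr false).comp measurable_interleave_memSeq
  have key := congrArg (Measure.map Φ) (map_splitMark_eq hα0 hα1 hθ)
  rw [Measure.map_map hΦ hm1, Measure.map_map hΦ hm2] at key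
  have hm3 : Measurable fun p : (ℕ → ℕ) × (ℕ → ℕ) => (rank (freq fun n => p.1 (n + 1)),
      rank (freq (interleave ZeroAt 0 (fun n => p.1 (n + 1)) p.2))) := by
    refine Measurable.prodMk ?_ ?_
    · exact hrf.comp (htail.comp measurable_fst)
    · exact measurable_rank.comp (measurable_freq.comp ((measurable_interleave zeroAt_congr 0).comp
        ((htail.comp measurable_fst).prodMk measurable_snd)))
  have hcoal : Measurable fun p : (ℕ → ℕ) × Set ℕ => coalesce (freq p.1) p.2 := by
    have h : Measurable fun p : (ℕ → ℕ) × Set ℕ => (freq p.1, p.2) :=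
      (measurable_freq.comp measurable_fst).prodMk measurable_snd
    have h' : Measurable ((fun p : (ℕ → ℝ) × Set ℕ => coalesce p.1 p.2) ∘
        fun p : (ℕ → ℕ) × Set ℕ => (freq p.1, p.2)) := measurable_coalesce.comp h
    exact h'
  rw [← map_rank_freq_interleave hα0 hα1 hθ, Measure.map_map measurable_swap hm3,
    ← map_rank_freq_crpLaw hα0 hα1 hθ1, ← map_prod_eq_compProd (σ := coagSetLaw α θ)
      (f := fun C S => coalesce (freq C) S) hrf hcoal]
  · refine Eq.trans ?_ (key.trans ?_)
    · congr 1
      funext p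
      refine Prod.ext ?_ ?_
      · exact (rank_freq_congr fun l m => rg_eq_iff).symm
      · exact (rank_freq_congr (mergeMarked_splitMark_interleave_eq_iff _ _)).symm
    · refine Measure.map_congr ?_
      have h1 : ∀ᵐ C ∂crpLaw α (θ + 1), rg C = C ∧ ProperFreq C := by
        have h2 : ∀ᵐ C ∂crpLaw α (θ + 1), rg C = C := by
          rw [← paintboxLaw_eq_crpLaw hα0 hα1 hθ1, paintboxLaw]
          refine (ae_map_iff measurable_rg.aemeasurable (p := fun C => rg C = C)
            (measurableSet_eq_fun measurable_rg measurable_id)).2 (Eventually.of_forall fun L => ?_)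
          exact rg_congr fun l m => rg_eq_iff
        filter_upwards [h2, ae_crpLaw hα0 hα1 hθ1] with C h h'
        exact ⟨h, h'.1⟩
      filter_upwards [Measure.quasiMeasurePreserving_fst.ae
        (p := fun C => rg C = C ∧ ProperFreq C) h1] with p hp
      refine Prod.ext rfl ?_
      change rank (freq (mergeMarked _)) = coalesce (freq p.1) p.2
      rw [← hp.2.rank_freq_lumpLabel p.2]
      congr 2
      funext n
      exact mergeMarked_interleave hp.1 p.2 n
  · filter_upwards [ae_crpLaw hα0 hα1 hθ1] with C hC
    change _ = coagLaw α θ (rank (freq C))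
    rw [coagLaw_rank hC.2 hC.1.2]

end Fragment

/-! ### The Markov chain of ranked frequencies -/

section Chain

variable {α θ : ℝ}

theorem HasPrediction.map_treeFreq (hα0 : 0 ≤ α) (hα1 : α < 1) (hθ : -α < θ)
    {μ : Measure (ℕ → ℕ)} [IsProbabilityMeasure μ] (hμ : HasPrediction μ (treeRule α θ)) :
    μ.map treeFreq = PD α θ := by
  have hrf : Measurable fun D : ℕ → ℕ => rank (freq D) := measurable_rank.comp measurable_freq
  rw [← map_rank_freq_crpLaw hα0 hα1 hθ, ← hμ.map_subtreeSeq_eq hα0 hα1 hθ,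
    Measure.map_map hrf measurable_subtreeSeq]
  rfl

/-- The forward transition: the reversed transition, turned around by the duality. -/
theorem HasPrediction.map_treeFreq_contract_one (hα0 : 0 ≤ α) (hα1 : α < 1) (hθ : -α < θ)
    {μ : Measure (ℕ → ℕ)} [IsProbabilityMeasure μ] (hμ : HasPrediction μ (treeRule α θ)) :
    μ.map (fun x => (treeFreq x, treeFreq (contract 1 x))) = PD α θ ⊗ₘ fragKernel α := by
  have hc := measurable_contract 1
  have := Measure.isProbabilityMeasure_map (μ := μ) hc.aemeasurable
  have h := hμ.map_contract_treeFreq hα0 hα1 hθ measurable_treeFreq measurable_id fun _ => rfl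
  have h1 : μ.map (fun x => treeFreq (contract 1 x)) = PD α (θ + 1) := by
    rw [← (hμ.map_contract_one hα0 hα1 hθ).map_treeFreq hα0 hα1 (by linarith),
      Measure.map_map measurable_treeFreq hc]
    rfl
  have hm : Measurable fun x => (treeFreq (contract 1 x), treeFreq x) :=
    (measurable_treeFreq.comp hc).prodMk measurable_treeFreq
  rw [h1, Kernel.comap_id, ← swap_compProd_fragKernel hα0 hα1 hθ] at h
  have h2 := congrArg (Measure.map Prod.swap) h
  rw [Measure.map_map measurable_swap hm, Measure.map_map measurable_swap measurable_swap,
    Prod.swap_swap_eq, Measure.map_id] at h2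
  exact h2

/-- Two random variables that are conditionally independent given a third one may be generated in
either order. -/
theorem map_compProd_comap_fst {A B C : Type*} [MeasurableSpace A] [MeasurableSpace B]
    [MeasurableSpace C] {μ : Measure A} [SFinite μ] {κ : Kernel A B} {η : Kernel A C}
    [IsSFiniteKernel κ] [IsSFiniteKernel η] :
    ((μ ⊗ₘ η) ⊗ₘ κ.comap Prod.fst measurable_fst).map (fun q => ((q.1.1, q.2), q.1.2)) =
      (μ ⊗ₘ κ) ⊗ₘ η.comap Prod.fst measurable_fst := by
  have hm : Measurable fun q : (A × C) × B => ((q.1.1, q.2), q.1.2) := by fun_prop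
  ext s hs
  have hs' := hm hs
  rw [Measure.map_apply hm hs, Measure.compProd_apply hs, Measure.compProd_apply hs',
    Measure.lintegral_compProd (Kernel.measurable_kernel_prodMk_left hs),
    Measure.lintegral_compProd (Kernel.measurable_kernel_prodMk_left hs')]
  refine lintegral_congr fun a => ?_
  have ht : MeasurableSet {p : B × C | ((a, p.1), p.2) ∈ s} :=
    (by fun_prop : Measurable fun p : B × C => ((a, p.1), p.2)) hs
  have h1 := Measure.prod_apply (μ := κ a) (ν := η a) ht
  rw [Measure.prod_apply_symm ht] at h1
  exact h1

/-- The ranked frequencies of the first `n` contractions of a tree. -/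
noncomputable def freqHistory (n : ℕ) (x : ℕ → ℕ) (j : Fin n) : ℕ → ℝ := treeFreq (contract j x)

theorem measurable_freqHistory (n : ℕ) : Measurable (freqHistory n) :=
  measurable_pi_lambda _ fun j => measurable_treeFreq.comp (measurable_contract j)

theorem contract_contract_one (i : ℕ) (x : ℕ → ℕ) :
    contract i (contract 1 x) = contract (i + 1) x := by
  funext n
  simp only [contract, Nat.sub_sub, Nat.add_comm 1 i]
  rfl

/-- The ranked frequencies of successive contractions form a Markov chain. By induction on the
length of the history: given the states at all later times, the initial state depends on the next
state only, so conditioning on it does not change the last transition. -/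
theorem HasPrediction.map_freqHistory (hα0 : 0 ≤ α) (hα1 : α < 1) (hθ : -α < θ)
    {μ : Measure (ℕ → ℕ)} [IsProbabilityMeasure μ] (hμ : HasPrediction μ (treeRule α θ)) (i : ℕ) :
    μ.map (fun x => (freqHistory (i + 1) x, treeFreq (contract (i + 1) x))) =
      (μ.map (freqHistory (i + 1))) ⊗ₘ ((fragKernel α).comap
        (fun h : Fin (i + 1) → ℕ → ℝ => h (Fin.last i)) (measurable_pi_apply _)) := by
  have := isMarkovKernel_fragKernel hα0 hα1
  have hc := measurable_contract 1
  induction i generalizing θ μ with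
  | zero =>
    let c : (ℕ → ℝ) → Fin 1 → ℕ → ℝ := fun y _ => y
    have hcm : Measurable c := measurable_pi_lambda _ fun _ => measurable_id
    have h0 : μ.map (freqHistory 1) = (PD α θ).map c := by
      rw [← hμ.map_treeFreq hα0 hα1 hθ, Measure.map_map hcm measurable_treeFreq]
      congr 1
      funext x j
      rw [Subsingleton.elim j 0]
      rfl
    have h1 := hμ.map_treeFreq_contract_one hα0 hα1 hθ
    have h2 := congrArg (Measure.map (Prod.map c id)) h1
    have hm : Measurable fun x => (treeFreq x, treeFreq (contract 1 x)) :=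
      measurable_treeFreq.prodMk (measurable_treeFreq.comp hc)
    rw [Measure.map_map (hcm.prodMap measurable_id) hm] at h2
    rw [h0]
    refine Eq.trans ?_ (h2.trans ?_)
    · congr 1
      funext x
      refine Prod.ext (funext fun j : Fin 1 => ?_) rfl
      rw [Subsingleton.elim j 0]
      rfl
    · have := isProbabilityMeasure_PD hα0 hα1 hθ
      ext s hs
      rw [Measure.map_apply (hcm.prodMap measurable_id) hs, Measure.compProd_apply hs,
        Measure.compProd_apply (hcm.prodMap measurable_id hs),
        lintegral_map (Kernel.measurable_kernel_prodMk_left hs) hcm]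
      rfl
  | succ i ih =>
    have := isMarkovKernel_coagKernel hα0 hα1 hθ
    have hprob := Measure.isProbabilityMeasure_map (μ := μ) hc.aemeasurable
    have hμ' := hμ.map_contract_one hα0 hα1 hθ
    have hh := measurable_freqHistory (i + 1)
    have hlast : Measurable fun x => treeFreq (contract (i + 1) x) :=
      measurable_treeFreq.comp (measurable_contract _)
    have hpair := hh.prodMk hlast
    have ih' := ih (by linarith) hμ'
    rw [Measure.map_map hpair hc, Measure.map_map hh hc] at ih'
    -- the first state given all later ones
    have b1 := hμ.map_contract_treeFreq hα0 hα1 hθ hpair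
      (e := fun t : (Fin (i + 1) → ℕ → ℝ) × (ℕ → ℝ) => t.1 0) (by fun_prop) fun x => rfl
    have b2 := hμ.map_contract_treeFreq hα0 hα1 hθ hh
      (e := fun t : Fin (i + 1) → ℕ → ℝ => t 0) (by fun_prop) fun x => rfl
    set ν := μ.map fun x => freqHistory (i + 1) (contract 1 x) with hν
    have hprob' : IsProbabilityMeasure ν :=
      Measure.isProbabilityMeasure_map (hh.comp hc).aemeasurable
    set κ : Kernel (Fin (i + 1) → ℕ → ℝ) (ℕ → ℝ) :=
      (coagKernel α θ).comap (fun t : Fin (i + 1) → ℕ → ℝ => t 0) (by fun_prop) with hκ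
    set η : Kernel (Fin (i + 1) → ℕ → ℝ) (ℕ → ℝ) :=
      (fragKernel α).comap (fun t : Fin (i + 1) → ℕ → ℝ => t (Fin.last i)) (by fun_prop) with hη
    have ih'' : μ.map (fun x => (freqHistory (i + 1) (contract 1 x),
        treeFreq (contract (i + 1) (contract 1 x)))) = ν ⊗ₘ η := ih'
    rw [ih''] at b1
    have b1' : μ.map (fun x => ((freqHistory (i + 1) (contract 1 x),
        treeFreq (contract (i + 1) (contract 1 x))), treeFreq x)) =
        (ν ⊗ₘ η) ⊗ₘ κ.comap Prod.fst measurable_fst := b1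
    have hm0 : Measurable fun x => ((freqHistory (i + 1) (contract 1 x),
        treeFreq (contract (i + 1) (contract 1 x))), treeFreq x) :=
      (hpair.comp hc).prodMk measurable_treeFreq
    have key := congrArg (Measure.map fun q : ((Fin (i + 1) → ℕ → ℝ) × (ℕ → ℝ)) × (ℕ → ℝ) =>
      ((q.1.1, q.2), q.1.2)) b1'
    rw [map_compProd_comap_fst, Measure.map_map (by fun_prop) hm0, ← b2] at key
    let c : (Fin (i + 1) → ℕ → ℝ) × (ℕ → ℝ) → Fin (i + 1 + 1) → ℕ → ℝ :=
      fun q => Fin.cons q.2 q.1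
    have hcm : Measurable c := by
      refine measurable_pi_lambda _ fun j => ?_
      refine Fin.cases ?_ (fun j => ?_) j
      · exact measurable_snd
      · exact (measurable_pi_apply j).comp measurable_fst
    have hhist (x : ℕ → ℕ) : c (freqHistory (i + 1) (contract 1 x), treeFreq x) =
        freqHistory (i + 1 + 1) x := by
      funext j
      refine Fin.cases ?_ (fun j => ?_) j
      · rfl
      · change treeFreq (contract j (contract 1 x)) = treeFreq (contract (j + 1) x)
        rw [contract_contract_one]
    have hmb : Measurable fun x => (freqHistory (i + 1) (contract 1 x), treeFreq x) :=
      (hh.comp hc).prodMk measurable_treeFreq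
    have h2 := congrArg (Measure.map (Prod.map c id)) key
    rw [Measure.map_map (hcm.prodMap measurable_id)
      ((by fun_prop : Measurable fun q : ((Fin (i + 1) → ℕ → ℝ) × (ℕ → ℝ)) × (ℕ → ℝ) =>
        ((q.1.1, q.2), q.1.2)).comp hm0)] at h2
    refine Eq.trans ?_ (h2.trans ?_)
    · congr 1
      funext x
      refine Prod.ext (hhist x).symm ?_
      change treeFreq (contract (i + 1 + 1) x) = treeFreq (contract (i + 1) (contract 1 x))
      rw [contract_contract_one]
    · have hmap : μ.map (freqHistory (i + 1 + 1)) =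
          (μ.map fun x => (freqHistory (i + 1) (contract 1 x), treeFreq x)).map c := by
        rw [Measure.map_map hcm hmb]
        congr 1
        funext x
        exact (hhist x).symm
      rw [hmap]
      have := Measure.isProbabilityMeasure_map (μ := μ) hmb.aemeasurable
      have := Measure.isProbabilityMeasure_map (μ := μ.map fun x =>
        (freqHistory (i + 1) (contract 1 x), treeFreq x)) hcm.aemeasurable
      ext s hs
      rw [Measure.map_apply (hcm.prodMap measurable_id) hs, Measure.compProd_apply hs,
        Measure.compProd_apply (hcm.prodMap measurable_id hs),
        lintegral_map (Kernel.measurable_kernel_prodMk_left hs) hcm]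
      rfl

/-- The duality, as an equivalence between descriptions of a joint law. -/
theorem hasCondDistrib_frag_iff (hα0 : 0 ≤ α) (hα1 : α < 1) (hθ : -α < θ) {Ω : Type*}
    [MeasurableSpace Ω] {Q : Measure Ω} {X Y : Ω → ℕ → ℝ} :
    (HasLaw X (PD α θ) Q ∧ HasCondDistrib Y X (fragKernel α) Q) ↔
      (HasLaw Y (PD α (θ + 1)) Q ∧ HasCondDistrib X Y (coagKernel α θ) Q) := by
  have := isMarkovKernel_fragKernel hα0 hα1
  have := isMarkovKernel_coagKernel hα0 hα1 hθ
  have := isProbabilityMeasure_PD hα0 hα1 hθ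
  have := isProbabilityMeasure_PD hα0 hα1 (θ := θ + 1) (by linarith)
  have hdual := swap_compProd_fragKernel hα0 hα1 hθ
  have hdual' : (PD α (θ + 1) ⊗ₘ coagKernel α θ).map Prod.swap = PD α θ ⊗ₘ fragKernel α := by
    rw [← hdual, Measure.map_map measurable_swap measurable_swap, Prod.swap_swap_eq,
      Measure.map_id]
  -- a joint law determines the law of the second variable and the reversed conditional law
  have aux {μ ν : Measure (ℕ → ℝ)} [IsProbabilityMeasure μ] [IsProbabilityMeasure ν]
      {κ η : Kernel (ℕ → ℝ) (ℕ → ℝ)} [IsMarkovKernel κ] [IsMarkovKernel η]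
      (h : (μ ⊗ₘ κ).map Prod.swap = ν ⊗ₘ η) {U V : Ω → ℕ → ℝ}
      (hU : HasLaw U μ Q) (hV : HasCondDistrib V U κ Q) :
      HasLaw V ν Q ∧ HasCondDistrib U V η Q := by
    have hUV := hU.prodMk_of_hasCondDistrib hV
    have hVU : Q.map (fun ω => (V ω, U ω)) = ν ⊗ₘ η := by
      rw [← h, ← hUV.map_eq,
        AEMeasurable.map_map_of_aemeasurable measurable_swap.aemeasurable hUV.aemeasurable]
      rfl
    have hVν : Q.map V = ν := by
      have := congrArg (Measure.map Prod.fst) hVU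
      rw [AEMeasurable.map_map_of_aemeasurable measurable_fst.aemeasurable
        (hV.aemeasurable_snd.prodMk hU.aemeasurable)] at this
      exact this.trans (Measure.fst_compProd ν η)
    exact ⟨⟨hV.aemeasurable_snd, hVν⟩, hV.aemeasurable_snd.prodMk hU.aemeasurable,
      by rw [hVν, hVU]⟩
  exact ⟨fun h => aux hdual h.1 h.2, fun h => aux hdual' h.1 h.2⟩

end Chain

/-! ### Subtrees of the recursive tree -/

section RecursiveTree

variable {α θ : ℝ} {Ω : Type*} [MeasurableSpace Ω] {P : Measure Ω}
  {par : ℕ → Ω → ℕ}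

/-- The sequence of the parents of the vertices `1, 2, …`. -/
def parentSeq (par : ℕ → Ω → ℕ) (ω : Ω) (n : ℕ) : ℕ := par (n + 1) ω

theorem IsRecursiveTree.measurable_parentSeq (hT : IsRecursiveTree α θ par P) :
    Measurable (parentSeq par) :=
  measurable_pi_lambda _ fun _ => hT.measurable _

/-- Conditional laws of functions of `Z` may be computed under the law of `Z`. -/
theorem hasCondDistrib_of_map {A B C : Type*} [MeasurableSpace A] [MeasurableSpace B]
    [MeasurableSpace C] {Z : Ω → A} (hZ : Measurable Z) {f : A → B} {g : A → C}
    (hf : Measurable f) (hg : Measurable g) {κ : Kernel B C}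
    (h : (P.map Z).map (fun z => (f z, g z)) = ((P.map Z).map f) ⊗ₘ κ) {X : Ω → B} {Y : Ω → C}
    (hX : X =ᵐ[P] fun ω => f (Z ω)) (hY : Y =ᵐ[P] fun ω => g (Z ω)) :
    HasCondDistrib Y X κ P := by
  have hXY : (fun ω => (X ω, Y ω)) =ᵐ[P] fun ω => (f (Z ω), g (Z ω)) := hX.prodMk hY
  rw [Measure.map_map (hf.prodMk hg) hZ, Measure.map_map hf hZ] at h
  refine ⟨((hf.prodMk hg).comp hZ).aemeasurable.congr hXY.symm, ?_⟩
  rw [Measure.map_congr hXY, Measure.map_congr hX]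
  exact h

variable [IsProbabilityMeasure P]

theorem IsRecursiveTree.ae_properFreq (hα0 : 0 ≤ α) (hα1 : α < 1) (hθ : -α < θ)
    (hT : IsRecursiveTree α θ par P) :
    ∀ᵐ ω ∂P, (∀ n, par (n + 1) ω ≤ n) ∧ ∀ i,
      ProperFreq (subtreeSeq (contract i (parentSeq par ω))) ∧
        ∀ k, 0 < freq (subtreeSeq (contract i (parentSeq par ω))) k := by
  have hX := hT.measurable_parentSeq
  have hμ : HasPrediction (P.map (parentSeq par)) (treeRule α θ) := hT.hasPrediction hα0 hα1 hθ
  have := Measure.isProbabilityMeasure_map (μ := P) hX.aemeasurable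
  refine (ae_of_ae_map hX.aemeasurable hμ.ae_isParentSeq).and (ae_all_iff.2 fun i => ?_)
  have hc := measurable_contract i
  have := Measure.isProbabilityMeasure_map (μ := P.map (parentSeq par)) hc.aemeasurable
  have h := (hμ.map_contract hα0 hα1 hθ i).ae_properFreq hα0 hα1
      (by linarith [i.cast_nonneg (α := ℝ)])
  exact ae_of_ae_map hX.aemeasurable (ae_of_ae_map hc.aemeasurable h)

/-- The tree obtained by contracting the vertices `0, …, i` is again recursive. -/
theorem IsRecursiveTree.hasPrediction_contract (hα0 : 0 ≤ α) (hα1 : α < 1) (hθ : -α < θ)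
    (hT : IsRecursiveTree α θ par P) (i : ℕ) :
    HasPrediction (P.map fun ω => contract i (parentSeq par ω)) (treeRule α (θ + i)) := by
  have hX := hT.measurable_parentSeq
  have hμ : HasPrediction (P.map (parentSeq par)) (treeRule α θ) := hT.hasPrediction hα0 hα1 hθ
  have := Measure.isProbabilityMeasure_map (μ := P) hX.aemeasurable
  have h := hμ.map_contract hα0 hα1 hθ i
  rwa [Measure.map_map (measurable_contract i) hX] at h

theorem IsRecursiveTree.hasLaw_subtreeSeq (hα0 : 0 ≤ α) (hα1 : α < 1) (hθ : -α < θ)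
    (hT : IsRecursiveTree α θ par P) (i : ℕ) :
    HasLaw (fun ω => subtreeSeq (contract i (parentSeq par ω))) (crpLaw α (θ + i)) P := by
  have hX := (measurable_contract i).comp hT.measurable_parentSeq
  have hX' : Measurable fun ω => contract i (parentSeq par ω) := hX
  have := Measure.isProbabilityMeasure_map (μ := P) hX'.aemeasurable
  refine ⟨(measurable_subtreeSeq.comp hX).aemeasurable, ?_⟩
  rw [← (hT.hasPrediction_contract hα0 hα1 hθ i).map_subtreeSeq_eq hα0 hα1
    (by linarith [i.cast_nonneg (α := ℝ)]), Measure.map_map measurable_subtreeSeq hX']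
  rfl

theorem IsRecursiveTree.hasLaw_subtreeBlock (hα0 : 0 ≤ α) (hα1 : α < 1) (hθ : -α < θ)
    (hT : IsRecursiveTree α θ par P) (i : ℕ) :
    HasLaw (fun ω => subtreeBlock (fun n => par n ω) i)
      (exchangeablePartitionLaw α (θ + i) (Set.Ioi i)) P := by
  rw [exchangeablePartitionLaw_eq hα0 hα1 (by linarith [i.cast_nonneg (α := ℝ)])]
  have h := hT.hasLaw_subtreeSeq hα0 hα1 hθ i
  have h' : HasLaw (fun ω => classesFrom i (subtreeSeq (contract i (parentSeq par ω))))
      ((crpLaw α (θ + i)).map (classesFrom i)) P := by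
    refine ⟨(measurable_classesFrom i).comp_aemeasurable h.aemeasurable, ?_⟩
    rw [← h.map_eq, AEMeasurable.map_map_of_aemeasurable
      (measurable_classesFrom i).aemeasurable h.aemeasurable]
    rfl
  refine h'.congr ?_
  filter_upwards [hT.ae_properFreq hα0 hα1 hθ] with ω hω
  exact subtreeBlock_eq hω.1 i

theorem IsRecursiveTree.ae_subtreeFreq (hα0 : 0 ≤ α) (hα1 : α < 1) (hθ : -α < θ)
    (hT : IsRecursiveTree α θ par P) :
    ∀ᵐ ω ∂P, ∀ i, subtreeFreq (fun n => par n ω) i =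
      freq (subtreeSeq (contract i (parentSeq par ω))) := by
  filter_upwards [hT.ae_properFreq hα0 hα1 hθ] with ω hω i
  exact subtreeFreq_eq hω.1 (hω.2 i).1

theorem IsRecursiveTree.ae_rankedFreq (hα0 : 0 ≤ α) (hα1 : α < 1) (hθ : -α < θ)
    (hT : IsRecursiveTree α θ par P) :
    ∀ᵐ ω ∂P, ∀ i, rankedFreq (fun n => par n ω) i = treeFreq (contract i (parentSeq par ω)) := by
  filter_upwards [hT.ae_subtreeFreq hα0 hα1 hθ] with ω hω i
  rw [rankedFreq, hω i, treeFreq]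

theorem IsRecursiveTree.hasLaw_subtreeFreq (hα0 : 0 ≤ α) (hα1 : α < 1) (hθ : -α < θ)
    (hT : IsRecursiveTree α θ par P) (i : ℕ) :
    HasLaw (fun ω => subtreeFreq (fun n => par n ω) i) (GEM α (θ + i)) P := by
  have h := hT.hasLaw_subtreeSeq hα0 hα1 hθ i
  have h' : HasLaw (fun ω => freq (subtreeSeq (contract i (parentSeq par ω))))
      (GEM α (θ + i)) P := by
    refine ⟨measurable_freq.comp_aemeasurable h.aemeasurable, ?_⟩
    rw [← map_freq_crpLaw hα0 hα1 (by linarith [i.cast_nonneg (α := ℝ)]), ← h.map_eq,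
      AEMeasurable.map_map_of_aemeasurable measurable_freq.aemeasurable h.aemeasurable]
    rfl
  refine h'.congr ?_
  filter_upwards [hT.ae_subtreeFreq hα0 hα1 hθ] with ω hω
  exact hω i

theorem IsRecursiveTree.hasCondDistrib_history (hα0 : 0 ≤ α) (hα1 : α < 1) (hθ : -α < θ)
    (hT : IsRecursiveTree α θ par P) (i : ℕ) :
    HasCondDistrib (fun ω => rankedFreq (fun n => par n ω) (i + 1))
      (fun ω (j : Fin (i + 1)) => rankedFreq (fun n => par n ω) j)
      ((fragKernel α).comap (fun h : Fin (i + 1) → ℕ → ℝ => h (Fin.last i))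
        (measurable_pi_apply _)) P := by
  have hX := hT.measurable_parentSeq
  have hμ : HasPrediction (P.map (parentSeq par)) (treeRule α θ) := hT.hasPrediction hα0 hα1 hθ
  have := Measure.isProbabilityMeasure_map (μ := P) hX.aemeasurable
  refine hasCondDistrib_of_map hX (measurable_freqHistory (i + 1))
    (measurable_treeFreq.comp (measurable_contract (i + 1)))
    (hμ.map_freqHistory hα0 hα1 hθ i) ?_ ?_
  · filter_upwards [hT.ae_rankedFreq hα0 hα1 hθ] with ω hω
    funext j
    exact hω j
  · filter_upwards [hT.ae_rankedFreq hα0 hα1 hθ] with ω hω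
    exact hω (i + 1)

theorem IsRecursiveTree.hasCondDistrib_frag (hα0 : 0 ≤ α) (hα1 : α < 1) (hθ : -α < θ)
    (hT : IsRecursiveTree α θ par P) (i : ℕ) :
    HasCondDistrib (fun ω => rankedFreq (fun n => par n ω) (i + 1))
      (fun ω => rankedFreq (fun n => par n ω) i) (fragKernel α) P := by
  have hX := (measurable_contract i).comp hT.measurable_parentSeq
  have hX' : Measurable fun ω => contract i (parentSeq par ω) := hX
  have := Measure.isProbabilityMeasure_map (μ := P) hX'.aemeasurable
  have hθ' : -α < θ + i := by linarith [i.cast_nonneg (α := ℝ)]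
  have hμ := hT.hasPrediction_contract hα0 hα1 hθ i
  refine hasCondDistrib_of_map hX' measurable_treeFreq
    (measurable_treeFreq.comp (measurable_contract 1))
    ((hμ.map_treeFreq_contract_one hα0 hα1 hθ').trans ?_) ?_ ?_
  · rw [hμ.map_treeFreq hα0 hα1 hθ']
  · filter_upwards [hT.ae_rankedFreq hα0 hα1 hθ] with ω hω
    exact hω i
  · filter_upwards [hT.ae_rankedFreq hα0 hα1 hθ] with ω hω
    rw [hω, Function.comp_apply, contract_succ]

theorem IsRecursiveTree.hasCondDistrib_coag (hα0 : 0 ≤ α) (hα1 : α < 1) (hθ : -α < θ)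
    (hT : IsRecursiveTree α θ par P) (i : ℕ) :
    HasCondDistrib (fun ω => rankedFreq (fun n => par n ω) i)
      (fun ω => rankedFreq (fun n => par n ω) (i + 1)) (coagKernel α (θ + i)) P := by
  have hX := (measurable_contract i).comp hT.measurable_parentSeq
  have hX' : Measurable fun ω => contract i (parentSeq par ω) := hX
  have := Measure.isProbabilityMeasure_map (μ := P) hX'.aemeasurable
  have hθ' : -α < θ + i := by linarith [i.cast_nonneg (α := ℝ)]
  have hμ := hT.hasPrediction_contract hα0 hα1 hθ i
  have h := hμ.map_contract_treeFreq hα0 hα1 hθ' measurable_treeFreq measurable_id fun _ => rfl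
  rw [Kernel.comap_id] at h
  refine hasCondDistrib_of_map hX' (measurable_treeFreq.comp (measurable_contract 1))
    measurable_treeFreq h ?_ ?_
  · filter_upwards [hT.ae_rankedFreq hα0 hα1 hθ] with ω hω
    rw [hω, Function.comp_apply, contract_succ]
  · filter_upwards [hT.ae_rankedFreq hα0 hα1 hθ] with ω hω
    exact hω i

theorem IsRecursiveTree.ae_hasFrequency (hα0 : 0 ≤ α) (hα1 : α < 1) (hθ : -α < θ)
    (hT : IsRecursiveTree α θ par P) :
    ∀ᵐ ω ∂P, ∀ i k : ℕ, HasFrequency (Set.Ioi i) (subtreeBlock (fun n => par n ω) i k)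
      (subtreeFreq (fun n => par n ω) i k) := by
  filter_upwards [hT.ae_properFreq hα0 hα1 hθ, hT.ae_subtreeFreq hα0 hα1 hθ] with ω h1 h2 i k
  rw [h2, subtreeBlock_eq h1.1, hasFrequency_classesFrom_iff]
  exact (h1.2 i).1.1 k

theorem IsRecursiveTree.ae_rankedFreq_mem (hα0 : 0 ≤ α) (hα1 : α < 1) (hθ : -α < θ)
    (hT : IsRecursiveTree α θ par P) :
    ∀ᵐ ω ∂P, ∀ i : ℕ, rankedFreq (fun n => par n ω) i ∈ massPartitions := by
  filter_upwards [hT.ae_properFreq hα0 hα1 hθ, hT.ae_rankedFreq hα0 hα1 hθ] with ω h1 h2 i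
  rw [h2]
  exact rank_mem_massPartitions (h1.2 i).2 (h1.2 i).1.2

end RecursiveTree

end FragCoag

theorem theorem5p1 {Ω : Type*} [MeasurableSpace Ω] (P : Measure Ω) [IsProbabilityMeasure P]
    (α θ : ℝ) (hα0 : 0 ≤ α) (hα1 : α < 1) (hθ : -α < θ)
    (par : ℕ → Ω → ℕ) (hT : FragCoag.IsRecursiveTree α θ par P) :
    -- the blocks form an exchangeable `(α, θ + i)` partition
    (∀ i : ℕ, HasLaw (fun ω => FragCoag.subtreeBlock (fun n => par n ω) i)
      (FragCoag.exchangeablePartitionLaw α (θ + i) (Set.Ioi i)) P) ∧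
    -- asymptotic frequencies exist, form a mass partition when ranked, and have the GEM law
    (∀ᵐ ω ∂P, ∀ i k : ℕ, FragCoag.HasFrequency (Set.Ioi i)
      (FragCoag.subtreeBlock (fun n => par n ω) i k)
      (FragCoag.subtreeFreq (fun n => par n ω) i k)) ∧
    (∀ᵐ ω ∂P, ∀ i : ℕ, FragCoag.rankedFreq (fun n => par n ω) i ∈ FragCoag.massPartitions) ∧
    (∀ i : ℕ, HasLaw (fun ω => FragCoag.subtreeFreq (fun n => par n ω) i)
      (FragCoag.GEM α (θ + i)) P) ∧
    -- Markov property of the ranked frequencies: given the states at times `0, …, i`, the next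
    -- state is a fragmentation of the state at time `i`
    (∀ i : ℕ, HasCondDistrib (fun ω => FragCoag.rankedFreq (fun n => par n ω) (i + 1))
      (fun ω (j : Fin (i + 1)) => FragCoag.rankedFreq (fun n => par n ω) j)
      ((FragCoag.fragKernel α).comap (fun h : Fin (i + 1) → ℕ → ℝ => h (Fin.last i))
        (measurable_pi_apply _)) P) ∧
    (∀ i : ℕ, HasCondDistrib (fun ω => FragCoag.rankedFreq (fun n => par n ω) (i + 1))
      (fun ω => FragCoag.rankedFreq (fun n => par n ω) i) (FragCoag.fragKernel α) P) ∧
    -- reversed transitions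
    (∀ i : ℕ, HasCondDistrib (fun ω => FragCoag.rankedFreq (fun n => par n ω) i)
      (fun ω => FragCoag.rankedFreq (fun n => par n ω) (i + 1))
      (FragCoag.coagKernel α (θ + i)) P) ∧
    -- the duality between fragmentation and coagulation
    (∀ (Ω' : Type*) [MeasurableSpace Ω'] (Q : Measure Ω') [IsProbabilityMeasure Q]
      (X Y : Ω' → ℕ → ℝ),
      (HasLaw X (FragCoag.PD α θ) Q ∧ HasCondDistrib Y X (FragCoag.fragKernel α) Q) ↔
      (HasLaw Y (FragCoag.PD α (θ + 1)) Q ∧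
        HasCondDistrib X Y (FragCoag.coagKernel α θ) Q)) := by
  refine ⟨hT.hasLaw_subtreeBlock hα0 hα1 hθ, hT.ae_hasFrequency hα0 hα1 hθ,
    hT.ae_rankedFreq_mem hα0 hα1 hθ, hT.hasLaw_subtreeFreq hα0 hα1 hθ,
    hT.hasCondDistrib_history hα0 hα1 hθ, hT.hasCondDistrib_frag hα0 hα1 hθ,
    hT.hasCondDistrib_coag hα0 hα1 hθ, fun Ω' _ Q _ X Y => ?_⟩
  exact FragCoag.hasCondDistrib_frag_iff hα0 hα1 hθ
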